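/- Let $\Gamma\in L^\infty(\mathbb R)$ be real valued, $k_*\in\mathbb N=\{1,2,\dots\}$, $\lambda_*<1$, and put $\alpha=2\sqrt{1-\lambda_*}/k_*$. For $k\in\mathbb N$ and $\lambda\in\mathbb R$ let $\delta_0$ denote the operator $H^1(\mathbb R)\to H^{-1}(\mathbb R)$, $\langle\delta_0 f,g\rangle=f(0)g(0)$, and let $$L_\lambda^k=-\frac{d^2}{dy^2}+k^2\bigl(1-\lambda-\alpha\delta_0\bigr)$$ be the operator in $L^2(\mathbb R)$ with domain $\{\phi\in H^1(\mathbb R): L_\lambda^k\phi\in L^2(\mathbb R)\}$. Let $$\phi^*(y)=\sqrt{k_*\sqrt{1-\lambda_*}}\;e^{-k_*\sqrt{1-\lambda_*}\,|y|}.$$ Then $\phi^*\in H^1(\mathbb R)$ and there is an open interval $I\ni\lambda_*$ such that: 1. $L_\lambda^k$ is self-adjoint for all $k\in\mathbb N$, $\lambda\in\mathbb R$. 2. Zero is an isolated simple eigenvalue of $L_{\lambda_*}^{k_*}$, whose kernel is spanned by $\phi^*$, and $0\in\rho(L_\lambda^k)$ for all $(k,\lambda)\in\mathbb N\times I$ with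 $(k,\lambda)\ne(k_*,\lambda_*)$. 3. There are $C$ and $K$ such that $L_\lambda^k\phi=f\in L^2(\mathbb R)$ implies $\|\phi\|_{L^2}\le Ck^{-2}\|f\|_{L^2}$ and $\|\phi'\|_{L^2}\le Ck^{-1}\|f\|_{L^2}$ for all $k\ge K$, $\lambda\in I$. 4. $\langle\phi^*,\phi^*\rangle_{L^2}\ne0$ (transversality, with $V_0\equiv1$). Moreover, with $\mathbb T=\mathbb R/2\pi\mathbb Z$, there are $\varepsilon_0>0$ and a $C^\infty$ curve $$(-\varepsilon_0,\varepsilon_0)\ni\varepsilon\mapsto(\Phi(\varepsilon),\lambda(\varepsilon))\in\bigl(H^2(\mathbb T;L^2(\mathbb R))\cap H^1(\mathbb T;H^1(\mathbb R))\bigr)\times I$$ such that $\Phi(\varepsilon)$ is of the form $\sum_{k\in\mathbb N}\phi_k(y)\sin(kx)$, $\Phi(\varepsilon)\ne0$ for $\varepsilon\neq0$, and $\Phi=\Phi(\varepsilon)$ is a weak solution, for $\lambda=\lambda(\varepsilon)$, of $$-\Phi_{yy}-\bigl(1-\lambda-\alpha\delta_0(y)\bigr)\Phi_{xx}+\Gamma(y)(\Phi^3)_{xx}=0\quad\text{on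 }\mathbb T\times\mathbb R,$$ that is, $(\Phi^3)_{xx}\in L^2(\mathbb T\times\mathbb R)$ and $$\int_{\mathbb T}\int_{\mathbb R}\Phi_y\Psi_y-(1-\lambda)\Phi_{xx}\Psi\,dy\,dx-\alpha\int_{\mathbb T}\Phi_x(x,0)\Psi_x(x,0)\,dx+\int_{\mathbb T}\int_{\mathbb R}\Gamma(y)(\Phi^3)_{xx}\Psi\,dy\,dx=0$$ for all $\Psi\in H^1(\mathbb T;H^1(\mathbb R))$. So $u(t,x,y)=\Phi(x-t,y)$ is a traveling wave for $-\Delta u+\partial_t^2\bigl((\lambda+\alpha\delta_0(y))u+\Gamma(y)u^3\bigr)=0$. Furthermore $\Phi(0)=0$, $D_\varepsilon\Phi(0)(x,y)=\phi^*(y)\sin(k_*x)$, $\lambda(0)=\lambda_*$, $\dot\lambda(0)=0$ and $$\ddot\lambda(0)=-\frac32\,k_*^2(1-\lambda_*)\int_{\mathbb R}\Gamma(y)\,e^{-4k_*\sqrt{1-\lambda_*}\,|y|}\,dy .$$ -/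

import Mathlib

open MeasureTheory Set Filter Topology

set_option maxSynthPendingDepth 3

noncomputable section

namespace TravWave

/-! ### Lebesgue spaces on the line and the Sobolev space `H¹(ℝ)` -/

/-- `L²(ℝ)`, real valued. -/
abbrev L2R : Type := Lp ℝ 2 (volume : Measure ℝ)

/-- `L^∞(ℝ)`, real valued. -/
abbrev LinfR : Type := Lp ℝ ⊤ (volume : Measure ℝ)

/-- `v` is the weak derivative of `u` on the real line. -/
def IsWeakDerivR (u v : ℝ → ℝ) : Prop :=
  ∀ η : ℝ → ℝ, ContDiff ℝ (⊤ : ℕ∞) η → HasCompactSupport η →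
    ∫ y, deriv η y * u y = -∫ y, η y * v y

theorem locInt (u : L2R) : LocallyIntegrable (u : ℝ → ℝ) volume :=
  (Lp.memLp u).locallyIntegrable (by norm_num)

theorem test_mul_integrable {η : ℝ → ℝ} (hη : Continuous η) (hc : HasCompactSupport η)
    (u : L2R) : Integrable (fun y => η y * u y) volume := by
  simpa [smul_eq_mul] using
    (locInt u).integrable_smul_left_of_hasCompactSupport hη hc

theorem test_deriv_cont {η : ℝ → ℝ} (hη : ContDiff ℝ (⊤ : ℕ∞) η) : Continuous (deriv η) :=
  hη.continuous_deriv (by exact_mod_cast le_top)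

/-- `H¹(ℝ)`, realised as the pairs `(u, u')` in `L²(ℝ) × L²(ℝ)` such that `u'` is the weak
derivative of `u`, with the Hilbert norm `(‖u‖² + ‖u'‖²)^(1/2)`. -/
def H1 : Submodule ℝ (WithLp 2 (L2R × L2R)) where
  carrier := {p | IsWeakDerivR p.fst p.snd}
  zero_mem' := by
    intro η hη hc
    have h0 : (((0 : WithLp 2 (L2R × L2R)).fst : L2R) : ℝ → ℝ) =ᵐ[volume] 0 := Lp.coeFn_zero _ _ _
    have h1 : (((0 : WithLp 2 (L2R × L2R)).snd : L2R) : ℝ → ℝ) =ᵐ[volume] 0 := Lp.coeFn_zero _ _ _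
    rw [integral_eq_zero_of_ae, integral_eq_zero_of_ae, neg_zero]
    · filter_upwards [h1] with y _
      simp
    · filter_upwards [h0] with y _
      simp
  add_mem' := by
    intro p q hp hq η hη hc
    have h0 := Lp.coeFn_add p.fst q.fst
    have h1 := Lp.coeFn_add p.snd q.snd
    have e0 : ∫ y, deriv η y * ((p + q).fst : L2R) y
        = ∫ y, (deriv η y * p.fst y + deriv η y * q.fst y) := by
      apply integral_congr_ae
      filter_upwards [h0] with y hy
      rw [WithLp.add_fst, hy, Pi.add_apply, mul_add]
    have e1 : ∫ y, η y * ((p + q).snd : L2R) y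
        = ∫ y, (η y * p.snd y + η y * q.snd y) := by
      apply integral_congr_ae
      filter_upwards [h1] with y hy
      rw [WithLp.add_snd, hy, Pi.add_apply, mul_add]
    have hd := test_deriv_cont hη
    rw [e0, e1, integral_add (test_mul_integrable hd hc.deriv _)
      (test_mul_integrable hd hc.deriv _),
      integral_add (test_mul_integrable hη.continuous hc _)
      (test_mul_integrable hη.continuous hc _), hp η hη hc, hq η hη hc]
    ring
  smul_mem' := by
    intro c p hp η hη hc
    have h0 := Lp.coeFn_smul c p.fst
    have h1 := Lp.coeFn_smul c p.snd
    have e0 : ∫ y, deriv η y * ((c • p).fst : L2R) y = c * ∫ y, deriv η y * p.fst y := by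
      rw [← integral_const_mul]
      apply integral_congr_ae
      filter_upwards [h0] with y hy
      rw [WithLp.smul_fst, hy, Pi.smul_apply, smul_eq_mul]
      ring
    have e1 : ∫ y, η y * ((c • p).snd : L2R) y = c * ∫ y, η y * p.snd y := by
      rw [← integral_const_mul]
      apply integral_congr_ae
      filter_upwards [h1] with y hy
      rw [WithLp.smul_snd, hy, Pi.smul_apply, smul_eq_mul]
      ring
    rw [e0, e1, hp η hη hc]
    ring

/-- The inclusion `H¹(ℝ) → L²(ℝ)`. -/
def toL2 : H1 →L[ℝ] L2R := (WithLp.fstL 2 ℝ L2R L2R).comp H1.subtypeL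

/-- The weak derivative `H¹(ℝ) → L²(ℝ)`. -/
def dy : H1 →L[ℝ] L2R := (WithLp.sndL 2 ℝ L2R L2R).comp H1.subtypeL

theorem toL2_weakDeriv (φ : H1) : IsWeakDerivR (toL2 φ) (dy φ) := φ.2

theorem norm_toL2_le (φ : H1) : ‖toL2 φ‖ ≤ ‖φ‖ := WithLp.norm_fst_le _ (φ : WithLp 2 (L2R × L2R))

theorem norm_dy_le (φ : H1) : ‖dy φ‖ ≤ ‖φ‖ := WithLp.norm_snd_le _ (φ : WithLp 2 (L2R × L2R))

theorem dy_intervalIntegrable (v : L2R) (a b : ℝ) : IntervalIntegrable v volume a b :=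
  ((locInt v).integrableOn_isCompact isCompact_uIcc).intervalIntegrable

/-- Integration by parts for the primitive of an `L²` function. -/
theorem primitive_weakDeriv (v : L2R) : IsWeakDerivR (fun y => ∫ t in (0 : ℝ)..y, v t) v := by
  intro η hη hc
  obtain ⟨R, hR0, hR⟩ : ∃ R : ℝ, 0 < R ∧ tsupport η ⊆ Ioo (-R) R := by
    obtain ⟨R, hR⟩ := hc.isCompact.isBounded.subset_ball_lt 0 (0 : ℝ)
    refine ⟨R, hR.1, ?_⟩
    simpa [Real.ball_eq_Ioo] using hR.2
  have hs : Function.support η ⊆ Ioc (-R) R :=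
    (subset_tsupport η).trans (hR.trans Ioo_subset_Ioc_self)
  have hs' : Function.support (deriv η) ⊆ Ioc (-R) R :=
    (support_deriv_subset).trans (hR.trans Ioo_subset_Ioc_self)
  have i0 : ∫ y, deriv η y * ∫ t in (0 : ℝ)..y, v t
      = ∫ y in (-R)..R, deriv η y * ∫ t in (0 : ℝ)..y, v t := by
    rw [intervalIntegral.integral_eq_integral_of_support_subset]
    exact (Function.support_mul_subset_left _ _).trans hs'
  have i1 : ∫ y, η y * v y = ∫ y in (-R)..R, η y * v y := by
    rw [intervalIntegral.integral_eq_integral_of_support_subset]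
    exact (Function.support_mul_subset_left _ _).trans hs
  have acη : AbsolutelyContinuousOnInterval η (-R) R :=
    ((hη.of_le (by exact_mod_cast le_top) : ContDiff ℝ 1 η).contDiffOn).absolutelyContinuousOnInterval
  have acF : AbsolutelyContinuousOnInterval (fun y => ∫ t in (0 : ℝ)..y, v t) (-R) R :=
    (dy_intervalIntegrable v (-R) R).absolutelyContinuousOnInterval_intervalIntegral
      (by rw [uIcc_of_le (by linarith)]; constructor <;> linarith)
  have key := acη.integral_mul_deriv_eq_deriv_mul acF
  have z0 : η R = 0 := by
    by_contra h
    exact absurd (hR (subset_tsupport η h)).2 (lt_irrefl _)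
  have z1 : η (-R) = 0 := by
    by_contra h
    exact absurd (hR (subset_tsupport η h)).1 (lt_irrefl _)
  have hd : ∫ y in (-R)..R, η y * deriv (fun y => ∫ t in (0 : ℝ)..y, v t) y
      = ∫ y in (-R)..R, η y * v y := by
    apply intervalIntegral.integral_congr_ae
    filter_upwards [LocallyIntegrable.ae_hasDerivAt_integral (locInt v)] with y hy _
    rw [(hy 0).deriv]
  rw [hd, z0, z1] at key
  rw [i0, i1, key]
  ring

/-- A locally integrable function on the line with vanishing weak derivative is constant. -/
theorem const_of_weakDeriv_zero {w : ℝ → ℝ} (hw : LocallyIntegrable w volume)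
    (h : ∀ η : ℝ → ℝ, ContDiff ℝ (⊤ : ℕ∞) η → HasCompactSupport η → ∫ y, deriv η y * w y = 0) :
    ∃ c : ℝ, ∀ᵐ y, w y = c := by
  let b : ContDiffBump (0 : ℝ) := ⟨1, 2, one_pos, one_lt_two⟩
  let θ : ℝ → ℝ := b.normed volume
  have hθ : ContDiff ℝ (⊤ : ℕ∞) θ := b.contDiff_normed
  have hθc : HasCompactSupport θ := b.hasCompactSupport_normed
  have hθ1 : ∫ y, θ y = 1 := b.integral_normed
  have hint : ∀ g : ℝ → ℝ, Continuous g → HasCompactSupport g →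
      Integrable (fun y => g y * w y) volume := by
    intro g hg hgc
    simpa [smul_eq_mul] using hw.integrable_smul_left_of_hasCompactSupport hg hgc
  let c := ∫ y, θ y * w y
  refine ⟨c, ?_⟩
  have := ae_eq_zero_of_integral_contDiff_smul_eq_zero (μ := (volume : Measure ℝ))
    (f := fun y => w y - c) (hw.sub (locallyIntegrable_const c)) ?_
  · filter_upwards [this] with y hy
    linarith
  intro g hg hgc
  let m := ∫ y, g y
  let ψ : ℝ → ℝ := fun y => g y - m * θ y
  have hψ : ContDiff ℝ (⊤ : ℕ∞) ψ := hg.sub (contDiff_const.mul hθ)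
  have hψc : HasCompactSupport ψ := hgc.sub (hθc.mul_left)
  have gi : Integrable g volume := hg.continuous.integrable_of_hasCompactSupport hgc
  have θi : Integrable θ volume := hθ.continuous.integrable_of_hasCompactSupport hθc
  have ψi : Integrable ψ volume := gi.sub (θi.const_mul m)
  have hψ0 : ∫ y, ψ y = 0 := by
    change ∫ y, (g y - m * θ y) = 0
    rw [integral_sub gi (θi.const_mul m), integral_const_mul, hθ1]
    simp [m]
  obtain ⟨R, hR0, hR⟩ : ∃ R : ℝ, 0 < R ∧ tsupport ψ ⊆ Ioo (-R) R := by
    obtain ⟨R, hR⟩ := hψc.isCompact.isBounded.subset_ball_lt 0 (0 : ℝ)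
    refine ⟨R, hR.1, ?_⟩
    simpa [Real.ball_eq_Ioo] using hR.2
  have hs : Function.support ψ ⊆ Ioc (-R) R :=
    (subset_tsupport ψ).trans (hR.trans Ioo_subset_Ioc_self)
  have hz : ∀ y, y ∉ Ioc (-R) R → ψ y = 0 := by
    intro y hy
    by_contra h'
    exact hy (hs h')
  let η : ℝ → ℝ := fun y => ∫ t in (-R)..y, ψ t
  have hηd : ∀ y, HasDerivAt η (ψ y) y := fun y =>
    intervalIntegral.integral_hasDerivAt_right (hψ.continuous.intervalIntegrable _ _)
      (hψ.continuous.stronglyMeasurableAtFilter _ _) hψ.continuous.continuousAt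
  have hηd' : deriv η = ψ := funext fun y => (hηd y).deriv
  have hη : ContDiff ℝ (⊤ : ℕ∞) η := by
    rw [contDiff_infty_iff_deriv]
    exact ⟨fun y => (hηd y).differentiableAt, hηd' ▸ hψ⟩
  have hηc : HasCompactSupport η := by
    apply HasCompactSupport.of_support_subset_isCompact (isCompact_Icc (a := -R) (b := R))
    intro y hy
    by_contra hn
    apply hy
    rw [mem_Icc, not_and_or, not_le, not_le] at hn
    rcases hn with hn | hn
    · change ∫ t in (-R)..y, ψ t = 0
      apply intervalIntegral.integral_zero_ae
      filter_upwards with t ht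
      rw [uIoc_of_ge hn.le] at ht
      exact hz t fun h' => absurd ht.2 (not_le.2 h'.1)
    · change ∫ t in (-R)..y, ψ t = 0
      rw [intervalIntegral.integral_eq_integral_of_support_subset
        (hs.trans (Ioc_subset_Ioc_right hn.le)), hψ0]
  have key := h η hη hηc
  rw [hηd'] at key
  have e : ∫ y, ψ y * w y = (∫ y, g y * w y) - m * c := by
    have : (fun y => ψ y * w y) = fun y => g y * w y - m * (θ y * w y) := by
      funext y
      simp only [ψ]
      ring
    rw [this, integral_sub (hint g hg.continuous hgc)
      ((hint θ hθ.continuous hθc).const_mul m), integral_const_mul]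
  have : (fun y => g y • (w y - c)) = fun y => g y * w y - g y * c := by
    funext y
    simp only [smul_eq_mul]
    ring
  rw [this, integral_sub (hint g hg.continuous hgc) (gi.mul_const c), integral_mul_const]
  change (∫ y, g y * w y) - m * c = 0
  linarith

/-- Every element of `H¹(ℝ)` has a continuous representative, and it is a primitive of the weak
derivative. -/
theorem exists_rep (φ : H1) : ∃ f : ℝ → ℝ, Continuous f ∧ (toL2 φ : ℝ → ℝ) =ᵐ[volume] f ∧
    ∀ a b : ℝ, ∫ t in a..b, dy φ t = f b - f a := by
  have hF : Continuous fun y => ∫ t in (0 : ℝ)..y, dy φ t :=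
    intervalIntegral.continuous_primitive (dy_intervalIntegrable (dy φ)) 0
  obtain ⟨c, hc⟩ := const_of_weakDeriv_zero
    (w := fun y => toL2 φ y - ∫ t in (0 : ℝ)..y, dy φ t)
    ((locInt (toL2 φ)).sub hF.locallyIntegrable) (by
      intro η hη hηc
      have hd := test_deriv_cont hη
      have : (fun y => deriv η y * (toL2 φ y - ∫ t in (0 : ℝ)..y, dy φ t))
          = fun y => deriv η y * toL2 φ y - deriv η y * ∫ t in (0 : ℝ)..y, dy φ t := by
        funext y
        ring
      have hi : Integrable (fun y => deriv η y * ∫ t in (0 : ℝ)..y, dy φ t) volume :=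
        (hd.mul hF).integrable_of_hasCompactSupport hηc.deriv.mul_right
      rw [this, integral_sub (test_mul_integrable hd hηc.deriv _) hi,
        toL2_weakDeriv φ η hη hηc, primitive_weakDeriv (dy φ) η hη hηc]
      ring)
  refine ⟨fun y => c + ∫ t in (0 : ℝ)..y, dy φ t, continuous_const.add hF, ?_, ?_⟩
  · filter_upwards [hc] with y hy
    linarith
  · intro a b
    rw [← intervalIntegral.integral_interval_sub_left (dy_intervalIntegrable (dy φ) 0 b)
      (dy_intervalIntegrable (dy φ) 0 a)]
    ring

/-- The continuous representative of an element of `H¹(ℝ)`. -/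
def rep (φ : H1) : ℝ → ℝ := Classical.choose (exists_rep φ)

theorem rep_continuous (φ : H1) : Continuous (rep φ) := (Classical.choose_spec (exists_rep φ)).1

theorem rep_ae (φ : H1) : (toL2 φ : ℝ → ℝ) =ᵐ[volume] rep φ :=
  (Classical.choose_spec (exists_rep φ)).2.1

theorem rep_sub (φ : H1) (a b : ℝ) : ∫ t in a..b, dy φ t = rep φ b - rep φ a :=
  (Classical.choose_spec (exists_rep φ)).2.2 a b

theorem rep_unique (φ : H1) {f : ℝ → ℝ} (hf : Continuous f)
    (h : (toL2 φ : ℝ → ℝ) =ᵐ[volume] f) : rep φ = f :=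
  ((rep_continuous φ).ae_eq_iff_eq volume hf).1 ((rep_ae φ).symm.trans h)

/-- Point evaluation at `0` is bounded on `H¹(ℝ)`. -/
theorem rep_zero_bound (φ : H1) : |rep φ 0| ≤ 2 * ‖φ‖ := by
  have hI : ∀ v : L2R, ∫ t in (0 : ℝ)..1, |v t| ≤ ‖v‖ := by
    intro v
    have h1 : MemLp (v : ℝ → ℝ) 2 (volume.restrict (Ioc (0 : ℝ) 1)) := (Lp.memLp v).restrict _
    have h2 : eLpNorm (v : ℝ → ℝ) 1 (volume.restrict (Ioc (0 : ℝ) 1))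
        ≤ eLpNorm (v : ℝ → ℝ) 2 volume := by
      refine (eLpNorm_le_eLpNorm_mul_rpow_measure_univ (p := 1) (q := 2) (by norm_num) h1.1).trans ?_
      simp only [Measure.restrict_apply_univ, Real.volume_Ioc, sub_zero, ENNReal.ofReal_one,
        ENNReal.one_rpow, mul_one]
      exact eLpNorm_mono_measure _ Measure.restrict_le_self
    rw [intervalIntegral.integral_of_le zero_le_one]
    have h3 : ∫ t in Ioc (0 : ℝ) 1, |v t|
        = (eLpNorm (v : ℝ → ℝ) 1 (volume.restrict (Ioc (0 : ℝ) 1))).toReal := by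
      rw [eLpNorm_one_eq_lintegral_enorm, ← integral_norm_eq_lintegral_enorm h1.1]
      simp [Real.norm_eq_abs]
    rw [h3, Lp.norm_def]
    exact ENNReal.toReal_mono (Lp.memLp v).2.ne h2
  have hp : ∀ t ∈ Icc (0 : ℝ) 1, |rep φ 0| ≤ |rep φ t| + ‖dy φ‖ := by
    intro t ht
    have h1 := rep_sub φ 0 t
    have h2 : |∫ s in (0 : ℝ)..t, dy φ s| ≤ ‖dy φ‖ := by
      refine (intervalIntegral.abs_integral_le_integral_abs ht.1).trans ?_
      refine le_trans ?_ (hI (dy φ))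
      exact intervalIntegral.integral_mono_interval le_rfl ht.1 ht.2
        (Eventually.of_forall fun s => abs_nonneg _) (dy_intervalIntegrable (dy φ) 0 1).abs
    rw [h1] at h2
    have h3 : |rep φ 0| ≤ |rep φ t| + |rep φ t - rep φ 0| := by
      have := abs_sub_abs_le_abs_sub (rep φ 0) (rep φ t)
      rw [abs_sub_comm] at this
      linarith
    linarith
  have hc : Continuous fun t => |rep φ t| + ‖dy φ‖ := (rep_continuous φ).abs.add continuous_const
  have hm : ∫ _t in (0 : ℝ)..1, |rep φ 0| ≤ ∫ t in (0 : ℝ)..1, (|rep φ t| + ‖dy φ‖) :=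
    intervalIntegral.integral_mono_on zero_le_one intervalIntegrable_const
      (hc.intervalIntegrable _ _) hp
  rw [intervalIntegral.integral_add ((rep_continuous φ).abs.intervalIntegrable _ _)
    intervalIntegrable_const] at hm
  have hr : ∫ t in (0 : ℝ)..1, |rep φ t| = ∫ t in (0 : ℝ)..1, |toL2 φ t| := by
    apply intervalIntegral.integral_congr_ae
    filter_upwards [rep_ae φ] with t ht _
    rw [ht]
  rw [hr] at hm
  simp only [intervalIntegral.integral_const, sub_zero, one_smul] at hm
  have := hI (toL2 φ)
  have := norm_toL2_le φ
  have := norm_dy_le φ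
  linarith

/-- The evaluation `u ↦ u(0)` as a bounded functional on `H¹(ℝ)`. -/
def eval0 : H1 →L[ℝ] ℝ :=
  LinearMap.mkContinuous
    { toFun := fun φ => rep φ 0
      map_add' := by
        intro φ ψ
        have : rep (φ + ψ) = fun y => rep φ y + rep ψ y := by
          apply rep_unique _ ((rep_continuous φ).add (rep_continuous ψ))
          rw [map_add]
          filter_upwards [Lp.coeFn_add (toL2 φ) (toL2 ψ), rep_ae φ, rep_ae ψ] with y h1 h2 h3
          rw [h1, Pi.add_apply, h2, h3, Pi.add_apply]
        rw [this]
      map_smul' := by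
        intro c φ
        have : rep (c • φ) = fun y => c * rep φ y := by
          apply rep_unique _ (continuous_const.mul (rep_continuous φ))
          rw [map_smul]
          filter_upwards [Lp.coeFn_smul c (toL2 φ), rep_ae φ] with y h1 h2
          rw [h1, Pi.smul_apply, h2, smul_eq_mul, Pi.mul_apply]
        simp [this] }
    2 (fun φ => by simpa [Real.norm_eq_abs] using rep_zero_bound φ)

/-- `H⁻¹(ℝ)`, the dual space of `H¹(ℝ)`. -/
abbrev HNeg1 : Type := StrongDual ℝ H1

/-- Multiplication by the delta distribution at `0`, as a bounded operator `H¹(ℝ) → H⁻¹(ℝ)`: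
`⟨δ₀ f, g⟩ = f(0) g(0)`. -/
def delta0 : H1 →L[ℝ] HNeg1 := eval0.smulRight eval0

theorem delta0_apply (f g : H1) : delta0 f g = rep f 0 * rep g 0 := rfl

/-! ### The Schrödinger operators -/

/-- The bilinear form of `-d²/dy² + k² (1 - l V₀ - V₁)` on `H¹(ℝ)`. -/
def schroForm (V0 : LinfR) (V1 : H1 →L[ℝ] HNeg1) (k : ℕ) (l : ℝ) (φ ψ : H1) : ℝ :=
  inner ℝ (dy φ) (dy ψ) + (k : ℝ) ^ 2 * (inner ℝ (toL2 φ) (toL2 ψ)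
    - l * inner ℝ (V0 • toL2 φ : L2R) (toL2 ψ) - V1 φ ψ)

/-- The graph of the operator `L = -d²/dy² + k² (1 - l V₀ - V₁)` in `L²(ℝ)`: a pair `(φ, f)`
belongs to it iff `φ ∈ H¹(ℝ)`, `f ∈ L²(ℝ)` and `-φ'' + k² (1 - l V₀ - V₁) φ = f` in `H⁻¹(ℝ)`. -/
def schroGraph (V0 : LinfR) (V1 : H1 →L[ℝ] HNeg1) (k : ℕ) (l : ℝ) :
    Submodule ℝ (L2R × L2R) where
  carrier := {p | ∃ φ : H1, toL2 φ = p.1 ∧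
    ∀ ψ : H1, schroForm V0 V1 k l φ ψ = inner ℝ p.2 (toL2 ψ)}
  zero_mem' := ⟨0, by simp, fun ψ => by simp [schroForm, Lp.smul_zero]⟩
  add_mem' := by
    rintro p q ⟨φ, hφ, h⟩ ⟨φ', hφ', h'⟩
    refine ⟨φ + φ', by simp [hφ, hφ'], fun ψ => ?_⟩
    have e := h ψ
    have e' := h' ψ
    simp only [schroForm] at e e' ⊢
    rw [Prod.snd_add, inner_add_left, ← e, ← e']
    simp only [map_add, Lp.add_smul, inner_add_left, add_apply]
    ring
  smul_mem' := by
    rintro c p ⟨φ, hφ, h⟩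
    refine ⟨c • φ, by simp [hφ], fun ψ => ?_⟩
    have e := h ψ
    simp only [schroForm] at e ⊢
    rw [Prod.smul_snd, real_inner_smul_left, ← e]
    simp only [map_smul, ← Lp.smul_comm, real_inner_smul_left, smul_apply,
      smul_eq_mul]
    ring

/-- The operator `L = -d²/dy² + k² (1 - l V₀ - V₁)`, as an unbounded operator in `L²(ℝ)` with the
domain `{φ ∈ H¹(ℝ) | L φ ∈ L²(ℝ)}`. -/
def schro (V0 : LinfR) (V1 : H1 →L[ℝ] HNeg1) (k : ℕ) (l : ℝ) : L2R →ₗ.[ℝ] L2R :=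
  (schroGraph V0 V1 k l).toLinearPMap

theorem toL2_injective : Function.Injective toL2 := by
  rw [injective_iff_map_eq_zero]
  intro φ h0
  have hu : (toL2 φ : ℝ → ℝ) =ᵐ[volume] 0 := by
    rw [h0]
    exact Lp.coeFn_zero _ _ _
  have hv : dy φ = 0 := by
    rw [Lp.eq_zero_iff_ae_eq_zero]
    refine ae_eq_zero_of_integral_contDiff_smul_eq_zero (locInt (dy φ)) fun η hη hc => ?_
    have h1 := toL2_weakDeriv φ η hη hc
    have h2 : ∫ y, deriv η y * toL2 φ y = 0 := by
      apply integral_eq_zero_of_ae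
      filter_upwards [hu] with y hy
      simp [hy]
    simp only [smul_eq_mul]
    linarith
  apply Subtype.ext
  apply (WithLp.ofLp_injective 2)
  exact Prod.ext h0 hv

/-- A test function as an element of `H¹(ℝ)`. -/
theorem exists_test (η : ℝ → ℝ) (hη : ContDiff ℝ (⊤ : ℕ∞) η) (hc : HasCompactSupport η) :
    ∃ ψ : H1, (toL2 ψ : ℝ → ℝ) =ᵐ[volume] η := by
  have m0 : MemLp η 2 volume := hη.continuous.memLp_of_hasCompactSupport hc
  have m1 : MemLp (deriv η) 2 volume :=
    (test_deriv_cont hη).memLp_of_hasCompactSupport hc.deriv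
  refine ⟨⟨WithLp.toLp 2 (m0.toLp η, m1.toLp (deriv η)), ?_⟩, m0.coeFn_toLp⟩
  intro θ hθ hθc
  have e0 : ∫ y, deriv θ y * (m0.toLp η) y = ∫ y, deriv θ y * η y := by
    apply integral_congr_ae
    filter_upwards [m0.coeFn_toLp] with y hy
    rw [hy]
  have e1 : ∫ y, θ y * (m1.toLp (deriv η)) y = ∫ y, θ y * deriv η y := by
    apply integral_congr_ae
    filter_upwards [m1.coeFn_toLp] with y hy
    rw [hy]
  change ∫ y, deriv θ y * (m0.toLp η) y = -∫ y, θ y * (m1.toLp (deriv η)) y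
  rw [e0, e1]
  have hd : ∀ {g : ℝ → ℝ}, ContDiff ℝ (⊤ : ℕ∞) g → ∀ y, HasDerivAt g (deriv g y) y := fun h y =>
    ((h.differentiable (by simp)) y).hasDerivAt
  have := integral_mul_deriv_eq_deriv_mul_of_integrable (u := θ) (v := η) (u' := deriv θ)
    (v' := deriv η) (fun y _ => hd hθ y) (fun y _ => hd hη y)
    ((hθ.continuous.mul (test_deriv_cont hη)).integrable_of_hasCompactSupport hθc.mul_right)
    (((test_deriv_cont hθ).mul hη.continuous).integrable_of_hasCompactSupport hθc.deriv.mul_right)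
    ((hθ.continuous.mul hη.continuous).integrable_of_hasCompactSupport hθc.mul_right)
  rw [this, neg_neg]

theorem schroGraph_single (V0 : LinfR) (V1 : H1 →L[ℝ] HNeg1) (k : ℕ) (l : ℝ) (p : L2R × L2R)
    (hp : p ∈ schroGraph V0 V1 k l) (h0 : p.fst = 0) : p.snd = 0 := by
  obtain ⟨φ, hφ, h⟩ := hp
  have hφ0 : φ = 0 := toL2_injective (by rw [hφ, h0, map_zero])
  subst hφ0
  rw [Lp.eq_zero_iff_ae_eq_zero]
  refine ae_eq_zero_of_integral_contDiff_smul_eq_zero (locInt p.2) fun η hη hc => ?_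
  obtain ⟨ψ, hψ⟩ := exists_test η hη hc
  have h1 : inner ℝ p.2 (toL2 ψ) = 0 := by
    rw [← h ψ]
    simp [schroForm, Lp.smul_zero]
  rw [L2.inner_def] at h1
  rw [← h1]
  apply integral_congr_ae
  filter_upwards [hψ] with y hy
  simp [hy]

/-- The operator has the prescribed graph. -/
theorem schro_graph (V0 : LinfR) (V1 : H1 →L[ℝ] HNeg1) (k : ℕ) (l : ℝ) :
    (schro V0 V1 k l).graph = schroGraph V0 V1 k l :=
  Submodule.toLinearPMap_graph_eq _ (schroGraph_single V0 V1 k l)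

/-- The kernel of an unbounded operator. -/
def opKer (A : L2R →ₗ.[ℝ] L2R) : Submodule ℝ L2R :=
  (LinearMap.ker A.toFun).map A.domain.subtype

/-- `m` belongs to the resolvent set of `A`: the map `m - A : D(A) → L²(ℝ)` is bijective with a
bounded inverse `R`. -/
def InResolventSet (A : L2R →ₗ.[ℝ] L2R) (m : ℝ) : Prop :=
  ∃ R : L2R →L[ℝ] L2R,
    (∀ f : L2R, ∃ h : R f ∈ A.domain, m • R f - A ⟨R f, h⟩ = f) ∧
    ∀ u : A.domain, R (m • (u : L2R) - A u) = u

/-- Zero is an isolated simple eigenvalue of `A`. -/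
def ZeroIsolatedSimple (A : L2R →ₗ.[ℝ] L2R) : Prop :=
  Module.finrank ℝ (opKer A) = 1 ∧
    ∃ δ : ℝ, 0 < δ ∧ ∀ m : ℝ, m ≠ 0 → |m| < δ → InResolventSet A m

/-- The conditions (L1), (L2), (L3) on the family `L_l^k`, `k ≥ 1`, `l ∈ ℝ`, with wavenumber `ks`,
parameter value `ls` and open interval `I`, together with the condition that the kernel of
`L_{ls}^{ks}` is spanned by `φs` and the transversality condition `⟨V₀ φs, φs⟩ ≠ 0`.
Condition (L0) is contained in the types of `V₀` and `V₁`. -/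
structure BifurcationHyp (V0 : LinfR) (V1 : H1 →L[ℝ] HNeg1) (ks : ℕ) (ls : ℝ) (I : Set ℝ)
    (φs : H1) : Prop where
  selfAdjoint : ∀ k : ℕ, 1 ≤ k → ∀ l : ℝ, IsSelfAdjoint (schro V0 V1 k l)
  isOpen_I : IsOpen I
  ordConnected_I : I.OrdConnected
  mem_I : ls ∈ I
  simple : ZeroIsolatedSimple (schro V0 V1 ks ls)
  resolvent : ∀ k : ℕ, 1 ≤ k → ∀ l ∈ I, (k, l) ≠ (ks, ls) → InResolventSet (schro V0 V1 k l) 0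
  estimate : ∃ (C : ℝ) (K : ℕ), ∀ k : ℕ, 1 ≤ k → K ≤ k → ∀ l ∈ I, ∀ (φ : H1) (f : L2R),
    (toL2 φ, f) ∈ (schro V0 V1 k l).graph →
      ‖toL2 φ‖ ≤ C / (k : ℝ) ^ 2 * ‖f‖ ∧ ‖dy φ‖ ≤ C / (k : ℝ) * ‖f‖
  ker_eq : opKer (schro V0 V1 ks ls) = Submodule.span ℝ {toL2 φs}
  transversal : inner ℝ (V0 • toL2 φs : L2R) (toL2 φs) ≠ 0

/-! ### Bochner–Sobolev spaces on the torus -/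

/-- The `2π`-periodic torus, with the Lebesgue measure of total mass `2π`. -/
abbrev Torus : Type := AddCircle (2 * Real.pi)

instance factTwoPiPos : Fact ((0 : ℝ) < 2 * Real.pi) := ⟨Real.two_pi_pos⟩

/-- `L²(𝕋; E)`. -/
abbrev L2T (E : Type) [NormedAddCommGroup E] : Type := Lp E 2 (volume : Measure Torus)

/-- `v` is the weak derivative of the vector valued function `u` on the torus. Here `η` runs over
the smooth functions on the torus and `η'` is the derivative of `η`. -/
def IsWeakDerivT {E : Type} [NormedAddCommGroup E] [NormedSpace ℝ E] (u v : Torus → E) : Prop :=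
  ∀ η η' : Torus → ℝ, ContDiff ℝ (⊤ : ℕ∞) (fun s : ℝ => η s) →
    (∀ s : ℝ, HasDerivAt (fun s : ℝ => η s) (η' s) s) →
      ∫ x, η' x • u x = -∫ x, η x • v x

theorem torus_test_continuous {η : Torus → ℝ} (h : Continuous fun s : ℝ => η s) : Continuous η :=
  (QuotientAddGroup.isQuotientMap_mk (N := AddSubgroup.zmultiples (2 * Real.pi))).continuous_iff.2 h

theorem torus_test_deriv_continuous {η η' : Torus → ℝ}
    (h : ContDiff ℝ (⊤ : ℕ∞) (fun s : ℝ => η s))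
    (h' : ∀ s : ℝ, HasDerivAt (fun s : ℝ => η s) (η' s) s) : Continuous η' := by
  apply torus_test_continuous
  have : (fun s : ℝ => η' s) = deriv fun s : ℝ => η s := funext fun s => (h' s).deriv.symm
  rw [this]
  exact test_deriv_cont h

theorem torus_test_integrable {E : Type} [NormedAddCommGroup E] [NormedSpace ℝ E]
    {η : Torus → ℝ} (h : Continuous η) (u : L2T E) : Integrable (fun x => η x • u x) volume := by
  obtain ⟨C, hC⟩ := isCompact_univ.exists_bound_of_continuousOn h.continuousOn
  exact ((Lp.memLp u).integrable (by norm_num)).bdd_smul C h.aestronglyMeasurable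
    (Eventually.of_forall fun x => hC x (mem_univ x))

theorem weakDerivT_zero {E : Type} [NormedAddCommGroup E] [NormedSpace ℝ E] {u v : Torus → E}
    (hu : u =ᵐ[volume] 0) (hv : v =ᵐ[volume] 0) : IsWeakDerivT u v := by
  intro η η' _ _
  rw [integral_eq_zero_of_ae, integral_eq_zero_of_ae, neg_zero]
  · filter_upwards [hv] with y hy
    simp [hy]
  · filter_upwards [hu] with y hy
    simp [hy]

theorem weakDerivT_add {E : Type} [NormedAddCommGroup E] [NormedSpace ℝ E]
    {u v u' v' : L2T E} (h : IsWeakDerivT u v) (h' : IsWeakDerivT u' v') :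
    IsWeakDerivT (u + u' : L2T E) (v + v' : L2T E) := by
  intro η η' hη hη'
  have c := torus_test_continuous hη.continuous
  have c' := torus_test_deriv_continuous hη hη'
  have e0 : ∫ x, η' x • (u + u' : L2T E) x = ∫ x, (η' x • u x + η' x • u' x) := by
    apply integral_congr_ae
    filter_upwards [Lp.coeFn_add u u'] with x hx
    rw [hx, Pi.add_apply, smul_add]
  have e1 : ∫ x, η x • (v + v' : L2T E) x = ∫ x, (η x • v x + η x • v' x) := by
    apply integral_congr_ae
    filter_upwards [Lp.coeFn_add v v'] with x hx
    rw [hx, Pi.add_apply, smul_add]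
  rw [e0, e1, integral_add (torus_test_integrable c' _) (torus_test_integrable c' _),
    integral_add (torus_test_integrable c _) (torus_test_integrable c _), h η η' hη hη',
    h' η η' hη hη', neg_add]

theorem weakDerivT_smul {E : Type} [NormedAddCommGroup E] [NormedSpace ℝ E]
    (a : ℝ) {u v : L2T E} (h : IsWeakDerivT u v) :
    IsWeakDerivT (a • u : L2T E) (a • v : L2T E) := by
  intro η η' hη hη'
  have e0 : ∫ x, η' x • (a • u : L2T E) x = a • ∫ x, η' x • u x := by
    rw [← integral_smul]
    apply integral_congr_ae
    filter_upwards [Lp.coeFn_smul a u] with x hx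
    rw [hx, Pi.smul_apply, smul_comm]
  have e1 : ∫ x, η x • (a • v : L2T E) x = a • ∫ x, η x • v x := by
    rw [← integral_smul]
    apply integral_congr_ae
    filter_upwards [Lp.coeFn_smul a v] with x hx
    rw [hx, Pi.smul_apply, smul_comm]
  rw [e0, e1, h η η' hη hη', smul_neg]

/-- The inclusion `L²(𝕋; H¹(ℝ)) → L²(𝕋; L²(ℝ))`. -/
def toL2T : L2T H1 →L[ℝ] L2T L2R := toL2.compLpL 2 (volume : Measure Torus)

/-- The space `H²(𝕋; L²(ℝ)) ∩ H¹(𝕋; H¹(ℝ))`, realised as the triples `(Φ, Φₓ, Φₓₓ)` with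
`Φ, Φₓ ∈ L²(𝕋; H¹(ℝ))`, `Φₓₓ ∈ L²(𝕋; L²(ℝ))`, where `Φₓ` is the weak derivative of `Φ` and `Φₓₓ`
is the weak derivative of `Φₓ`; it carries the norm induced by the three spaces. -/
def SolSpace : Submodule ℝ (L2T H1 × L2T H1 × L2T L2R) where
  carrier := {p | IsWeakDerivT p.1 p.2.1 ∧ IsWeakDerivT (toL2T p.2.1) p.2.2}
  zero_mem' := by
    refine ⟨weakDerivT_zero (Lp.coeFn_zero _ _ _) (Lp.coeFn_zero _ _ _), ?_⟩
    refine weakDerivT_zero ?_ (Lp.coeFn_zero _ _ _)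
    simp only [Prod.snd_zero, Prod.fst_zero, map_zero]
    exact Lp.coeFn_zero _ _ _
  add_mem' := by
    rintro p q ⟨h1, h2⟩ ⟨h3, h4⟩
    refine ⟨weakDerivT_add h1 h3, ?_⟩
    simp only [Prod.snd_add, Prod.fst_add, map_add]
    exact weakDerivT_add h2 h4
  smul_mem' := by
    rintro c p ⟨h1, h2⟩
    refine ⟨weakDerivT_smul c h1, ?_⟩
    simp only [Prod.smul_snd, Prod.smul_fst, map_smul]
    exact weakDerivT_smul c h2

/-- The function `Φ` of a triple `(Φ, Φₓ, Φₓₓ)`. -/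
abbrev solVal (Φ : SolSpace) : L2T H1 := (Φ : L2T H1 × L2T H1 × L2T L2R).1

/-- The derivative `Φₓ` of a triple `(Φ, Φₓ, Φₓₓ)`. -/
abbrev solDx (Φ : SolSpace) : L2T H1 := (Φ : L2T H1 × L2T H1 × L2T L2R).2.1

/-- The second derivative `Φₓₓ` of a triple `(Φ, Φₓ, Φₓₓ)`. -/
abbrev solDxx (Φ : SolSpace) : L2T L2R := (Φ : L2T H1 × L2T H1 × L2T L2R).2.2

/-- `G = (Φ³)ₓₓ`: the cube `C` of `Φ` belongs to `L²(𝕋; L²(ℝ))`, and `G ∈ L²(𝕋; L²(ℝ))` is its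
second weak derivative. -/
def IsCubeDxx (Φ : L2T H1) (G : L2T L2R) : Prop :=
  ∃ C B : L2T L2R,
    (∀ᵐ x : Torus, (C x : ℝ → ℝ) =ᵐ[volume] fun y => (toL2 (Φ x) : ℝ → ℝ) y ^ 3) ∧
    IsWeakDerivT C B ∧ IsWeakDerivT B G

/-- `Φ` is a weak solution of `-Φ_yy - (1 - l V₀ - V₁) Φ_xx + Γ (Φ³)_xx = 0`. The test functions
`Ψ` run over `H¹(𝕋; H¹(ℝ))`, with weak derivative `Ψx`. -/
def IsWeakSolution (V0 : LinfR) (V1 : H1 →L[ℝ] HNeg1) (Γ : LinfR) (l : ℝ) (Φ : SolSpace) : Prop :=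
  ∃ G : L2T L2R, IsCubeDxx (solVal Φ) G ∧
    ∀ Ψ Ψx : L2T H1, IsWeakDerivT Ψ Ψx →
      (∫ x, (inner ℝ (dy (solVal Φ x)) (dy (Ψ x))
          - inner ℝ (solDxx Φ x - l • (V0 • solDxx Φ x : L2R)) (toL2 (Ψ x))))
        - (∫ x, V1 (solDx Φ x) (Ψx x))
        + (∫ x, inner ℝ (Γ • G x : L2R) (toL2 (Ψ x))) = 0

/-- The function `x ↦ sin (k x)` on the torus. -/
def sinMode (k : ℕ) : Torus → ℝ :=
  Function.Periodic.lift (f := fun s : ℝ => Real.sin (k * s)) (fun s => by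
    have : (k : ℝ) * (s + 2 * Real.pi) = k * s + k * (2 * Real.pi) := by ring
    simp only [this, Real.sin_add_nat_mul_two_pi])

theorem sinMode_coe (k : ℕ) (s : ℝ) : sinMode k (s : Torus) = Real.sin (k * s) := rfl

theorem sinMode_continuous (k : ℕ) : Continuous (sinMode k) :=
  torus_test_continuous (by
    simp only [sinMode_coe]
    fun_prop)

/-- The function `(x, y) ↦ φ(y) sin (k x)` as an element of `L²(𝕋; H¹(ℝ))`. -/
def sinTensor (k : ℕ) (φ : H1) : L2T H1 :=
  MemLp.toLp (fun x => sinMode k x • φ)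
    (((sinMode_continuous k).smul continuous_const).memLp_of_hasCompactSupport
      (HasCompactSupport.of_compactSpace _))

/-- `Φ` is of the form `Φ(x, y) = ∑_{k ≥ 1} φ_k(y) sin (k x)`. -/
def IsSineSeries (Φ : L2T H1) : Prop :=
  ∃ φ : ℕ → H1, HasSum (fun k : ℕ => sinTensor (k + 1) (φ k)) Φ

/-- The constant function `1` in `L^∞(ℝ)`. -/
def oneLinf : LinfR := MemLp.toLp (fun _ : ℝ => (1 : ℝ)) (memLp_top_const 1)

end TravWave

end

noncomputable section

namespace TravWave

/-! ### The Sobolev space `H¹(ℝ)` -/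

/-! Everything spectral is explicit, because `exp (-κ|y|)` is `2κ` times the Green function at `0`
of `-d²/dy² + κ²` (`expH1_green`). Hence `-φ'' + κ² φ - β φ(0) δ₀ = f` is the free equation plus a
rank-one correction: `φ` is the free solution plus a multiple of the exponential, and evaluation at
`0` fixes the multiple unless `β = 2κ` (`Solves.eq_pointRes`). For `L_λ^k` one has `κ = k √(1-λ)`
and `β = k² α`, so resonance means `k α = 2 √(1-λ)`. The choice of `α` puts it at `(k_*, λ_*)`, and
since wavenumbers are integers, the other `k` keep a uniform distance from it for `λ` near `λ_*`
(`nonresonance`). Self-adjointness follows from symmetry and one real resolvent point.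

For the nonlinear problem the unknown is not `Φ` but the sequence `F` of right-hand sides: `Φ = ∑ₖ
sin (k x) Tₖ Fₖ`, where `Tₖ` inverts `L_{λ_*}^k` and, for `k = k_*`, does so off the kernel and is
the identity on it (`ModeInverse`). With `λ = λ_* + ν`, `P` the projection onto the critical mode
and `A F = (k² Tₖ Fₖ)ₖ`, the weak equation follows from `F - P F - ν A F = Γ · (k² (Φ³)ₖ)ₖ`
(`isWeakSolution_toSol`). This is posed in `ℓ¹(ℕ; L²(ℝ))`, where bounded multilinear maps are
determined by single modes and uniform bounds on single modes suffice to define them. The weight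
`k²` on the cube is affordable because an output frequency is at most the sum of the three input
frequencies, and `Tₖ` gains `k²` in `L²` while all factors stay bounded in `H¹ ⊆ L^∞`
(`norm_signedSingle_triple_le`).

The abstract equation `F - P F - m A F = N(F, F, F)` is solved by a scaled Lyapunov–Schmidt
reduction (`exists_bifurcation_curve`). Put `s = ε²`, `F = ε (e + (1 - P) Z)` and `m = l(Z)`, where
`l` is chosen so that `l(Z) A e = -P Z`; the single unknown `Z` then carries both the correction and
the parameter. After division by `ε` the linearisation in `Z` at the origin is the identity, and the
analytic implicit function theorem gives `Z(s)` with `Z'(0) = N(e, e, e)`. Hence `m''(0) = 2 l(N(e,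
e, e))`, and the coefficient `3/4` of `sin` in `sin³` turns this into `-(3/2) ∫ Γ φ*⁴`. -/

theorem inner_L2R (u v : L2R) : inner ℝ u v = ∫ y, u y * v y := by
  rw [L2.inner_def]
  refine integral_congr_ae (Eventually.of_forall fun y => ?_)
  simp [mul_comm]

theorem inner_L2R_of_ae {u v : L2R} {f g : ℝ → ℝ} (hf : (u : ℝ → ℝ) =ᵐ[volume] f)
    (hg : (v : ℝ → ℝ) =ᵐ[volume] g) : inner ℝ u v = ∫ y, f y * g y := by
  rw [inner_L2R]
  apply integral_congr_ae
  filter_upwards [hf, hg] with y h1 h2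
  rw [h1, h2]

/-- Each test function imposes an equality between `L²` inner products with fixed vectors, which is
a closed condition. The resulting completeness is needed for Lax–Milgram. -/
theorem isClosed_H1 : IsClosed (H1 : Set (WithLp 2 (L2R × L2R))) := by
  have : (H1 : Set (WithLp 2 (L2R × L2R))) = ⋂ (η : ℝ → ℝ) (_ : ContDiff ℝ (⊤ : ℕ∞) η)
      (_ : HasCompactSupport η), {p | ∫ y, deriv η y * p.fst y = -∫ y, η y * p.snd y} := by
    ext p
    simp only [mem_iInter, mem_ofPred_eq]
    rfl
  rw [this]
  refine isClosed_iInter fun η => isClosed_iInter fun hη => isClosed_iInter fun hc => ?_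
  have m0 : MemLp η 2 volume := hη.continuous.memLp_of_hasCompactSupport hc
  have m1 : MemLp (deriv η) 2 volume :=
    (test_deriv_cont hη).memLp_of_hasCompactSupport hc.deriv
  have e : ∀ p : WithLp 2 (L2R × L2R), (∫ y, deriv η y * p.fst y = -∫ y, η y * p.snd y) ↔
      inner ℝ (m1.toLp _) p.fst = -inner ℝ (m0.toLp _) p.snd := fun p => by
    rw [inner_L2R_of_ae m0.coeFn_toLp (EventuallyEq.refl _ _),
      inner_L2R_of_ae m1.coeFn_toLp (EventuallyEq.refl _ _)]
  simp only [e]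
  have c0 : Continuous fun p : WithLp 2 (L2R × L2R) => p.fst := (WithLp.fstL 2 ℝ L2R L2R).continuous
  have c1 : Continuous fun p : WithLp 2 (L2R × L2R) => p.snd := (WithLp.sndL 2 ℝ L2R L2R).continuous
  exact isClosed_eq (continuous_const.inner c0) (continuous_const.inner c1).neg

instance instCompleteSpaceH1 : CompleteSpace H1 := isClosed_H1.completeSpace_coe

theorem inner_H1 (φ ψ : H1) :
    inner ℝ φ ψ = inner ℝ (toL2 φ) (toL2 ψ) + inner ℝ (dy φ) (dy ψ) := by
  rw [Submodule.coe_inner, WithLp.prod_inner_apply]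
  rfl

theorem norm_H1_sq (φ : H1) : ‖φ‖ ^ 2 = ‖toL2 φ‖ ^ 2 + ‖dy φ‖ ^ 2 := by
  rw [← real_inner_self_eq_norm_sq, inner_H1, real_inner_self_eq_norm_sq,
    real_inner_self_eq_norm_sq]

theorem integral_abs_unit_le (v : L2R) (a : ℝ) : ∫ t in a..a + 1, |v t| ≤ ‖v‖ := by
  have h1 : MemLp (v : ℝ → ℝ) 2 (volume.restrict (Ioc a (a + 1))) := (Lp.memLp v).restrict _
  have h2 : eLpNorm (v : ℝ → ℝ) 1 (volume.restrict (Ioc a (a + 1)))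
      ≤ eLpNorm (v : ℝ → ℝ) 2 volume := by
    refine (eLpNorm_le_eLpNorm_mul_rpow_measure_univ (p := 1) (q := 2) (by norm_num) h1.1).trans ?_
    simp only [Measure.restrict_apply_univ, Real.volume_Ioc, add_sub_cancel_left,
      ENNReal.ofReal_one, ENNReal.one_rpow, mul_one]
    exact eLpNorm_mono_measure _ Measure.restrict_le_self
  rw [intervalIntegral.integral_of_le (by linarith)]
  have h3 : ∫ t in Ioc a (a + 1), |v t|
      = (eLpNorm (v : ℝ → ℝ) 1 (volume.restrict (Ioc a (a + 1)))).toReal := by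
    rw [eLpNorm_one_eq_lintegral_enorm, ← integral_norm_eq_lintegral_enorm h1.1]
    simp [Real.norm_eq_abs]
  rw [h3, Lp.norm_def]
  exact ENNReal.toReal_mono (Lp.memLp v).2.ne h2

/-- Averaging `|φ(a)| ≤ |φ(t)| + ∫ |φ'|` over the unit interval `[a, a + 1]`. Uniformity in `a`
gives both `H¹ ⊆ L^∞` and the vanishing of boundary terms at infinity against decaying exponentials.
-/
theorem abs_rep_le (φ : H1) (a : ℝ) : |rep φ a| ≤ 2 * ‖φ‖ := by
  have hp : ∀ t ∈ Icc a (a + 1), |rep φ a| ≤ |rep φ t| + ‖dy φ‖ := by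
    intro t ht
    have h1 := rep_sub φ a t
    have h2 : |∫ s in a..t, dy φ s| ≤ ‖dy φ‖ := by
      refine (intervalIntegral.abs_integral_le_integral_abs ht.1).trans ?_
      refine le_trans ?_ (integral_abs_unit_le (dy φ) a)
      exact intervalIntegral.integral_mono_interval le_rfl ht.1 ht.2
        (Eventually.of_forall fun s => abs_nonneg _) (dy_intervalIntegrable (dy φ) a (a + 1)).abs
    rw [h1] at h2
    have := abs_sub_abs_le_abs_sub (rep φ a) (rep φ t)
    rw [abs_sub_comm] at this
    linarith
  have hc : Continuous fun t => |rep φ t| + ‖dy φ‖ := (rep_continuous φ).abs.add continuous_const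
  have hm : ∫ _t in a..a + 1, |rep φ a| ≤ ∫ t in a..a + 1, (|rep φ t| + ‖dy φ‖) :=
    intervalIntegral.integral_mono_on (by linarith) intervalIntegrable_const
      (hc.intervalIntegrable _ _) hp
  rw [intervalIntegral.integral_add ((rep_continuous φ).abs.intervalIntegrable _ _)
    intervalIntegrable_const] at hm
  have hr : ∫ t in a..a + 1, |rep φ t| = ∫ t in a..a + 1, |toL2 φ t| := by
    apply intervalIntegral.integral_congr_ae
    filter_upwards [rep_ae φ] with t ht _
    rw [ht]
  rw [hr] at hm
  simp only [intervalIntegral.integral_const, add_sub_cancel_left, one_smul] at hm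
  have := integral_abs_unit_le (toL2 φ) a
  have := norm_toL2_le φ
  have := norm_dy_le φ
  linarith

/-- Integration by parts between absolutely continuous functions, the primitive of `dy φ` being `rep
φ` up to a constant. -/
theorem integral_mul_dy (φ : H1) {e e' : ℝ → ℝ} (he : ∀ y, HasDerivAt e (e' y) y)
    (he' : Continuous e') (a b : ℝ) :
    ∫ y in a..b, (e y * dy φ y + e' y * rep φ y) = e b * rep φ b - e a * rep φ a := by
  have hd : deriv e = e' := funext fun y => (he y).deriv
  have ce : Continuous e := continuous_iff_continuousAt.2 fun y => (he y).continuousAt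
  have hC : ContDiff ℝ 1 e := by
    rw [contDiff_one_iff_deriv]
    exact ⟨fun y => (he y).differentiableAt, hd ▸ he'⟩
  have ac1 : AbsolutelyContinuousOnInterval e a b := hC.contDiffOn.absolutelyContinuousOnInterval
  have ac2 : AbsolutelyContinuousOnInterval (fun y => ∫ t in a..y, dy φ t) a b :=
    (dy_intervalIntegrable (dy φ) a b).absolutelyContinuousOnInterval_intervalIntegral
      left_mem_uIcc
  have key := ac1.integral_mul_deriv_eq_deriv_mul ac2
  have h1 : ∫ y in a..b, e y * deriv (fun y => ∫ t in a..y, dy φ t) y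
      = ∫ y in a..b, e y * dy φ y := by
    apply intervalIntegral.integral_congr_ae
    filter_upwards [LocallyIntegrable.ae_hasDerivAt_integral (locInt (dy φ))] with y hy _
    rw [(hy a).deriv]
  have i1 : IntervalIntegrable (fun y => e y * dy φ y) volume a b :=
    (dy_intervalIntegrable (dy φ) a b).continuousOn_mul ce.continuousOn
  have i2 : IntervalIntegrable (fun y => e' y * rep φ y) volume a b :=
    (he'.mul (rep_continuous φ)).intervalIntegrable a b
  have h2 : ∫ y in a..b, deriv e y * ∫ t in a..y, dy φ t
      = (∫ y in a..b, e' y * rep φ y) - (e b - e a) * rep φ a := by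
    have : ∀ y, deriv e y * ∫ t in a..y, dy φ t = e' y * rep φ y - e' y * rep φ a := fun y => by
      rw [rep_sub, hd]; ring
    have i3 : IntervalIntegrable (fun y => e' y * rep φ a) volume a b :=
      (he'.mul continuous_const).intervalIntegrable a b
    simp only [this]
    rw [intervalIntegral.integral_sub i2 i3, intervalIntegral.integral_mul_const,
      intervalIntegral.integral_eq_sub_of_hasDerivAt (fun y _ => he y) (he'.intervalIntegrable a b)]
  rw [h1, h2, rep_sub, intervalIntegral.integral_same] at key
  rw [intervalIntegral.integral_add i1 i2, key]
  ring

/-! ### The exponential `exp (-κ|y|)` -/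

theorem integrable_exp_neg_mul_abs {c : ℝ} (hc : 0 < c) :
    Integrable (fun y : ℝ => Real.exp (-(c * |y|))) volume := by
  rw [← integrableOn_univ, ← Iic_union_Ioi (a := (0 : ℝ))]
  refine IntegrableOn.union ?_ ?_
  · refine (integrableOn_exp_mul_Iic hc 0).congr_fun (fun y hy => ?_) measurableSet_Iic
    simp only [abs_of_nonpos (mem_Iic.1 hy), mul_neg, neg_neg]
  · refine (integrableOn_exp_mul_Ioi (neg_lt_zero.2 hc) 0).congr_fun (fun y hy => ?_)
      measurableSet_Ioi
    simp only [abs_of_pos (mem_Ioi.1 hy), neg_mul]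

/-- The derivative of `exp (-κ|y|)`. -/
def expDer (κ y : ℝ) : ℝ := (if 0 < y then -κ else κ) * Real.exp (-(κ * |y|))

theorem expDer_of_pos (κ : ℝ) {y : ℝ} (hy : 0 < y) : expDer κ y = -κ * Real.exp (-κ * y) := by
  simp [expDer, hy, abs_of_pos hy]

theorem expDer_of_nonpos (κ : ℝ) {y : ℝ} (hy : y ≤ 0) : expDer κ y = κ * Real.exp (κ * y) := by
  simp [expDer, not_lt.2 hy, abs_of_nonpos hy]

theorem expDer_sq (κ y : ℝ) : expDer κ y ^ 2 = κ ^ 2 * Real.exp (-(κ * |y|)) ^ 2 := by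
  unfold expDer
  split_ifs <;> ring

theorem measurable_expDer (κ : ℝ) : Measurable (expDer κ) := by
  unfold expDer
  refine Measurable.mul (Measurable.ite measurableSet_Ioi measurable_const measurable_const) ?_
  fun_prop

theorem memLp_exp {κ : ℝ} (hκ : 0 < κ) :
    MemLp (fun y : ℝ => Real.exp (-(κ * |y|))) 2 volume := by
  rw [memLp_two_iff_integrable_sq (by fun_prop)]
  refine (integrable_exp_neg_mul_abs (mul_pos two_pos hκ)).congr (Eventually.of_forall fun y => ?_)
  simp only [← Real.exp_nat_mul]
  congr 1
  push_cast
  ring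

theorem memLp_expDer {κ : ℝ} (hκ : 0 < κ) : MemLp (expDer κ) 2 volume := by
  rw [memLp_two_iff_integrable_sq (measurable_expDer κ).aestronglyMeasurable]
  simp only [expDer_sq]
  exact ((memLp_two_iff_integrable_sq (by fun_prop)).1 (memLp_exp hκ)).const_mul _

/-- On each half-line `exp (-κ|y|)` is a smooth exponential with rate `c = ±κ`, so `hk` evaluates
the truncated integrals, and boundedness of `F` removes the term at infinity. The halves are kept
apart: the boundary terms at `0` cancel when computing the weak derivative, but add up in the Green
identity. `F` is a test function in the first use and an `H¹` function in the second. -/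
theorem integral_exp_mul_halves {κ M : ℝ} (hκ : 0 < κ) {F F' : ℝ → ℝ}
    (hi : Integrable (fun y => Real.exp (-(κ * |y|)) * F' y + expDer κ y * F y) volume)
    (hM : ∀ y, |F y| ≤ M)
    (hk : ∀ c a b : ℝ, ∫ y in a..b, (Real.exp (c * y) * F' y + c * Real.exp (c * y) * F y)
      = Real.exp (c * b) * F b - Real.exp (c * a) * F a) :
    ∫ y in Iic 0, (Real.exp (-(κ * |y|)) * F' y + expDer κ y * F y) = F 0 ∧
    ∫ y in Ioi 0, (Real.exp (-(κ * |y|)) * F' y + expDer κ y * F y) = -F 0 := by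
  have lim : Tendsto (fun R : ℝ => M * Real.exp (-(κ * R))) atTop (𝓝 0) := by
    have : Tendsto (fun R : ℝ => κ * R) atTop atTop := tendsto_id.const_mul_atTop hκ
    simpa using (Real.tendsto_exp_neg_atTop_nhds_zero.comp this).const_mul M
  constructor
  · have h1 := intervalIntegral_tendsto_integral_Iic 0 hi.integrableOn
      (tendsto_neg_atTop_atBot (G := ℝ))
    refine tendsto_nhds_unique (h1.congr' ?_)
      (f := fun R : ℝ => F 0 - Real.exp (κ * -R) * F (-R)) ?_
    · filter_upwards [eventually_ge_atTop 0] with R hR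
      have := hk κ (-R) 0
      rw [mul_zero, Real.exp_zero, one_mul] at this
      rw [← this]
      apply intervalIntegral.integral_congr
      intro y hy
      rw [uIcc_of_le (by linarith)] at hy
      simp only [expDer_of_nonpos κ hy.2, abs_of_nonpos hy.2, mul_neg, neg_neg]
    · have : Tendsto (fun R : ℝ => Real.exp (κ * -R) * F (-R)) atTop (𝓝 0) := by
        refine squeeze_zero_norm (fun R => ?_) lim
        rw [Real.norm_eq_abs, abs_mul, Real.abs_exp, mul_comm, mul_neg]
        exact mul_le_mul_of_nonneg_right (hM _) (Real.exp_pos _).le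
      simpa using tendsto_const_nhds.sub this
  · have h1 := intervalIntegral_tendsto_integral_Ioi 0 hi.integrableOn tendsto_id
    refine tendsto_nhds_unique (h1.congr' ?_)
      (f := fun R : ℝ => Real.exp (-κ * R) * F R - F 0) ?_
    · filter_upwards [eventually_ge_atTop 0] with R hR
      have := hk (-κ) 0 R
      rw [mul_zero, Real.exp_zero, one_mul] at this
      rw [← this]
      apply intervalIntegral.integral_congr_ae
      refine Eventually.of_forall fun y hy => ?_
      rw [id, uIoc_of_le hR] at hy
      simp only [expDer_of_pos κ hy.1, abs_of_pos hy.1, neg_mul]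
    · have : Tendsto (fun R : ℝ => Real.exp (-κ * R) * F R) atTop (𝓝 0) := by
        refine squeeze_zero_norm (fun R => ?_) lim
        rw [Real.norm_eq_abs, abs_mul, Real.abs_exp, mul_comm, neg_mul]
        exact mul_le_mul_of_nonneg_right (hM _) (Real.exp_pos _).le
      simpa using this.sub tendsto_const_nhds

theorem hasDerivAt_exp_mul (c y : ℝ) :
    HasDerivAt (fun y => Real.exp (c * y)) (c * Real.exp (c * y)) y := by
  have := ((hasDerivAt_id y).const_mul c).exp
  simpa [mul_comm] using this

theorem exp_isWeakDerivR {κ : ℝ} (hκ : 0 < κ) :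
    IsWeakDerivR (fun y => Real.exp (-(κ * |y|))) (expDer κ) := by
  intro η hη hc
  have hd : ∀ y, HasDerivAt η (deriv η y) y := fun y =>
    ((hη.differentiable (by simp)) y).hasDerivAt
  have hdc := test_deriv_cont hη
  obtain ⟨M, hM⟩ := hη.continuous.bounded_above_of_compact_support hc
  have i1 : Integrable (fun y => Real.exp (-(κ * |y|)) * deriv η y) volume :=
    (memLp_exp hκ).integrable_mul (q := 2) (hdc.memLp_of_hasCompactSupport hc.deriv)
  have i2 : Integrable (fun y => expDer κ y * η y) volume :=
    (memLp_expDer hκ).integrable_mul (q := 2) (hη.continuous.memLp_of_hasCompactSupport hc)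
  have key := integral_exp_mul_halves hκ (i1.add i2) hM (fun c a b => by
    rw [intervalIntegral.integral_eq_sub_of_hasDerivAt
      (f := fun y => Real.exp (c * y) * η y)]
    · intro y _
      exact ((hasDerivAt_exp_mul c y).mul (hd y)).congr_deriv (by ring)
    · have := hη.continuous
      exact Continuous.intervalIntegrable (by fun_prop) a b)
  have h := intervalIntegral.integral_Iic_add_Ioi (i1.add i2).integrableOn
    (i1.add i2).integrableOn (b := (0 : ℝ))
  simp only [Pi.add_apply] at h
  rw [key.1, key.2, integral_add i1 i2] at h
  simp only [mul_comm (deriv η _), mul_comm (η _)]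
  linarith

/-- The function `exp (-κ|y|)` as an element of `H¹(ℝ)`. -/
def expH1 (κ : ℝ) (hκ : 0 < κ) : H1 :=
  ⟨WithLp.toLp 2 ((memLp_exp hκ).toLp _, (memLp_expDer hκ).toLp _), by
    intro η hη hc
    have e0 := (memLp_exp hκ).coeFn_toLp
    have e1 := (memLp_expDer hκ).coeFn_toLp
    have := exp_isWeakDerivR hκ η hη hc
    refine Eq.trans ?_ (this.trans ?_)
    · apply integral_congr_ae
      filter_upwards [e0] with y hy
      exact congrArg (deriv η y * ·) hy
    · congr 1
      apply integral_congr_ae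
      filter_upwards [e1] with y hy
      exact congrArg (η y * ·) hy.symm⟩

theorem toL2_expH1 {κ : ℝ} (hκ : 0 < κ) :
    (toL2 (expH1 κ hκ) : ℝ → ℝ) =ᵐ[volume] fun y => Real.exp (-(κ * |y|)) :=
  (memLp_exp hκ).coeFn_toLp

theorem dy_expH1 {κ : ℝ} (hκ : 0 < κ) : (dy (expH1 κ hκ) : ℝ → ℝ) =ᵐ[volume] expDer κ :=
  (memLp_expDer hκ).coeFn_toLp

theorem rep_expH1 {κ : ℝ} (hκ : 0 < κ) :
    rep (expH1 κ hκ) = fun y => Real.exp (-(κ * |y|)) :=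
  rep_unique _ (by fun_prop) (toL2_expH1 hκ)

theorem eval0_apply (φ : H1) : eval0 φ = rep φ 0 := rfl

theorem eval0_expH1 {κ : ℝ} (hκ : 0 < κ) : eval0 (expH1 κ hκ) = 1 := by
  rw [eval0_apply, rep_expH1]
  simp

/-- `exp (-κ|y|) / (2κ)` is the Green function of `-d²/dy² + κ²`. -/
theorem expH1_green {κ : ℝ} (hκ : 0 < κ) (ψ : H1) :
    inner ℝ (dy (expH1 κ hκ)) (dy ψ) + κ ^ 2 * inner ℝ (toL2 (expH1 κ hκ)) (toL2 ψ)
      = 2 * κ * eval0 ψ := by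
  rw [inner_L2R_of_ae (dy_expH1 hκ) (EventuallyEq.refl _ _),
    inner_L2R_of_ae (toL2_expH1 hκ) (rep_ae ψ)]
  have hψ : MemLp (rep ψ) 2 volume := (memLp_congr_ae (rep_ae ψ)).1 (Lp.memLp _)
  have i1 : Integrable (fun y => Real.exp (-(κ * |y|)) * dy ψ y) volume :=
    (memLp_exp hκ).integrable_mul (Lp.memLp _)
  have i2 : Integrable (fun y => expDer κ y * rep ψ y) volume :=
    (memLp_expDer hκ).integrable_mul hψ
  have i3 : Integrable (fun y => expDer κ y * dy ψ y) volume :=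
    (memLp_expDer hκ).integrable_mul (Lp.memLp _)
  have i4 : Integrable (fun y => Real.exp (-(κ * |y|)) * rep ψ y) volume :=
    (memLp_exp hκ).integrable_mul hψ
  have key := integral_exp_mul_halves hκ (i1.add i2) (abs_rep_le ψ) (fun c a b =>
    integral_mul_dy ψ (hasDerivAt_exp_mul c) (by fun_prop) a b)
  rw [← integral_const_mul, ← integral_add i3 (i4.const_mul _)]
  have i5 : Integrable (fun y => expDer κ y * dy ψ y
      + κ ^ 2 * (Real.exp (-(κ * |y|)) * rep ψ y)) volume := i3.add (i4.const_mul (κ ^ 2))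
  rw [← intervalIntegral.integral_Iic_add_Ioi (b := (0 : ℝ)) i5.integrableOn i5.integrableOn]
  -- The integrand is `κ` times the product derivative on the left and `-κ` times it on the right.
  -- The change of sign is the jump of the derivative, so each half contributes `κ ψ(0)`.
  have h1 : ∫ y in Iic 0, (expDer κ y * dy ψ y + κ ^ 2 * (Real.exp (-(κ * |y|)) * rep ψ y))
      = κ * rep ψ 0 := by
    rw [← key.1, ← integral_const_mul]
    refine setIntegral_congr_fun measurableSet_Iic fun y hy => ?_
    simp only [expDer_of_nonpos κ (mem_Iic.1 hy), abs_of_nonpos (mem_Iic.1 hy), mul_neg, neg_neg]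
    ring
  have h2 : ∫ y in Ioi 0, (expDer κ y * dy ψ y + κ ^ 2 * (Real.exp (-(κ * |y|)) * rep ψ y))
      = κ * rep ψ 0 := by
    rw [← neg_neg (rep ψ 0), ← key.2, ← integral_neg, ← integral_const_mul]
    refine setIntegral_congr_fun measurableSet_Ioi fun y hy => ?_
    simp only [expDer_of_pos κ (mem_Ioi.1 hy), abs_of_pos (mem_Ioi.1 hy)]
    ring_nf
  rw [eval0_apply]
  rw [h1, h2]
  ring

theorem norm_dy_expH1 {κ : ℝ} (hκ : 0 < κ) :
    ‖dy (expH1 κ hκ)‖ = κ * ‖toL2 (expH1 κ hκ)‖ := by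
  rw [← sq_eq_sq₀ (norm_nonneg _) (by positivity), mul_pow, ← real_inner_self_eq_norm_sq,
    ← real_inner_self_eq_norm_sq, inner_L2R_of_ae (dy_expH1 hκ) (dy_expH1 hκ),
    inner_L2R_of_ae (toL2_expH1 hκ) (toL2_expH1 hκ), ← integral_const_mul]
  simp only [← sq, expDer_sq]

/-- The Green identity tested with the exponential itself reads `2 κ² ‖e‖² = 2 κ`. -/
theorem norm_toL2_expH1_sq {κ : ℝ} (hκ : 0 < κ) : ‖toL2 (expH1 κ hκ)‖ ^ 2 = 1 / κ := by
  have h := expH1_green hκ (expH1 κ hκ)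
  rw [real_inner_self_eq_norm_sq, real_inner_self_eq_norm_sq, norm_dy_expH1, eval0_expH1] at h
  field_simp
  nlinarith

/-! ### The operator `-d²/dy² + s - β δ₀` -/

/-- `-φ'' + s φ - β δ₀ φ = f` in the weak sense. -/
def Solves (s β : ℝ) (φ : H1) (f : L2R) : Prop :=
  ∀ ψ : H1, inner ℝ (dy φ) (dy ψ) + s * inner ℝ (toL2 φ) (toL2 ψ) - β * (eval0 φ * eval0 ψ)
    = inner ℝ f (toL2 ψ)

theorem Solves.add {s β : ℝ} {φ ψ : H1} {f g : L2R} (h : Solves s β φ f) (h' : Solves s β ψ g) :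
    Solves s β (φ + ψ) (f + g) := fun η => by
  have := h η
  have := h' η
  simp only [map_add, inner_add_left]
  linarith

theorem Solves.smul {s β : ℝ} {φ : H1} {f : L2R} (c : ℝ) (h : Solves s β φ f) :
    Solves s β (c • φ) (c • f) := fun η => by
  have := h η
  simp only [map_smul, real_inner_smul_left, smul_eq_mul]
  rw [← this]
  ring

theorem Solves.shift {s β : ℝ} {φ : H1} {f : L2R} (h : Solves s β φ f) (t : ℝ) :
    Solves (s + t) β φ (f + t • toL2 φ) := fun η => by
  have := h η
  simp only [inner_add_left, real_inner_smul_left]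
  linarith

/-- A function vanishing at `0` does not feel the delta potential. This lets the free resolvent
invert the critical operator on the complement of its kernel. -/
theorem Solves.of_eval0_eq_zero {s β β' : ℝ} {φ : H1} {f : L2R} (h : Solves s β φ f)
    (h0 : eval0 φ = 0) : Solves s β' φ f := fun η => by
  have := h η
  rw [h0] at this ⊢
  linarith

theorem solves_expH1 {κ : ℝ} (hκ : 0 < κ) : Solves (κ ^ 2) (2 * κ) (expH1 κ hκ) 0 := fun ψ => by
  rw [eval0_expH1, inner_zero_left, expH1_green]
  ring

/-- The form `⟨φ', ψ'⟩ + κ² ⟨φ, ψ⟩` on `H¹(ℝ)`. -/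
def helmForm (κ : ℝ) : H1 →L[ℝ] H1 →L[ℝ] ℝ :=
  (innerSL ℝ).bilinearComp dy dy + κ ^ 2 • (innerSL ℝ).bilinearComp toL2 toL2

theorem helmForm_apply (κ : ℝ) (φ ψ : H1) : helmForm κ φ ψ
    = inner ℝ (dy φ) (dy ψ) + κ ^ 2 * inner ℝ (toL2 φ) (toL2 ψ) := rfl

theorem helmForm_coercive {κ : ℝ} (hκ : 0 < κ) : IsCoercive (helmForm κ) := by
  refine ⟨min 1 (κ ^ 2), by positivity, fun φ => ?_⟩
  rw [helmForm_apply, real_inner_self_eq_norm_sq, real_inner_self_eq_norm_sq, mul_assoc, ← sq,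
    norm_H1_sq, mul_add, add_comm]
  gcongr
  · nlinarith [min_le_left 1 (κ ^ 2), sq_nonneg ‖dy φ‖]
  · exact min_le_right _ _

/-- The resolvent `(-d²/dy² + κ²)⁻¹ : L²(ℝ) → H¹(ℝ)`. -/
def freeRes (κ : ℝ) (hκ : 0 < κ) : L2R →L[ℝ] H1 :=
  ((helmForm_coercive hκ).continuousLinearEquivOfBilin.symm : H1 →L[ℝ] H1) ∘L
    (ContinuousLinearMap.adjoint toL2)

theorem solves_freeRes {κ : ℝ} (hκ : 0 < κ) (f : L2R) :
    Solves (κ ^ 2) 0 (freeRes κ hκ f) f := fun ψ => by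
  have h := (helmForm_coercive hκ).continuousLinearEquivOfBilin_apply (freeRes κ hκ f) ψ
  rw [helmForm_apply] at h
  rw [zero_mul, sub_zero, ← h]
  simp [freeRes, ContinuousLinearMap.adjoint_inner_left]

/-- The equation for the free solution is tested with the Green function. In particular the free
solution vanishes at `0` exactly when `f` is orthogonal to the exponential, which is the solvability
condition at resonance. -/
theorem eval0_freeRes {κ : ℝ} (hκ : 0 < κ) (f : L2R) :
    2 * κ * eval0 (freeRes κ hκ f) = inner ℝ f (toL2 (expH1 κ hκ)) := by
  rw [← expH1_green hκ, ← solves_freeRes hκ f, real_inner_comm (dy _),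
    real_inner_comm (toL2 _)]
  ring

/-- Energy estimate: the equation is tested with `φ`. -/
theorem Solves.norm_le {κ : ℝ} (hκ : 0 < κ) {φ : H1} {f : L2R} (h : Solves (κ ^ 2) 0 φ f) :
    κ ^ 2 * ‖toL2 φ‖ ≤ ‖f‖ ∧ κ * ‖dy φ‖ ≤ ‖f‖ := by
  have h1 := h φ
  rw [real_inner_self_eq_norm_sq, real_inner_self_eq_norm_sq, zero_mul, sub_zero] at h1
  have h2 := real_inner_le_norm f (toL2 φ)
  have h3 : κ ^ 2 * ‖toL2 φ‖ ≤ ‖f‖ := by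
    rcases (norm_nonneg (toL2 φ)).eq_or_lt with h0 | h0
    · rw [← h0, mul_zero]
      exact norm_nonneg f
    · refine le_of_mul_le_mul_right ?_ h0
      nlinarith [sq_nonneg ‖dy φ‖]
  refine ⟨h3, ?_⟩
  refine le_of_sq_le_sq ?_ (norm_nonneg f)
  have h4 : ‖dy φ‖ ^ 2 ≤ ‖f‖ * ‖toL2 φ‖ := by nlinarith [sq_nonneg (κ * ‖toL2 φ‖)]
  calc (κ * ‖dy φ‖) ^ 2 = κ ^ 2 * ‖dy φ‖ ^ 2 := by ring
    _ ≤ κ ^ 2 * (‖f‖ * ‖toL2 φ‖) := by gcongr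
    _ = ‖f‖ * (κ ^ 2 * ‖toL2 φ‖) := by ring
    _ ≤ ‖f‖ * ‖f‖ := by gcongr
    _ = ‖f‖ ^ 2 := by ring

theorem Solves.eq_zero {κ : ℝ} (hκ : 0 < κ) {φ : H1} (h : Solves (κ ^ 2) 0 φ 0) : φ = 0 := by
  apply toL2_injective
  have := (h.norm_le hκ).1
  rw [norm_zero] at this
  rw [map_zero, ← norm_eq_zero]
  nlinarith [norm_nonneg (toL2 φ), pow_pos hκ 2]

/-- The term `β φ(0) δ₀` moves to the right-hand side and is inverted by the Green function `exp
(-κ|y|) / (2κ)`. With `f = 0` this already shows that the kernel lies in the span of the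
exponential. -/
theorem Solves.eq_freeRes {κ β : ℝ} (hκ : 0 < κ) {φ : H1} {f : L2R} (h : Solves (κ ^ 2) β φ f) :
    φ = freeRes κ hκ f + (β * eval0 φ / (2 * κ)) • expH1 κ hκ := by
  rw [← sub_eq_zero]
  refine Solves.eq_zero hκ fun ψ => ?_
  have h1 := h ψ
  have h2 := solves_freeRes hκ f ψ
  have h3 := expH1_green hκ ψ
  simp only [map_sub, map_add, map_smul, inner_sub_left, inner_add_left, real_inner_smul_left,
    inner_zero_left]
  have h4 : β * eval0 φ / (2 * κ) * (2 * κ * eval0 ψ) = β * (eval0 φ * eval0 ψ) := by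
    field_simp
  rw [← h3] at h4
  linarith

/-- The resolvent `(-d²/dy² + κ² - β δ₀)⁻¹ : L²(ℝ) → H¹(ℝ)`, for `β ≠ 2κ`. -/
def pointRes (κ β : ℝ) (hκ : 0 < κ) : L2R →L[ℝ] H1 :=
  freeRes κ hκ + (β / (2 * κ - β)) • (eval0 ∘L freeRes κ hκ).smulRight (expH1 κ hκ)

theorem pointRes_apply {κ : ℝ} (β : ℝ) (hκ : 0 < κ) (f : L2R) : pointRes κ β hκ f
    = freeRes κ hκ f + (β / (2 * κ - β) * eval0 (freeRes κ hκ f)) • expH1 κ hκ := by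
  simp [pointRes, smul_smul]

theorem solves_pointRes {κ β : ℝ} (hκ : 0 < κ) (hβ : β ≠ 2 * κ) (f : L2R) :
    Solves (κ ^ 2) β (pointRes κ β hκ f) f := fun ψ => by
  have h2 := solves_freeRes hκ f ψ
  have h3 := expH1_green hκ ψ
  have h0 : 2 * κ - β ≠ 0 := sub_ne_zero.2 hβ.symm
  rw [pointRes_apply]
  simp only [map_add, map_smul, inner_add_left, real_inner_smul_left, eval0_expH1, smul_eq_mul,
    mul_one]
  set u := eval0 (freeRes κ hκ f)
  -- The coefficient `c = β u / (2κ - β)` solves `2κ c = β (u + c)`, the balance of the delta terms;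
  -- `u + c` is the value of the solution at `0`.
  have h4 : β / (2 * κ - β) * u * (2 * κ * eval0 ψ)
      = β * ((u + β / (2 * κ - β) * u) * eval0 ψ) := by
    field_simp
    ring
  rw [← h3] at h4
  linarith

theorem Solves.eq_pointRes {κ β : ℝ} (hκ : 0 < κ) (hβ : β ≠ 2 * κ) {φ : H1} {f : L2R}
    (h : Solves (κ ^ 2) β φ f) : φ = pointRes κ β hκ f := by
  have h1 := h.eq_freeRes hκ
  have h0 : 2 * κ - β ≠ 0 := sub_ne_zero.2 hβ.symm
  have h2 := congrArg eval0 h1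
  rw [map_add, map_smul, eval0_expH1, smul_eq_mul, mul_one] at h2
  rw [pointRes_apply]
  refine h1.trans ?_
  congr 2
  have h3 : eval0 (freeRes κ hκ f) = eval0 φ - β * eval0 φ / (2 * κ) := by linarith
  rw [h3]
  field_simp

/-- The rank-one correction is controlled by `|u| ≤ ‖f‖ ‖e‖ / (2κ)` and `κ ‖e‖² = 1`. Since `‖e'‖ =
κ ‖e‖`, the same number bounds it in both weighted norms. -/
theorem norm_pointRes_le {κ β : ℝ} (hκ : 0 < κ) (hβ : β ≠ 2 * κ) (f : L2R) :
    κ ^ 2 * ‖toL2 (pointRes κ β hκ f)‖ ≤ (1 + |β| / (2 * |2 * κ - β|)) * ‖f‖ ∧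
    κ * ‖dy (pointRes κ β hκ f)‖ ≤ (1 + |β| / (2 * |2 * κ - β|)) * ‖f‖ := by
  obtain ⟨h1, h2⟩ := (solves_freeRes hκ f).norm_le hκ
  have h0 : 0 < |2 * κ - β| := abs_pos.2 (sub_ne_zero.2 hβ.symm)
  have he := norm_toL2_expH1_sq hκ
  set E := ‖toL2 (expH1 κ hκ)‖
  set u := eval0 (freeRes κ hκ f) with hu
  have h3 : |u| ≤ ‖f‖ * E / (2 * κ) := by
    have := abs_real_inner_le_norm f (toL2 (expH1 κ hκ))
    rw [← eval0_freeRes, abs_mul, abs_of_pos (by positivity)] at this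
    rw [le_div_iff₀ (by positivity)]
    linarith
  have h4 : κ ^ 2 * (|β / (2 * κ - β) * u| * E) ≤ |β| / (2 * |2 * κ - β|) * ‖f‖ := by
    rw [abs_mul, abs_div]
    calc κ ^ 2 * (|β| / |2 * κ - β| * |u| * E)
        ≤ κ ^ 2 * (|β| / |2 * κ - β| * (‖f‖ * E / (2 * κ)) * E) := by gcongr
      _ = |β| / (2 * |2 * κ - β|) * ‖f‖ * (κ * E ^ 2) := by field_simp
      _ = |β| / (2 * |2 * κ - β|) * ‖f‖ := by rw [he]; field_simp
  rw [pointRes_apply]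
  constructor
  · calc κ ^ 2 * ‖toL2 (freeRes κ hκ f + (β / (2 * κ - β) * u) • expH1 κ hκ)‖
        ≤ κ ^ 2 * (‖toL2 (freeRes κ hκ f)‖ + |β / (2 * κ - β) * u| * E) := by
          rw [map_add, map_smul]
          gcongr
          refine (norm_add_le _ _).trans ?_
          rw [norm_smul, Real.norm_eq_abs]
      _ ≤ _ := by rw [mul_add, add_mul, one_mul]; gcongr
  · calc κ * ‖dy (freeRes κ hκ f + (β / (2 * κ - β) * u) • expH1 κ hκ)‖
        ≤ κ * (‖dy (freeRes κ hκ f)‖ + |β / (2 * κ - β) * u| * (κ * E)) := by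
          rw [map_add, map_smul]
          gcongr
          refine (norm_add_le _ _).trans ?_
          rw [norm_smul, Real.norm_eq_abs, norm_dy_expH1]
      _ = κ * ‖dy (freeRes κ hκ f)‖ + κ ^ 2 * (|β / (2 * κ - β) * u| * E) := by ring
      _ ≤ _ := by rw [add_mul, one_mul]; gcongr

/-! ### The Schrödinger operators with a delta potential -/

theorem oneLinf_smul (u : L2R) : (oneLinf • u : L2R) = u := by
  apply Lp.ext
  filter_upwards [Lp.coeFn_lpSMul (r := 2) oneLinf u,
    MemLp.coeFn_toLp (memLp_top_const (μ := (volume : Measure ℝ)) (1 : ℝ))] with y h1 h2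
  rw [h1]
  simp only [Pi.smul_apply', oneLinf]
  rw [h2, one_smul]

theorem schroForm_delta (α : ℝ) (k : ℕ) (l : ℝ) (φ ψ : H1) :
    schroForm oneLinf (α • delta0) k l φ ψ = inner ℝ (dy φ) (dy ψ)
      + (k : ℝ) ^ 2 * (1 - l) * inner ℝ (toL2 φ) (toL2 ψ)
      - (k : ℝ) ^ 2 * α * (eval0 φ * eval0 ψ) := by
  have : (α • delta0) φ ψ = α * (eval0 φ * eval0 ψ) := rfl
  rw [schroForm, oneLinf_smul, this]
  ring

theorem mem_graph_schro {α : ℝ} {k : ℕ} {l : ℝ} {u f : L2R} :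
    (u, f) ∈ (schro oneLinf (α • delta0) k l).graph ↔
      ∃ φ : H1, toL2 φ = u ∧ Solves ((k : ℝ) ^ 2 * (1 - l)) ((k : ℝ) ^ 2 * α) φ f := by
  rw [schro_graph]
  change (∃ φ : H1, toL2 φ = u ∧ ∀ ψ, schroForm oneLinf (α • delta0) k l φ ψ = inner ℝ f (toL2 ψ)) ↔
    _
  simp only [schroForm_delta]
  rfl

theorem mem_graph_schro_toL2 {α : ℝ} {k : ℕ} {l : ℝ} {φ : H1} {f : L2R} :
    (toL2 φ, f) ∈ (schro oneLinf (α • delta0) k l).graph ↔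
      Solves ((k : ℝ) ^ 2 * (1 - l)) ((k : ℝ) ^ 2 * α) φ f := by
  rw [mem_graph_schro]
  constructor
  · rintro ⟨φ', h, h'⟩
    rwa [← toL2_injective h]
  · exact fun h => ⟨φ, rfl, h⟩

theorem inResolventSet_schro {α : ℝ} {k : ℕ} {l m κ : ℝ} (hκ : 0 < κ)
    (hs : (k : ℝ) ^ 2 * (1 - l) - m = κ ^ 2) (hβ : (k : ℝ) ^ 2 * α ≠ 2 * κ) :
    InResolventSet (schro oneLinf (α • delta0) k l) m := by
  have hs' : (k : ℝ) ^ 2 * (1 - l) = κ ^ 2 + m := by linarith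
  -- The resolvent here inverts `m - L`, whereas `pointRes` inverts `L - m`; hence the minus sign.
  refine ⟨-(toL2 ∘L pointRes κ ((k : ℝ) ^ 2 * α) hκ), fun f => ?_, fun u => ?_⟩
  · have h1 := (solves_pointRes hκ hβ (-f)).shift m
    rw [← hs', ← mem_graph_schro_toL2, LinearPMap.mem_graph_iff] at h1
    obtain ⟨v, hv, hv'⟩ := h1
    have e : (-(toL2 ∘L pointRes κ ((k : ℝ) ^ 2 * α) hκ)) f = v := by simp [hv]
    have hv0 : (v : L2R) = toL2 (pointRes κ ((k : ℝ) ^ 2 * α) hκ (-f)) := hv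
    refine ⟨e ▸ v.2, ?_⟩
    have e2 : (⟨_, e ▸ v.2⟩ : (schro oneLinf (α • delta0) k l).domain) = v := Subtype.ext e
    rw [e2, hv', e, hv0, sub_add_cancel_right, neg_neg]
  · have h1 := LinearPMap.mem_graph _ u
    rw [mem_graph_schro] at h1
    obtain ⟨φ, hφ, h⟩ := h1
    have h2 := h.shift (-m)
    rw [hs', add_neg_cancel_right] at h2
    have h3 := h2.eq_pointRes hκ hβ
    rw [← hφ]
    conv_rhs => rw [h3]
    simp only [neg_apply, ContinuousLinearMap.comp_apply, ← map_neg]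
    congr 2
    rw [neg_sub, neg_smul, sub_eq_add_neg]

/-- A symmetric operator with a real resolvent point is self-adjoint. The resolvent `R` is
symmetric, so a vector orthogonal to the domain, which contains the range of `R`, lies in `ker R =
0`. Any `y` in the adjoint domain equals `R (m y - A* y)` and so lies in the domain. -/
theorem isSelfAdjoint_of_inResolventSet {A : L2R →ₗ.[ℝ] L2R} (hA : A.IsFormalAdjoint A) {m : ℝ}
    (hm : InResolventSet A m) : IsSelfAdjoint A := by
  obtain ⟨R, hR, hR'⟩ := hm
  choose hd hR using hR
  have symR : ∀ f g, inner ℝ (R f) g = inner ℝ f (R g) := fun f g => by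
    have := hA ⟨R f, hd f⟩ ⟨R g, hd g⟩
    conv_lhs => rw [← hR g]
    conv_rhs => rw [← hR f]
    simp only [inner_sub_left, inner_sub_right, real_inner_smul_left, real_inner_smul_right] at *
    linarith
  have dense : Dense (A.domain : Set L2R) := by
    rw [Submodule.dense_iff_topologicalClosure_eq_top, Submodule.topologicalClosure_eq_top_iff,
      Submodule.eq_bot_iff]
    intro v hv
    have h0 : R v = 0 := by
      apply ext_inner_right ℝ
      intro f
      rw [symR, inner_zero_left, real_inner_comm]
      exact (Submodule.mem_orthogonal _ _).1 hv _ (hd f)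
    have h1 := hR v
    have h2 : (⟨R v, hd v⟩ : A.domain) = 0 := Subtype.ext h0
    rw [h2, h0, smul_zero, LinearPMap.map_zero, sub_zero] at h1
    exact h1.symm
  rw [LinearPMap.isSelfAdjoint_def]
  refine (LinearPMap.eq_of_le_of_domain_eq (hA.le_adjoint dense)
    (le_antisymm (hA.le_adjoint dense).1 fun y hy => ?_)).symm
  have e : y = R (m • y - A.adjoint ⟨y, hy⟩) := by
    apply ext_inner_left ℝ
    intro g
    have h1 := LinearPMap.adjoint_isFormalAdjoint dense ⟨y, hy⟩ ⟨R g, hd g⟩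
    rw [← symR]
    conv_lhs => rw [← hR g]
    rw [inner_sub_left, inner_sub_right, real_inner_smul_left, real_inner_smul_right,
      real_inner_comm (A.adjoint _), h1, real_inner_comm y, real_inner_comm y]
  rw [e]
  exact hd _

theorem isFormalAdjoint_schro (α : ℝ) (k : ℕ) (l : ℝ) :
    (schro oneLinf (α • delta0) k l).IsFormalAdjoint (schro oneLinf (α • delta0) k l) := by
  intro x y
  obtain ⟨φ, hφ, h⟩ := mem_graph_schro.1 (LinearPMap.mem_graph _ x)
  obtain ⟨ψ, hψ, h'⟩ := mem_graph_schro.1 (LinearPMap.mem_graph _ y)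
  have h1 := h ψ
  have h2 := h' φ
  rw [real_inner_comm (dy φ), real_inner_comm (toL2 φ)] at h2
  rw [← hφ, ← hψ, real_inner_comm _ (toL2 φ)]
  linarith

theorem isSelfAdjoint_schro (α : ℝ) (k : ℕ) (l : ℝ) :
    IsSelfAdjoint (schro oneLinf (α • delta0) k l) := by
  -- Any `κ` with `2κ > k² α` avoids resonance, whatever the sign of `1 - l`.
  set κ := |(k : ℝ) ^ 2 * α| + 1 with hκ
  have h0 : 0 < κ := by positivity
  refine isSelfAdjoint_of_inResolventSet (isFormalAdjoint_schro α k l)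
    (m := (k : ℝ) ^ 2 * (1 - l) - κ ^ 2) (inResolventSet_schro h0 (by ring) ?_)
  have := le_abs_self ((k : ℝ) ^ 2 * α)
  linarith

theorem opKer_schro {α : ℝ} {k : ℕ} {l κ : ℝ} (hκ : 0 < κ)
    (hs : (k : ℝ) ^ 2 * (1 - l) = κ ^ 2) (hβ : (k : ℝ) ^ 2 * α = 2 * κ) :
    opKer (schro oneLinf (α • delta0) k l) = Submodule.span ℝ {toL2 (expH1 κ hκ)} := by
  ext u
  have h1 : u ∈ opKer (schro oneLinf (α • delta0) k l) ↔
      (u, 0) ∈ (schro oneLinf (α • delta0) k l).graph := by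
    simp only [opKer, Submodule.mem_map, LinearMap.mem_ker, LinearPMap.mem_graph_iff]
    exact ⟨fun ⟨v, h, h'⟩ => ⟨v, h', h⟩, fun ⟨v, h, h'⟩ => ⟨v, h', h⟩⟩
  rw [h1, mem_graph_schro, hs, hβ, Submodule.mem_span_singleton]
  constructor
  · rintro ⟨φ, rfl, h⟩
    have := h.eq_freeRes hκ
    rw [map_zero, zero_add] at this
    rw [this, map_smul]
    exact ⟨_, rfl⟩
  · rintro ⟨c, rfl⟩
    refine ⟨c • expH1 κ hκ, map_smul _ _ _, ?_⟩
    simpa using (solves_expH1 hκ).smul c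

theorem toL2_expH1_ne_zero {κ : ℝ} (hκ : 0 < κ) : toL2 (expH1 κ hκ) ≠ 0 := by
  intro h
  have := norm_toL2_expH1_sq hκ
  rw [h, norm_zero] at this
  have : 0 < 1 / κ := by positivity
  linarith

theorem zeroIsolatedSimple_schro {α : ℝ} {k : ℕ} {l κ : ℝ} (hκ : 0 < κ)
    (hs : (k : ℝ) ^ 2 * (1 - l) = κ ^ 2) (hβ : (k : ℝ) ^ 2 * α = 2 * κ) :
    ZeroIsolatedSimple (schro oneLinf (α • delta0) k l) := by
  constructor
  · rw [opKer_schro hκ hs hβ]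
    exact finrank_span_singleton (toL2_expH1_ne_zero hκ)
  -- For `|m| < κ²` the shifted operator has rate `√(κ² - m)`, which is resonant only if it equals
  -- `κ`, that is, if `m = 0`.
  · refine ⟨κ ^ 2, by positivity, fun m hm hm' => ?_⟩
    have h0 : 0 < κ ^ 2 - m := by linarith [le_abs_self m]
    have h1 : Real.sqrt (κ ^ 2 - m) ^ 2 = κ ^ 2 - m := Real.sq_sqrt h0.le
    refine inResolventSet_schro (Real.sqrt_pos.2 h0) (by rw [hs, h1]) fun h => hm ?_
    rw [hβ] at h
    have : κ = Real.sqrt (κ ^ 2 - m) := by linarith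
    rw [← this] at h1
    linarith

/-! ### Uniform bounds away from the critical wavenumber -/

/-- The gap factors as `2kμ - k²α = (2k/ks)(ks μ - k μs)`. At `μ = μs` the second factor has size
`μs |k - ks| ≥ μs`, and `hμ` lets the perturbation consume at most half of it. As the gap grows like
`k |k - ks|`, its quotient with `k² α` is bounded uniformly in `k`. -/
theorem nonresonance {ks k : ℕ} (hks : 1 ≤ ks) (hk : 1 ≤ k) (hne : k ≠ ks) {α μs μ : ℝ}
    (hμs : 0 < μs) (hα : α * ks = 2 * μs) (hμ : ks * |μ - μs| ≤ μs / 2) :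
    (k : ℝ) ^ 2 * α ≠ 2 * (k * μ) ∧
      |(k : ℝ) ^ 2 * α| / (2 * |2 * (k * μ) - (k : ℝ) ^ 2 * α|) ≤ ks + 1 := by
  have hks0 : (0 : ℝ) < ks := by exact_mod_cast hks
  have hk0 : (0 : ℝ) < k := by exact_mod_cast hk
  have h1 : (1 : ℝ) ≤ |(k : ℝ) - ks| := by
    have : (1 : ℤ) ≤ |(k : ℤ) - ks| := Int.one_le_abs (sub_ne_zero.2 (by exact_mod_cast hne))
    exact_mod_cast this
  set D := |ks * μ - k * μs| with hD
  have h2 : μs / 2 * |(k : ℝ) - ks| ≤ D := by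
    have e1 : |(k : ℝ) - ks| * μs = |(ks : ℝ) * μs - k * μs| := by
      rw [← sub_mul, abs_mul, abs_of_pos hμs, abs_sub_comm]
    have e2 : |(ks : ℝ) * μs - ks * μ| = ks * |μ - μs| := by
      rw [← mul_sub, abs_mul, abs_of_pos hks0, abs_sub_comm]
    have e3 := abs_sub_le ((ks : ℝ) * μs) (ks * μ) (k * μs)
    nlinarith
  have hD0 : 0 < D := by
    refine lt_of_lt_of_le ?_ h2
    positivity
  have hα' : α = 2 * μs / ks := by field_simp; linarith
  have h3 : |2 * (k * μ) - (k : ℝ) ^ 2 * α| = 2 * k / ks * D := by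
    rw [hD, ← abs_of_pos (show (0 : ℝ) < 2 * k / ks by positivity), ← abs_mul, hα']
    congr 1
    field_simp
  constructor
  · intro h
    rw [h, sub_self, abs_zero] at h3
    have : 0 < 2 * k / ks * D := by positivity
    linarith
  · have h4 : |(k : ℝ) ^ 2 * α| = 2 * k ^ 2 * μs / ks := by
      rw [abs_of_pos (by rw [hα']; positivity), hα']
      ring
    have h5 : (k : ℝ) ≤ ks + |(k : ℝ) - ks| := by linarith [le_abs_self ((k : ℝ) - ks)]
    rw [h3, h4, div_le_iff₀ (by positivity)]
    have h6 : (k : ℝ) * μs ≤ 2 * (ks + 1) * D := by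
      -- This is `k ≤ ks + |k - ks|` together with `|k - ks| ≥ 1`.
      have : (k : ℝ) ≤ (ks + 1) * |(k : ℝ) - ks| := by nlinarith
      nlinarith
    calc 2 * (k : ℝ) ^ 2 * μs / ks = 2 * k / ks * (k * μs) := by ring
      _ ≤ 2 * k / ks * (2 * (ks + 1) * D) := by gcongr
      _ = _ := by ring

/-- From `|√a - √b| (√a + √b) = |a - b|`. The radius `(1 - ls) / (2 ks)` is chosen to produce
exactly the smallness assumed in `nonresonance`. -/
theorem abs_sqrt_sub_le {ks : ℕ} (hks : 1 ≤ ks) {l ls : ℝ} (hls : ls < 1)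
    (hl : |l - ls| < (1 - ls) / (2 * ks)) :
    0 < 1 - l ∧ ks * |Real.sqrt (1 - l) - Real.sqrt (1 - ls)| ≤ Real.sqrt (1 - ls) / 2 := by
  have hks0 : (1 : ℝ) ≤ ks := by exact_mod_cast hks
  have h0 : 0 < 1 - ls := by linarith
  rw [lt_div_iff₀ (by positivity)] at hl
  have h1 : 0 < 1 - l := by
    have := le_abs_self (l - ls)
    nlinarith [abs_nonneg (l - ls)]
  refine ⟨h1, ?_⟩
  have hs := Real.sqrt_pos.2 h0
  have e1 := Real.sq_sqrt h0.le
  have e2 := Real.sq_sqrt h1.le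
  have e3 : |Real.sqrt (1 - l) - Real.sqrt (1 - ls)| * (Real.sqrt (1 - l) + Real.sqrt (1 - ls))
      = |l - ls| := by
    rw [← abs_of_pos (add_pos (Real.sqrt_pos.2 h1) hs), ← abs_mul, abs_sub_comm l]
    congr 1
    linear_combination e2 - e1
  refine le_of_mul_le_mul_right ?_ hs
  have : |Real.sqrt (1 - l) - Real.sqrt (1 - ls)| * Real.sqrt (1 - ls) ≤ |l - ls| := by
    rw [← e3]
    gcongr
    linarith [Real.sqrt_nonneg (1 - l)]
  nlinarith

/-! ### The critical mode -/

/-- The normalised exponential `√κ exp (-κ|y|)`. -/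
def critMode (κ : ℝ) (hκ : 0 < κ) : H1 := Real.sqrt κ • expH1 κ hκ

theorem rep_critMode {κ : ℝ} (hκ : 0 < κ) :
    rep (critMode κ hκ) = fun y => Real.sqrt κ * Real.exp (-(κ * |y|)) := by
  apply rep_unique _ (by fun_prop)
  rw [critMode, map_smul]
  filter_upwards [Lp.coeFn_smul (Real.sqrt κ) (toL2 (expH1 κ hκ)), toL2_expH1 hκ] with y h1 h2
  rw [h1, Pi.smul_apply, h2, smul_eq_mul]

theorem norm_toL2_critMode {κ : ℝ} (hκ : 0 < κ) : ‖toL2 (critMode κ hκ)‖ = 1 := by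
  rw [← sq_eq_sq₀ (norm_nonneg _) zero_le_one, critMode, map_smul, norm_smul, mul_pow,
    norm_toL2_expH1_sq, Real.norm_eq_abs, sq_abs, Real.sq_sqrt hκ.le]
  field_simp

theorem inner_critMode_self {κ : ℝ} (hκ : 0 < κ) :
    inner ℝ (toL2 (critMode κ hκ)) (toL2 (critMode κ hκ)) = (1 : ℝ) := by
  rw [real_inner_self_eq_norm_sq, norm_toL2_critMode, one_pow]

theorem span_critMode {κ : ℝ} (hκ : 0 < κ) :
    Submodule.span ℝ {toL2 (critMode κ hκ)} = Submodule.span ℝ {toL2 (expH1 κ hκ)} := by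
  rw [critMode, map_smul]
  exact Submodule.span_singleton_smul_eq (IsUnit.mk0 _ (Real.sqrt_pos.2 hκ).ne') _

theorem bifurcationHyp_delta {ks : ℕ} (hks : 1 ≤ ks) {ls : ℝ} (hls : ls < 1) {α : ℝ}
    (hα : α = 2 * Real.sqrt (1 - ls) / ks) (hκ : 0 < ks * Real.sqrt (1 - ls)) :
    BifurcationHyp oneLinf (α • delta0) ks ls
      (Ioo (ls - (1 - ls) / (2 * ks)) (ls + (1 - ls) / (2 * ks)))
      (critMode (ks * Real.sqrt (1 - ls)) hκ) := by
  have hks0 : (1 : ℝ) ≤ ks := by exact_mod_cast hks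
  have h0 : 0 < 1 - ls := by linarith
  have hs := Real.sqrt_pos.2 h0
  have hα' : α * ks = 2 * Real.sqrt (1 - ls) := by rw [hα]; field_simp
  have e0 : (ks : ℝ) ^ 2 * (1 - ls) = (ks * Real.sqrt (1 - ls)) ^ 2 := by
    rw [mul_pow, Real.sq_sqrt h0.le]
  have e1 : (ks : ℝ) ^ 2 * α = 2 * (ks * Real.sqrt (1 - ls)) := by linear_combination ks * hα'
  have hI : ∀ l ∈ Ioo (ls - (1 - ls) / (2 * ks)) (ls + (1 - ls) / (2 * ks)),
      0 < 1 - l ∧ ks * |Real.sqrt (1 - l) - Real.sqrt (1 - ls)| ≤ Real.sqrt (1 - ls) / 2 :=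
    fun l hl => abs_sqrt_sub_le hks hls (abs_lt.2 ⟨by linarith [hl.1], by linarith [hl.2]⟩)
  have hδ : 0 < (1 - ls) / (2 * ks) := by positivity
  refine ⟨fun k _ l => isSelfAdjoint_schro α k l, isOpen_Ioo, ordConnected_Ioo,
    ⟨by linarith, by linarith⟩, zeroIsolatedSimple_schro hκ e0 e1, ?_, ?_, ?_, ?_⟩
  · intro k hk l hl hne
    have hk0 : (0 : ℝ) < k := by exact_mod_cast hk
    obtain ⟨hl0, hl1⟩ := hI l hl
    have hl2 := Real.sqrt_pos.2 hl0
    refine inResolventSet_schro (κ := k * Real.sqrt (1 - l)) (by positivity)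
      (by rw [mul_pow, Real.sq_sqrt hl0.le, sub_zero]) ?_
    by_cases hkk : k = ks
    -- At the critical wavenumber, resonance forces `√(1 - l) = √(1 - ls)`, so only `l = ls` is
    -- excluded.
    · subst hkk
      rw [e1]
      intro h
      have h2 : Real.sqrt (1 - ls) = Real.sqrt (1 - l) := by
        have h3 : (k : ℝ) * Real.sqrt (1 - ls) = k * Real.sqrt (1 - l) := by linarith
        exact mul_left_cancel₀ hk0.ne' h3
      rw [Real.sqrt_inj h0.le hl0.le] at h2
      exact hne (by rw [show l = ls by linarith])
    · exact (nonresonance hks hk hkk hs hα' hl1).1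
  -- The factor `ks + 2` is one plus the bound of `nonresonance`; `4/s²` and `2/s` come from `√(1 -
  -- l) ≥ s/2`. Starting at `K = ks + 1` avoids the critical wavenumber.
  · refine ⟨(ks + 2) * (4 / Real.sqrt (1 - ls) ^ 2 + 2 / Real.sqrt (1 - ls)), ks + 1, ?_⟩
    intro k hk hK l hl φ f hφ
    have hk0 : (0 : ℝ) < k := by exact_mod_cast hk
    obtain ⟨hl0, hl1⟩ := hI l hl
    have hl2 := Real.sqrt_pos.2 hl0
    obtain ⟨h3, h4⟩ := nonresonance hks hk (by omega) hs hα' hl1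
    rw [mem_graph_schro_toL2, show (k : ℝ) ^ 2 * (1 - l) = (k * Real.sqrt (1 - l)) ^ 2 by
      rw [mul_pow, Real.sq_sqrt hl0.le]] at hφ
    have hκ' : 0 < k * Real.sqrt (1 - l) := by positivity
    have h5 := hφ.eq_pointRes hκ' h3
    obtain ⟨h6, h7⟩ := norm_pointRes_le hκ' h3 f
    rw [← h5] at h6 h7
    have h8 : Real.sqrt (1 - ls) / 2 ≤ Real.sqrt (1 - l) := by
      have := neg_abs_le (Real.sqrt (1 - l) - Real.sqrt (1 - ls))
      nlinarith [abs_nonneg (Real.sqrt (1 - l) - Real.sqrt (1 - ls))]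
    have h9 : (1 + |(k : ℝ) ^ 2 * α| / (2 * |2 * (k * Real.sqrt (1 - l)) - (k : ℝ) ^ 2 * α|)) * ‖f‖
        ≤ (ks + 2) * ‖f‖ := by
      refine mul_le_mul_of_nonneg_right ?_ (norm_nonneg f)
      linarith
    set s := Real.sqrt (1 - ls)
    have hn := norm_nonneg f
    constructor
    · rw [div_mul_eq_mul_div, le_div_iff₀ (by positivity)]
      have h10 : k ^ 2 * (s / 2) ^ 2 * ‖toL2 φ‖ ≤ (ks + 2) * ‖f‖ := by
        refine le_trans ?_ (h6.trans h9)
        rw [← mul_pow]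
        gcongr
      calc ‖toL2 φ‖ * (k : ℝ) ^ 2 = (k ^ 2 * (s / 2) ^ 2 * ‖toL2 φ‖) * (4 / s ^ 2) := by
            field_simp; norm_num
        _ ≤ ((ks + 2) * ‖f‖) * (4 / s ^ 2) := by gcongr
        _ ≤ ((ks + 2) * ‖f‖) * (4 / s ^ 2 + 2 / s) := by
            gcongr
            have : 0 < 2 / s := by positivity
            linarith
        _ = _ := by ring
    · rw [div_mul_eq_mul_div, le_div_iff₀ hk0]
      have h10 : k * (s / 2) * ‖dy φ‖ ≤ (ks + 2) * ‖f‖ := by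
        refine le_trans ?_ (h7.trans h9)
        gcongr
      calc ‖dy φ‖ * (k : ℝ) = (k * (s / 2) * ‖dy φ‖) * (2 / s) := by field_simp
        _ ≤ ((ks + 2) * ‖f‖) * (2 / s) := by gcongr
        _ ≤ ((ks + 2) * ‖f‖) * (4 / s ^ 2 + 2 / s) := by
            gcongr
            have : 0 < 4 / s ^ 2 := by positivity
            linarith
        _ = _ := by ring
  · rw [opKer_schro hκ e0 e1, span_critMode]
  · rw [oneLinf_smul, inner_critMode_self]
    exact one_ne_zero

/-! ### Modewise inversion -/

/-- The resolvent at the critical parameter, on the complement of the kernel, extended by the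
identity on the kernel. -/
def critRes (κ : ℝ) (hκ : 0 < κ) : L2R →L[ℝ] H1 :=
  freeRes κ hκ + (innerSL ℝ (toL2 (critMode κ hκ))).smulRight
    (critMode κ hκ - freeRes κ hκ (toL2 (critMode κ hκ)))

theorem critRes_apply {κ : ℝ} (hκ : 0 < κ) (f : L2R) : critRes κ hκ f
    = freeRes κ hκ (f - inner ℝ (toL2 (critMode κ hκ)) f • toL2 (critMode κ hκ))
      + inner ℝ (toL2 (critMode κ hκ)) f • critMode κ hκ := by
  simp only [critRes, add_apply, ContinuousLinearMap.smulRight_apply,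
    innerSL_apply_apply, map_sub, map_smul, smul_sub]
  abel

theorem critRes_critMode {κ : ℝ} (hκ : 0 < κ) :
    critRes κ hκ (toL2 (critMode κ hκ)) = critMode κ hκ := by
  rw [critRes_apply, inner_critMode_self, one_smul, one_smul, sub_self, map_zero, zero_add]

/-- Removing the kernel component makes the right-hand side orthogonal to the exponential, so the
free solution vanishes at `0` and also solves the equation with `β = 2κ`. Adding back a kernel
element changes nothing. -/
theorem solves_critRes {κ : ℝ} (hκ : 0 < κ) (f : L2R) :
    Solves (κ ^ 2) (2 * κ) (critRes κ hκ f)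
      (f - inner ℝ (toL2 (critMode κ hκ)) f • toL2 (critMode κ hκ)) := by
  rw [critRes_apply]
  set g := f - inner ℝ (toL2 (critMode κ hκ)) f • toL2 (critMode κ hκ) with hg
  have h0 : inner ℝ g (toL2 (critMode κ hκ)) = 0 := by
    rw [hg, inner_sub_left, real_inner_smul_left, inner_critMode_self, mul_one,
      real_inner_comm, sub_self]
  have h1 : eval0 (freeRes κ hκ g) = 0 := by
    have h2 := eval0_freeRes hκ g
    rw [critMode, map_smul, real_inner_smul_right] at h0
    have h3 := (Real.sqrt_pos.2 hκ).ne'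
    rw [(mul_eq_zero.1 h0).resolve_left h3] at h2
    have : 2 * κ ≠ 0 := by positivity
    exact (mul_eq_zero.1 h2).resolve_left this
  have h4 := ((solves_freeRes hκ g).of_eval0_eq_zero h1 (β' := 2 * κ)).add
    (((solves_expH1 hκ).smul (Real.sqrt κ)).smul (inner ℝ (toL2 (critMode κ hκ)) f))
  rw [smul_zero, smul_zero, add_zero] at h4
  exact h4

theorem norm_H1_le (φ : H1) : ‖φ‖ ≤ ‖toL2 φ‖ + ‖dy φ‖ := by
  refine le_of_sq_le_sq ?_ (by positivity)
  rw [norm_H1_sq]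
  nlinarith [norm_nonneg (toL2 φ), norm_nonneg (dy φ)]

/-- A family of bounded operators inverting `L_{ls}^k`, `k ≥ 1`, modulo the kernel spanned by `φs`
for `k = ks`, with bounds uniform in `k`. -/
structure ModeInverse (α ls : ℝ) (ks : ℕ) (φs : H1) where
  T : ℕ → L2R →L[ℝ] H1
  C : ℝ
  C_nonneg : 0 ≤ C
  T_zero : T 0 = 0
  norm_toL2_T : ∀ (k : ℕ) f, (k : ℝ) ^ 2 * ‖toL2 (T k f)‖ ≤ C * ‖f‖
  norm_T : ∀ (k : ℕ) f, (k : ℝ) * ‖T k f‖ ≤ C * ‖f‖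
  solves : ∀ (k : ℕ) f, k ≠ 0 → k ≠ ks →
    Solves ((k : ℝ) ^ 2 * (1 - ls)) ((k : ℝ) ^ 2 * α) (T k f) f
  solves_crit : ∀ f, Solves ((ks : ℝ) ^ 2 * (1 - ls)) ((ks : ℝ) ^ 2 * α) (T ks f)
    (f - inner ℝ (toL2 φs) f • toL2 φs)
  T_crit : T ks (toL2 φs) = φs
  norm_crit : inner ℝ (toL2 φs) (toL2 φs) = (1 : ℝ)
  ks_ne_zero : ks ≠ 0

theorem nonempty_modeInverse {ks : ℕ} (hks : 1 ≤ ks) {ls : ℝ} (hls : ls < 1) {α : ℝ}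
    (hα : α = 2 * Real.sqrt (1 - ls) / ks) (hκ : 0 < ks * Real.sqrt (1 - ls)) :
    Nonempty (ModeInverse α ls ks (critMode (ks * Real.sqrt (1 - ls)) hκ)) := by
  have hks0 : (1 : ℝ) ≤ ks := by exact_mod_cast hks
  have h0 : 0 < 1 - ls := by linarith
  have hs := Real.sqrt_pos.2 h0
  have hα' : α * ks = 2 * Real.sqrt (1 - ls) := by rw [hα]; field_simp
  have e1 : (ks : ℝ) ^ 2 * α = 2 * (ks * Real.sqrt (1 - ls)) := by linear_combination ks * hα'
  have sq_eq : ∀ k : ℕ, (k : ℝ) ^ 2 * (1 - ls) = (k * Real.sqrt (1 - ls)) ^ 2 := fun k => by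
    rw [mul_pow, Real.sq_sqrt h0.le]
  set s := Real.sqrt (1 - ls)
  have key : ∀ k : ℕ, ∃ T : L2R →L[ℝ] H1, k ≠ 0 → k ≠ ks → ∀ f,
      Solves ((k : ℝ) ^ 2 * (1 - ls)) ((k : ℝ) ^ 2 * α) (T f) f ∧
      (k : ℝ) ^ 2 * ‖toL2 (T f)‖ ≤ (ks + 2) / s ^ 2 * ‖f‖ ∧
      (k : ℝ) * ‖T f‖ ≤ ((ks + 2) / s ^ 2 + (ks + 2) / s) * ‖f‖ := by
    intro k
    by_cases hk : k = 0
    · exact ⟨0, fun h => absurd hk h⟩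
    by_cases hkk : k = ks
    · exact ⟨0, fun _ h => absurd hkk h⟩
    have hk1 : 1 ≤ k := Nat.one_le_iff_ne_zero.2 hk
    have hk0 : (1 : ℝ) ≤ k := by exact_mod_cast hk1
    have hκ' : 0 < k * s := by positivity
    -- Only `λ = λ_*` is needed here, so the perturbation `μ - μs` is zero.
    obtain ⟨h3, h4⟩ := nonresonance (μ := s) hks hk1 hkk hs hα' (by simp; positivity)
    refine ⟨pointRes (k * s) ((k : ℝ) ^ 2 * α) hκ', fun _ _ f => ?_⟩
    obtain ⟨h6, h7⟩ := norm_pointRes_le hκ' h3 f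
    have h9 : (1 + |(k : ℝ) ^ 2 * α| / (2 * |2 * (k * s) - (k : ℝ) ^ 2 * α|)) * ‖f‖
        ≤ (ks + 2) * ‖f‖ := by
      refine mul_le_mul_of_nonneg_right ?_ (norm_nonneg f)
      linarith
    have h10 := h6.trans h9
    have h11 := h7.trans h9
    set u := pointRes (k * s) ((k : ℝ) ^ 2 * α) hκ' f with hu
    have h12 : (k : ℝ) ^ 2 * ‖toL2 u‖ ≤ (ks + 2) / s ^ 2 * ‖f‖ := by
      rw [div_mul_eq_mul_div, le_div_iff₀ (by positivity)]
      linarith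
    have h13 : (k : ℝ) * ‖dy u‖ ≤ (ks + 2) / s * ‖f‖ := by
      rw [div_mul_eq_mul_div, le_div_iff₀ (by positivity)]
      linarith
    refine ⟨?_, h12, ?_⟩
    · rw [sq_eq]
      exact solves_pointRes hκ' h3 f
    · have : (k : ℝ) * ‖toL2 u‖ ≤ (k : ℝ) ^ 2 * ‖toL2 u‖ := by
        gcongr
        nlinarith
      calc (k : ℝ) * ‖u‖ ≤ k * (‖toL2 u‖ + ‖dy u‖) := by gcongr; exact norm_H1_le u
        _ ≤ _ := by rw [mul_add, add_mul]; linarith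
  choose T hT using key
  set Tc := critRes (ks * s) hκ with hTc
  -- The value at `k = 0` is zero, as a sine series has no such mode; no operator is inverted there.
  set S : ℕ → L2R →L[ℝ] H1 := fun k => if k = 0 then 0 else if k = ks then Tc else T k with hS
  have hne : ks ≠ 0 := by omega
  have S0 : S 0 = 0 := by simp [hS]
  have Sc : S ks = Tc := by simp [hS, hne]
  have Sk : ∀ k, k ≠ 0 → k ≠ ks → S k = T k := fun k h h' => by simp [hS, h, h']
  have hC : 0 ≤ ((ks : ℝ) + 2) / s ^ 2 + (ks + 2) / s := by positivity
  have hC' : ((ks : ℝ) + 2) / s ^ 2 ≤ ((ks : ℝ) + 2) / s ^ 2 + (ks + 2) / s :=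
    le_add_of_nonneg_right (by positivity)
  have hCc : 0 ≤ (ks : ℝ) ^ 2 * ‖Tc‖ := by positivity
  -- The bound for the noncritical modes plus `ks² ‖Tc‖` for the single critical one.
  refine ⟨⟨S, ((ks + 2) / s ^ 2 + (ks + 2) / s) + ks ^ 2 * ‖Tc‖, by positivity, S0, ?_, ?_, ?_, ?_,
    ?_, inner_critMode_self hκ, hne⟩⟩
  · intro k f
    rw [add_mul]
    rcases eq_or_ne k 0 with rfl | hk
    · simp only [Nat.cast_zero]
      have := norm_nonneg f
      rw [zero_pow two_ne_zero, zero_mul]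
      positivity
    rcases eq_or_ne k ks with rfl | hkk
    · rw [Sc]
      refine le_add_of_nonneg_of_le (by positivity) ?_
      rw [mul_assoc]
      gcongr
      exact (norm_toL2_le _).trans (Tc.le_opNorm f)
    · rw [Sk k hk hkk]
      refine le_add_of_le_of_nonneg (((hT k hk hkk f).2.1).trans ?_) (by positivity)
      gcongr
  · intro k f
    rw [add_mul]
    rcases eq_or_ne k 0 with rfl | hk
    · simp only [Nat.cast_zero, zero_mul]
      positivity
    rcases eq_or_ne k ks with rfl | hkk
    · rw [Sc]
      refine le_add_of_nonneg_of_le (by positivity) ?_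
      rw [mul_assoc]
      gcongr
      · nlinarith
      · exact Tc.le_opNorm f
    · rw [Sk k hk hkk]
      exact le_add_of_le_of_nonneg (hT k hk hkk f).2.2 (by positivity)
  · intro k f hk hkk
    rw [Sk k hk hkk]
    exact (hT k hk hkk f).1
  · intro f
    rw [Sc, sq_eq, e1]
    exact solves_critRes hκ f
  · rw [Sc]
    exact critRes_critMode hκ

/-! ### Operators on `ℓ¹(ℕ; E)` -/

/-- Absolutely summable sequences. -/
abbrev Seq1 (E : Type) [NormedAddCommGroup E] : Type := lp (fun _ : ℕ => E) 1

theorem hasSum_norm_seq1 {E : Type} [NormedAddCommGroup E] (f : Seq1 E) :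
    HasSum (fun k => ‖f k‖) ‖f‖ := by
  simpa using lp.hasSum_norm (p := 1) (by simp) f

section Lift

variable {E W : Type} [NormedAddCommGroup E] [NormedSpace ℝ E] [NormedAddCommGroup W]
  [NormedSpace ℝ W]

/-- The sequence with the single entry `v` at `k`. -/
def single1 (k : ℕ) : E →L[ℝ] Seq1 E :=
  LinearMap.mkContinuous
    { toFun := fun v => lp.single (E := fun _ : ℕ => E) 1 k v
      map_add' := fun u v => lp.single_add (E := fun _ : ℕ => E) 1 k u v
      map_smul' := fun c v => lp.single_smul (E := fun _ : ℕ => E) 1 k c v }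
    1 (fun v => by
      rw [one_mul]
      exact (lp.norm_single (E := fun _ : ℕ => E) one_pos k v).le)

theorem norm_single1 (k : ℕ) (v : E) : ‖single1 k v‖ = ‖v‖ :=
  lp.norm_single (E := fun _ : ℕ => E) one_pos k v

theorem single1_apply (k j : ℕ) (v : E) : (single1 k v : ∀ _ : ℕ, E) j = if j = k then v else 0 := by
  change Pi.single (M := fun _ : ℕ => E) k v j = _
  rw [Pi.single_apply]

/-- Evaluation of a sequence. -/
def coef1 (k : ℕ) : Seq1 E →L[ℝ] E :=
  LinearMap.mkContinuous
    { toFun := fun f => f k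
      map_add' := fun _ _ => rfl
      map_smul' := fun _ _ => rfl }
    1 (fun f => by
      rw [one_mul]
      exact lp.norm_apply_le_norm one_ne_zero f k)

/-- Every `ℓ¹` sequence is the norm-convergent sum of its entries. All later identities between
bounded operators are thereby reduced to one mode at a time. -/
theorem seq1_clm_ext {A B : Seq1 E →L[ℝ] W} (h : ∀ k v, A (single1 k v) = B (single1 k v)) :
    A = B := by
  ext f
  have hf : HasSum (fun k => single1 k (f k)) f := lp.hasSum_single (by simp) f
  refine (hf.mapL A).unique ?_
  simp only [h]
  exact hf.mapL B

variable [CompleteSpace W]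

theorem summable_lift1 (A : ℕ → E →L[ℝ] W) {C : ℝ} (hA : ∀ k, ‖A k‖ ≤ C) (f : Seq1 E) :
    Summable fun k => A k (f k) :=
  Summable.of_norm_bounded ((hasSum_norm_seq1 f).summable.mul_left C)
    fun k => ((A k).le_opNorm (f k)).trans (by gcongr; exact hA k)

/-- The operator on `ℓ¹(ℕ; E)` defined by a bounded sequence of operators. -/
def lift1 (A : ℕ → E →L[ℝ] W) (C : ℝ) (hA : ∀ k, ‖A k‖ ≤ C) : Seq1 E →L[ℝ] W :=
  LinearMap.mkContinuous
    { toFun := fun f => ∑' k, A k (f k)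
      map_add' := fun f g => by
        rw [← (summable_lift1 A hA f).tsum_add (summable_lift1 A hA g)]
        simp
      map_smul' := fun c f => by
        rw [RingHom.id_apply, ← (summable_lift1 A hA f).tsum_const_smul]
        simp }
    C (fun f => by
      refine tsum_of_norm_bounded ((hasSum_norm_seq1 f).mul_left C) fun k => ?_
      exact ((A k).le_opNorm (f k)).trans (by gcongr; exact hA k))

variable (A : ℕ → E →L[ℝ] W) {C : ℝ} (hA : ∀ k, ‖A k‖ ≤ C)

theorem hasSum_lift1 (f : Seq1 E) : HasSum (fun k => A k (f k)) (lift1 A C hA f) :=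
  (summable_lift1 A hA f).hasSum

theorem lift1_single (k : ℕ) (v : E) : lift1 A C hA (single1 k v) = A k v := by
  refine (hasSum_lift1 A hA _).unique ?_
  have : A k v = A k ((single1 k v : Seq1 E) k) := by rw [single1_apply, if_pos rfl]
  rw [this]
  refine hasSum_single k fun j hj => ?_
  rw [single1_apply, if_neg hj, map_zero]

theorem norm_lift1_le : ‖lift1 A C hA‖ ≤ C :=
  LinearMap.mkContinuous_norm_le _ ((norm_nonneg _).trans (hA 0)) _

/-- The trilinear operator on `ℓ¹(ℕ; E)` defined by a bounded family of trilinear operators. -/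
theorem exists_trilinear_lift (m : ℕ → ℕ → ℕ → E →L[ℝ] E →L[ℝ] E →L[ℝ] W) (C : ℝ)
    (hm : ∀ a b c, ‖m a b c‖ ≤ C) :
    ∃ M : Seq1 E →L[ℝ] Seq1 E →L[ℝ] Seq1 E →L[ℝ] W,
      ∀ a b c u v w, M (single1 c w) (single1 b v) (single1 a u) = m a b c u v w := by
  -- One variable is lifted at a time; the flips bring the next unlifted variable to the front and
  -- preserve operator norms, so `C` survives. The arguments come out in reverse order.
  let M1 : ℕ → ℕ → Seq1 E →L[ℝ] E →L[ℝ] E →L[ℝ] W := fun b c =>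
    lift1 (fun a => m a b c) C (fun a => hm a b c)
  have n1 : ∀ b c, ‖(M1 b c).flip‖ ≤ C := fun b c => by
    rw [ContinuousLinearMap.opNorm_flip]
    exact norm_lift1_le _ _
  let M2 : ℕ → Seq1 E →L[ℝ] Seq1 E →L[ℝ] E →L[ℝ] W := fun c =>
    lift1 (fun b => (M1 b c).flip) C (fun b => n1 b c)
  have n2 : ∀ c, ‖M2 c‖ ≤ C := fun c => norm_lift1_le _ _
  let fl : (Seq1 E →L[ℝ] E →L[ℝ] W) →L[ℝ] (E →L[ℝ] Seq1 E →L[ℝ] W) :=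
    (ContinuousLinearMap.flipₗᵢ ℝ (Seq1 E) E W).toContinuousLinearEquiv.toContinuousLinearMap
  have n3 : ∀ c, ‖(fl ∘L M2 c).flip‖ ≤ C := fun c => by
    rw [ContinuousLinearMap.opNorm_flip]
    refine ContinuousLinearMap.opNorm_le_bound _ ((norm_nonneg _).trans (n2 0)) fun x => ?_
    change ‖(M2 c x).flip‖ ≤ _
    rw [ContinuousLinearMap.opNorm_flip]
    exact ((M2 c).le_opNorm x).trans (by gcongr; exact n2 c)
  let M3 : Seq1 E →L[ℝ] Seq1 E →L[ℝ] Seq1 E →L[ℝ] W :=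
    lift1 (fun c => (fl ∘L M2 c).flip) C n3
  refine ⟨M3, fun a b c u v w => ?_⟩
  have e3 : M3 (single1 c w) = (fl ∘L M2 c).flip w := lift1_single _ n3 c w
  have e2 : M2 c (single1 b v) = (M1 b c).flip v := lift1_single _ (fun b => n1 b c) b v
  have e1 : M1 b c (single1 a u) = m a b c u := lift1_single _ (fun a => hm a b c) a u
  rw [e3]
  change M2 c (single1 b v) (single1 a u) w = _
  rw [e2]
  change M1 b c (single1 a u) v w = _
  rw [e1]

end Lift

/-! ### Products of functions in `H¹(ℝ)` -/

/-- Multiplication `L^∞ × L² → L²` as a bounded bilinear map. -/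
def smulL : LinfR →L[ℝ] L2R →L[ℝ] L2R :=
  LinearMap.mkContinuous₂
    (LinearMap.mk₂ ℝ (fun (V : LinfR) (u : L2R) => (V • u : L2R))
      (fun V W u => Lp.smul_add V W u) (fun c V u => Lp.smul_assoc c V u)
      (fun V u w => Lp.add_smul V u w) (fun c V u => (Lp.smul_comm c V u).symm))
    1 (fun V u => by rw [one_mul]; exact Lp.norm_smul_le V u)

theorem smulL_apply (V : LinfR) (u : L2R) : smulL V u = (V • u : L2R) := rfl

theorem norm_smulL_le (V : LinfR) (u : L2R) : ‖smulL V u‖ ≤ ‖V‖ * ‖u‖ := Lp.norm_smul_le V u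

theorem smulL_coeFn (V : LinfR) (u : L2R) :
    (smulL V u : ℝ → ℝ) =ᵐ[volume] fun y => V y * u y :=
  Lp.coeFn_lpSMul V u

theorem memLp_top_rep (φ : H1) : MemLp (rep φ) ⊤ volume :=
  memLp_top_of_bound (rep_continuous φ).aestronglyMeasurable (2 * ‖φ‖)
    (Eventually.of_forall (abs_rep_le φ))

theorem toLp_rep_ae (φ : H1) : ((memLp_top_rep φ).toLp _ : ℝ → ℝ) =ᵐ[volume] toL2 φ :=
  (memLp_top_rep φ).coeFn_toLp.trans (rep_ae φ).symm

/-- The inclusion `H¹(ℝ) → L^∞(ℝ)`. -/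
def toLinf : H1 →L[ℝ] LinfR :=
  LinearMap.mkContinuous
    { toFun := fun φ => (memLp_top_rep φ).toLp _
      map_add' := fun φ ψ => by
        apply Lp.ext
        filter_upwards [toLp_rep_ae (φ + ψ), toLp_rep_ae φ, toLp_rep_ae ψ,
          Lp.coeFn_add ((memLp_top_rep φ).toLp _) ((memLp_top_rep ψ).toLp _),
          Lp.coeFn_add (toL2 φ) (toL2 ψ)] with y h1 h2 h3 h4 h5
        rw [h1, h4, map_add, h5, Pi.add_apply, Pi.add_apply, h2, h3]
      map_smul' := fun c φ => by
        apply Lp.ext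
        filter_upwards [toLp_rep_ae (c • φ), toLp_rep_ae φ,
          Lp.coeFn_smul c ((memLp_top_rep φ).toLp _), Lp.coeFn_smul c (toL2 φ)] with y h1 h2 h3 h4
        rw [h1, RingHom.id_apply, h3, map_smul, h4, Pi.smul_apply, Pi.smul_apply, h2] }
    2 (fun φ => by
      change ‖(memLp_top_rep φ).toLp _‖ ≤ _
      rw [Lp.norm_toLp]
      refine ENNReal.toReal_le_of_le_ofReal (by positivity) ?_
      rw [eLpNorm_exponent_top]
      exact eLpNormEssSup_le_of_ae_bound (Eventually.of_forall (abs_rep_le φ)))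

theorem toLinf_ae (φ : H1) : (toLinf φ : ℝ → ℝ) =ᵐ[volume] toL2 φ := toLp_rep_ae φ

theorem norm_toLinf_le (φ : H1) : ‖toLinf φ‖ ≤ 2 * ‖φ‖ :=
  toLinf.le_of_opNorm_le (LinearMap.mkContinuous_norm_le _ zero_le_two _) φ

/-- The product of three functions. -/
def tripleMul : H1 →L[ℝ] H1 →L[ℝ] H1 →L[ℝ] L2R :=
  ((ContinuousLinearMap.compL ℝ H1 (H1 →L[ℝ] L2R) (H1 →L[ℝ] L2R)).flip
      ((smulL ∘L toLinf).bilinearComp (ContinuousLinearMap.id ℝ H1) toL2)) ∘L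
    (ContinuousLinearMap.compL ℝ H1 L2R L2R) ∘L smulL ∘L toLinf

theorem tripleMul_apply (u v w : H1) :
    tripleMul u v w = smulL (toLinf u) (smulL (toLinf v) (toL2 w)) := rfl

theorem tripleMul_ae (u v w : H1) : (tripleMul u v w : ℝ → ℝ) =ᵐ[volume]
    fun y => toL2 u y * (toL2 v y * toL2 w y) := by
  rw [tripleMul_apply]
  filter_upwards [smulL_coeFn (toLinf u) (smulL (toLinf v) (toL2 w)),
    smulL_coeFn (toLinf v) (toL2 w), toLinf_ae u, toLinf_ae v] with y h1 h2 h3 h4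
  rw [h1, h2, h3, h4]

/-- Two factors are taken in `L^∞` and only the last in `L²`; with `tripleMul_rotate` the `L²` norm
can be put on any factor. -/
theorem norm_tripleMul_le (u v w : H1) : ‖tripleMul u v w‖ ≤ 4 * (‖u‖ * ‖v‖ * ‖toL2 w‖) := by
  rw [tripleMul_apply]
  calc _ ≤ ‖toLinf u‖ * (‖toLinf v‖ * ‖toL2 w‖) :=
        (norm_smulL_le _ _).trans (by gcongr; exact norm_smulL_le _ _)
    _ ≤ (2 * ‖u‖) * ((2 * ‖v‖) * ‖toL2 w‖) := by
        gcongr <;> exact norm_toLinf_le _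
    _ = _ := by ring

theorem tripleMul_rotate (u v w : H1) : tripleMul u v w = tripleMul v w u := by
  apply Lp.ext
  filter_upwards [tripleMul_ae u v w, tripleMul_ae v w u] with y h1 h2
  rw [h1, h2]
  ring

theorem add_add_sq_le (a b c : ℝ) : (a + b + c) ^ 2 ≤ 3 * (a ^ 2 + b ^ 2 + c ^ 2) := by
  nlinarith [sq_nonneg (a - b), sq_nonneg (b - c), sq_nonneg (a - c)]

/-- The bounded trilinear map `(x, y, z) ↦ S (A x * B y * C z)`. -/
def triComp {W : Type} [NormedAddCommGroup W] [NormedSpace ℝ W]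
    (A B C : L2R →L[ℝ] H1) (S : L2R →L[ℝ] W) : L2R →L[ℝ] L2R →L[ℝ] L2R →L[ℝ] W :=
  (ContinuousLinearMap.compL ℝ L2R (H1 →L[ℝ] L2R) (L2R →L[ℝ] W)
      ((ContinuousLinearMap.compL ℝ L2R L2R W S) ∘L
        ((ContinuousLinearMap.compL ℝ L2R H1 L2R).flip C))) ∘L
    ((ContinuousLinearMap.compL ℝ L2R H1 (H1 →L[ℝ] L2R)).flip B) ∘L tripleMul ∘L A

theorem triComp_apply {W : Type} [NormedAddCommGroup W] [NormedSpace ℝ W]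
    (A B C : L2R →L[ℝ] H1) (S : L2R →L[ℝ] W) (x y z : L2R) :
    triComp A B C S x y z = S (tripleMul (A x) (B y) (C z)) := rfl

theorem opNorm_trilinear_le {E W : Type} [NormedAddCommGroup E] [NormedSpace ℝ E]
    [NormedAddCommGroup W] [NormedSpace ℝ W] (m : E →L[ℝ] E →L[ℝ] E →L[ℝ] W) {K : ℝ} (hK : 0 ≤ K)
    (h : ∀ x y z, ‖m x y z‖ ≤ K * (‖x‖ * ‖y‖ * ‖z‖)) : ‖m‖ ≤ K := by
  refine ContinuousLinearMap.opNorm_le_bound _ hK fun x => ?_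
  refine ContinuousLinearMap.opNorm_le_bound _ (by positivity) fun y => ?_
  refine ContinuousLinearMap.opNorm_le_bound _ (by positivity) fun z => ?_
  exact (h x y z).trans_eq (by ring)

/-- The coefficient `v` of `sin (n x)`, weighted with `n²`, as a sequence of coefficients of
`sin (k x)`, `k ≥ 0`. -/
def signedSingle (n : ℤ) : L2R →L[ℝ] Seq1 L2R :=
  ((n.sign : ℝ) * (n : ℝ) ^ 2) • single1 n.natAbs

theorem norm_signedSingle_le (n : ℤ) (v : L2R) : ‖signedSingle n v‖ ≤ (n : ℝ) ^ 2 * ‖v‖ := by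
  rw [signedSingle, smul_apply, norm_smul, norm_single1, Real.norm_eq_abs, abs_mul,
    abs_of_nonneg (sq_nonneg (n : ℝ))]
  gcongr
  have : |(n.sign : ℝ)| ≤ 1 := by
    rcases lt_trichotomy n 0 with h | h | h
    · simp [Int.sign_eq_neg_one_of_neg h]
    · simp [h]
    · simp [Int.sign_eq_one_of_pos h]
  nlinarith [sq_nonneg (n : ℝ)]

namespace ModeInverse

variable {α ls : ℝ} {ks : ℕ} {φs : H1} (D : ModeInverse α ls ks φs)

theorem norm_T_le (k : ℕ) (f : L2R) : ‖D.T k f‖ ≤ D.C * ‖f‖ := by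
  rcases Nat.eq_zero_or_pos k with rfl | hk
  · rw [D.T_zero, zero_apply, norm_zero]
    exact mul_nonneg D.C_nonneg (norm_nonneg f)
  · refine le_trans ?_ (D.norm_T k f)
    have : (1 : ℝ) ≤ k := by exact_mod_cast hk
    nlinarith [norm_nonneg (D.T k f)]

/-- The two derivatives on the cube are paid for by `n² ≤ 3 (a² + b² + c²)`: each square falls on
the `L²` norm of the factor with that frequency, where `k² ‖Tₖ f‖ ≤ C ‖f‖`, the other two being
bounded in `H¹`. The constant is `3 · 3 · 4`. -/
theorem norm_signedSingle_triple_le (a b c : ℕ) (n : ℤ) (hn : |(n : ℝ)| ≤ a + b + c) :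
    ‖triComp (D.T a) (D.T b) (D.T c) (signedSingle n)‖ ≤ 36 * D.C ^ 3 := by
  have hC := D.C_nonneg
  refine opNorm_trilinear_le _ (by positivity) fun x y z => ?_
  rw [triComp_apply]
  refine (norm_signedSingle_le _ _).trans ?_
  have key : ∀ (i j k : ℕ) (f g h : L2R),
      (k : ℝ) ^ 2 * ‖tripleMul (D.T i f) (D.T j g) (D.T k h)‖
        ≤ 4 * (D.C ^ 3 * (‖f‖ * ‖g‖ * ‖h‖)) := by
    intro i j k f g h
    calc (k : ℝ) ^ 2 * ‖tripleMul (D.T i f) (D.T j g) (D.T k h)‖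
        ≤ (k : ℝ) ^ 2 * (4 * (‖D.T i f‖ * ‖D.T j g‖ * ‖toL2 (D.T k h)‖)) := by
          gcongr
          exact norm_tripleMul_le _ _ _
      _ = 4 * (‖D.T i f‖ * ‖D.T j g‖ * ((k : ℝ) ^ 2 * ‖toL2 (D.T k h)‖)) := by ring
      _ ≤ 4 * ((D.C * ‖f‖) * (D.C * ‖g‖) * (D.C * ‖h‖)) := by
          gcongr 4 * (?_ * ?_ * ?_)
          · exact D.norm_T_le i f
          · exact D.norm_T_le j g
          · exact D.norm_toL2_T k h
      _ = _ := by ring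
  have h1 := key a b c x y z
  have h2 := key b c a y z x
  have h3 := key c a b z x y
  rw [← tripleMul_rotate] at h2
  rw [tripleMul_rotate] at h3
  set τ := ‖tripleMul (D.T a x) (D.T b y) (D.T c z)‖
  have h4 : (n : ℝ) ^ 2 ≤ 3 * ((a : ℝ) ^ 2 + b ^ 2 + c ^ 2) := by
    refine le_trans ?_ (add_add_sq_le a b c)
    rw [← sq_abs]
    gcongr
  have h5 : (n : ℝ) ^ 2 * τ ≤ 3 * ((a : ℝ) ^ 2 + b ^ 2 + c ^ 2) * τ := by
    gcongr
  have r1 : ‖y‖ * ‖z‖ * ‖x‖ = ‖x‖ * ‖y‖ * ‖z‖ := by ring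
  have r2 : ‖z‖ * ‖x‖ * ‖y‖ = ‖x‖ * ‖y‖ * ‖z‖ := by ring
  rw [r1] at h2
  rw [r2] at h3
  linarith

/-- The weighted coefficients `k² ((TF) (TG) (TH))_k` of the product of three sine series. -/
theorem exists_cube : ∃ N : Seq1 L2R →L[ℝ] Seq1 L2R →L[ℝ] Seq1 L2R →L[ℝ] Seq1 L2R,
    ∀ (a b c : ℕ) (u v w : L2R), N (single1 a u) (single1 b v) (single1 c w) = (1 / 4 : ℝ) •
      (signedSingle (a + b - c) (tripleMul (D.T c w) (D.T b v) (D.T a u))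
        + signedSingle (a - b + c) (tripleMul (D.T c w) (D.T b v) (D.T a u))
        + signedSingle (-a + b + c) (tripleMul (D.T c w) (D.T b v) (D.T a u))
        - signedSingle (a + b + c) (tripleMul (D.T c w) (D.T b v) (D.T a u))) := by
  have key : ∀ n : ℕ → ℕ → ℕ → ℤ, (∀ a b c, |(n a b c : ℝ)| ≤ c + b + a) →
      ∃ M : Seq1 L2R →L[ℝ] Seq1 L2R →L[ℝ] Seq1 L2R →L[ℝ] Seq1 L2R, ∀ a b c u v w,
        M (single1 a u) (single1 b v) (single1 c w)
          = signedSingle (n a b c) (tripleMul (D.T c w) (D.T b v) (D.T a u)) := by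
    intro n hn
    -- The indices are listed as `c b a` because the lift reverses its arguments.
    obtain ⟨M, hM⟩ := exists_trilinear_lift
      (fun c b a => triComp (D.T c) (D.T b) (D.T a) (signedSingle (n a b c))) (36 * D.C ^ 3)
      (fun c b a => D.norm_signedSingle_triple_le c b a _ (hn a b c))
    exact ⟨M, fun a b c u v w => by rw [hM, triComp_apply]⟩
  have hp : ∀ a : ℕ, (0 : ℝ) ≤ a := fun a => a.cast_nonneg
  obtain ⟨M1, h1⟩ := key (fun a b c => a + b - c) fun a b c => by
    push_cast
    rw [abs_le]
    constructor <;> linarith [hp a, hp b, hp c]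
  obtain ⟨M2, h2⟩ := key (fun a b c => a - b + c) fun a b c => by
    push_cast
    rw [abs_le]
    constructor <;> linarith [hp a, hp b, hp c]
  obtain ⟨M3, h3⟩ := key (fun a b c => -a + b + c) fun a b c => by
    push_cast
    rw [abs_le]
    constructor <;> linarith [hp a, hp b, hp c]
  obtain ⟨M4, h4⟩ := key (fun a b c => a + b + c) fun a b c => by
    push_cast
    rw [abs_le]
    constructor <;> linarith [hp a, hp b, hp c]
  refine ⟨(1 / 4 : ℝ) • (M1 + M2 + M3 - M4), fun a b c u v w => ?_⟩
  simp only [smul_apply, add_apply, sub_apply, h1, h2, h3, h4]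

end ModeInverse

/-! ### Trigonometric series with coefficients in a Banach space -/

/-- The function `x ↦ cos (k x)` on the torus. -/
def cosMode (k : ℕ) : Torus → ℝ :=
  Function.Periodic.lift (f := fun s : ℝ => Real.cos (k * s)) (fun s => by
    have : (k : ℝ) * (s + 2 * Real.pi) = k * s + k * (2 * Real.pi) := by ring
    simp only [this, Real.cos_add_nat_mul_two_pi])

theorem cosMode_coe (k : ℕ) (s : ℝ) : cosMode k (s : Torus) = Real.cos (k * s) := rfl

theorem cosMode_continuous (k : ℕ) : Continuous (cosMode k) :=
  torus_test_continuous (by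
    simp only [cosMode_coe]
    fun_prop)

theorem sinMode_zero : sinMode 0 = 0 := by
  funext x
  induction x using QuotientAddGroup.induction_on with
  | H s => simp [sinMode_coe]

/-- `sin (k x)` as a continuous function. -/
def sinC (k : ℕ) : C(Torus, ℝ) := ⟨sinMode k, sinMode_continuous k⟩

/-- `cos (k x)` as a continuous function. -/
def cosC (k : ℕ) : C(Torus, ℝ) := ⟨cosMode k, cosMode_continuous k⟩

theorem sinC_apply (k : ℕ) (x : Torus) : sinC k x = sinMode k x := rfl

theorem norm_sinC_le (k : ℕ) : ‖sinC k‖ ≤ 1 := by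
  rw [ContinuousMap.norm_le _ zero_le_one]
  intro x
  induction x using QuotientAddGroup.induction_on with
  | H s => exact Real.abs_sin_le_one _

theorem norm_cosC_le (k : ℕ) : ‖cosC k‖ ≤ 1 := by
  rw [ContinuousMap.norm_le _ zero_le_one]
  intro x
  induction x using QuotientAddGroup.induction_on with
  | H s => exact Real.abs_cos_le_one _

theorem hasDerivAt_sinMode (k : ℕ) (s : ℝ) :
    HasDerivAt (fun s : ℝ => sinMode k s) (k * cosMode k s) s := by
  simp only [sinMode_coe, cosMode_coe]
  have := ((hasDerivAt_id s).const_mul (k : ℝ)).sin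
  simpa [mul_comm] using this

theorem hasDerivAt_cosMode (k : ℕ) (s : ℝ) :
    HasDerivAt (fun s : ℝ => cosMode k s) (-(k * sinMode k s)) s := by
  simp only [sinMode_coe, cosMode_coe]
  have := ((hasDerivAt_id s).const_mul (k : ℝ)).cos
  simpa [mul_comm] using this

/-- Fundamental theorem of calculus over one period. -/
theorem torus_integral_deriv {h h' : Torus → ℝ} (hc : Continuous h')
    (hd : ∀ s : ℝ, HasDerivAt (fun s : ℝ => h s) (h' s) s) : ∫ x, h' x = 0 := by
  rw [← AddCircle.intervalIntegral_preimage (2 * Real.pi) 0,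
    intervalIntegral.integral_eq_sub_of_hasDerivAt (fun s _ => hd s)]
  · rw [AddCircle.coe_add_period, sub_self]
  · exact (hc.comp (AddCircle.continuous_mk' _)).intervalIntegrable _ _

theorem weakDerivT_smul_const {E : Type} [NormedAddCommGroup E] [NormedSpace ℝ E]
    [CompleteSpace E] {g g' : Torus → ℝ} (hg' : Continuous g')
    (hd : ∀ s : ℝ, HasDerivAt (fun s : ℝ => g s) (g' s) s) (v : E) :
    IsWeakDerivT (fun x => g x • v) (fun x => g' x • v) := by
  intro η η' hη hη'
  have cg : Continuous g := torus_test_continuous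
    (continuous_iff_continuousAt.2 fun s => (hd s).continuousAt)
  have cη := torus_test_continuous hη.continuous
  have cη' := torus_test_deriv_continuous hη hη'
  have i1 : Integrable (fun x => η' x * g x) volume :=
    (cη'.mul cg).integrable_of_hasCompactSupport (HasCompactSupport.of_compactSpace _)
  have i2 : Integrable (fun x => η x * g' x) volume :=
    (cη.mul hg').integrable_of_hasCompactSupport (HasCompactSupport.of_compactSpace _)
  have h0 : ∫ x, (η' x * g x + η x * g' x) = 0 :=
    torus_integral_deriv (h := fun x => η x * g x) ((cη'.mul cg).add (cη.mul hg'))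
      (fun s => (hη' s).mul (hd s))
  rw [integral_add i1 i2] at h0
  simp only [smul_smul]
  rw [integral_smul_const, integral_smul_const, ← neg_smul]
  congr 1
  linarith

theorem IsWeakDerivT.congr {E : Type} [NormedAddCommGroup E] [NormedSpace ℝ E]
    {u v u' v' : Torus → E} (h : IsWeakDerivT u v) (hu : u' =ᵐ[volume] u)
    (hv : v' =ᵐ[volume] v) : IsWeakDerivT u' v' := by
  intro η η' hη hη'
  refine Eq.trans (integral_congr_ae ?_) ((h η η' hη hη').trans (congrArg _ (integral_congr_ae ?_)))
  · filter_upwards [hu] with x hx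
    rw [hx]
  · filter_upwards [hv] with x hx
    rw [hx]

section Series

variable {E : Type} [NormedAddCommGroup E] [NormedSpace ℝ E]

/-- The map `v ↦ (x ↦ g x • v)`. -/
def tensC (g : C(Torus, ℝ)) : E →L[ℝ] C(Torus, E) :=
  LinearMap.mkContinuous
    { toFun := fun v => ⟨fun x => g x • v, g.continuous.smul continuous_const⟩
      map_add' := fun u v => by ext x; simp
      map_smul' := fun c v => by ext x; exact smul_comm (g x) c v }
    ‖g‖ (fun v => by
      rw [ContinuousMap.norm_le _ (by positivity)]
      intro x
      simp only [LinearMap.coe_mk, AddHom.coe_mk, ContinuousMap.coe_mk, norm_smul]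
      gcongr
      exact g.norm_coe_le_norm x)

theorem tensC_apply (g : C(Torus, ℝ)) (v : E) (x : Torus) : tensC g v x = g x • v := rfl

theorem norm_tensC_comp_le {g : C(Torus, ℝ)} (hg : ‖g‖ ≤ 1) {A : L2R →L[ℝ] E} {C : ℝ}
    (hA : ‖A‖ ≤ C) : ‖tensC g ∘L A‖ ≤ C := by
  refine (ContinuousLinearMap.opNorm_comp_le _ _).trans ?_
  have h : ‖(tensC g : E →L[ℝ] C(Torus, E))‖ ≤ 1 :=
    (LinearMap.mkContinuous_norm_le _ (norm_nonneg g) _).trans hg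
  calc _ ≤ 1 * C := by gcongr
    _ = C := one_mul C

theorem torus_integrable_smul {η : Torus → ℝ} (hη : Continuous η) (u : C(Torus, E)) :
    Integrable (fun x => η x • u x) volume :=
  (hη.smul u.continuous).integrable_of_hasCompactSupport (HasCompactSupport.of_compactSpace _)

/-- Integration against a continuous function. -/
def intSmul (η : C(Torus, ℝ)) : C(Torus, E) →L[ℝ] E :=
  LinearMap.mkContinuous
    { toFun := fun u => ∫ x, η x • u x
      map_add' := fun u v => by
        simp only [ContinuousMap.add_apply, smul_add]
        exact integral_add (torus_integrable_smul η.continuous u)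
          (torus_integrable_smul η.continuous v)
      map_smul' := fun c u => by
        simp only [ContinuousMap.smul_apply, smul_comm _ c, integral_smul, RingHom.id_apply] }
    (‖η‖ * (volume : Measure Torus).real univ) (fun u => by
      refine (norm_integral_le_of_norm_le_const (C := ‖η‖ * ‖u‖)
        (Eventually.of_forall fun x => ?_)).trans_eq (by ring)
      rw [norm_smul]
      gcongr
      · exact η.norm_coe_le_norm x
      · exact u.norm_coe_le_norm x)

/-- For a fixed test function both sides of the weak derivative identity are bounded linear in `F`,
so agreement on single modes suffices. -/
theorem weakDerivT_of_single {U V : Seq1 L2R →L[ℝ] C(Torus, E)}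
    (h : ∀ k f, IsWeakDerivT (U (single1 k f)) (V (single1 k f))) (F : Seq1 L2R) :
    IsWeakDerivT (U F) (V F) := by
  intro η η' hη hη'
  let e : C(Torus, ℝ) := ⟨η, torus_test_continuous hη.continuous⟩
  let e' : C(Torus, ℝ) := ⟨η', torus_test_deriv_continuous hη hη'⟩
  have : intSmul e' ∘L U = -(intSmul e ∘L V) := seq1_clm_ext fun k f => h k f η η' hη hη'
  exact congrArg (fun A => A F) this

/-- The class in `L²(𝕋; E)` of a continuous function. -/
def toLpT : C(Torus, E) →L[ℝ] L2T E := ContinuousMap.toLp 2 volume ℝ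

theorem toLpT_ae (u : C(Torus, E)) : (toLpT u : Torus → E) =ᵐ[volume] u :=
  ContinuousMap.coeFn_toLp (p := 2) (𝕜 := ℝ) volume u

variable [CompleteSpace E]

/-- The series `∑ₖ sin (k x) Aₖ Fₖ`. -/
def sinSeries (A : ℕ → L2R →L[ℝ] E) (C : ℝ) (hA : ∀ k, ‖A k‖ ≤ C) :
    Seq1 L2R →L[ℝ] C(Torus, E) :=
  lift1 (fun k => tensC (sinC k) ∘L A k) C (fun k => norm_tensC_comp_le (norm_sinC_le k) (hA k))

/-- The series `∑ₖ cos (k x) Aₖ Fₖ`. -/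
def cosSeries (A : ℕ → L2R →L[ℝ] E) (C : ℝ) (hA : ∀ k, ‖A k‖ ≤ C) :
    Seq1 L2R →L[ℝ] C(Torus, E) :=
  lift1 (fun k => tensC (cosC k) ∘L A k) C (fun k => norm_tensC_comp_le (norm_cosC_le k) (hA k))

theorem hasSum_sinSeries (A : ℕ → L2R →L[ℝ] E) {C : ℝ} (hA : ∀ k, ‖A k‖ ≤ C) (F : Seq1 L2R) :
    HasSum (fun k => tensC (sinC k) (A k (F k))) (sinSeries A C hA F) := by
  rw [sinSeries]
  exact hasSum_lift1 _ _ F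

theorem sinSeries_single (A : ℕ → L2R →L[ℝ] E) {C : ℝ} (hA : ∀ k, ‖A k‖ ≤ C) (k : ℕ) (f : L2R)
    (x : Torus) : sinSeries A C hA (single1 k f) x = sinMode k x • A k f := by
  rw [sinSeries, lift1_single]
  rfl

theorem cosSeries_single (A : ℕ → L2R →L[ℝ] E) {C : ℝ} (hA : ∀ k, ‖A k‖ ≤ C) (k : ℕ) (f : L2R)
    (x : Torus) : cosSeries A C hA (single1 k f) x = cosMode k x • A k f := by
  rw [cosSeries, lift1_single]
  rfl

theorem weakDerivT_sinSeries {A A' : ℕ → L2R →L[ℝ] E} {C C' : ℝ} (hA : ∀ k, ‖A k‖ ≤ C)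
    (hA' : ∀ k, ‖A' k‖ ≤ C') (h : ∀ k f, A' k f = (k : ℝ) • A k f) (F : Seq1 L2R) :
    IsWeakDerivT (sinSeries A C hA F) (cosSeries A' C' hA' F) := by
  refine weakDerivT_of_single (fun k f => ?_) F
  refine (weakDerivT_smul_const (g' := fun x => k * cosMode k x)
    (continuous_const.mul (cosMode_continuous k)) (hasDerivAt_sinMode k) (A k f)).congr (Eventually.of_forall fun x => ?_)
    (Eventually.of_forall fun x => ?_)
  · exact sinSeries_single _ _ _ _ _
  · rw [cosSeries_single, h, smul_smul, mul_comm]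

/-- The mode `k = 0` is exempt in `h`, because its sine vanishes. -/
theorem weakDerivT_cosSeries {A A' : ℕ → L2R →L[ℝ] E} {C C' : ℝ} (hA : ∀ k, ‖A k‖ ≤ C)
    (hA' : ∀ k, ‖A' k‖ ≤ C') (h : ∀ k f, k ≠ 0 → A' k f = -((k : ℝ) • A k f)) (F : Seq1 L2R) :
    IsWeakDerivT (cosSeries A C hA F) (sinSeries A' C' hA' F) := by
  refine weakDerivT_of_single (fun k f => ?_) F
  refine (weakDerivT_smul_const (g' := fun x => -(k * sinMode k x))
    (continuous_const.mul (sinMode_continuous k)).neg (hasDerivAt_cosMode k) (A k f)).congr (Eventually.of_forall fun x => ?_)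
    (Eventually.of_forall fun x => ?_)
  · exact cosSeries_single _ _ _ _ _
  · rw [sinSeries_single]
    rcases eq_or_ne k 0 with rfl | hk
    · simp [sinMode_zero]
    · simp only [h k f hk, smul_neg, smul_smul, neg_smul, mul_comm]

end Series

theorem sinTensor_ae (k : ℕ) (φ : H1) :
    (sinTensor k φ : Torus → H1) =ᵐ[volume] fun x => sinMode k x • φ :=
  MemLp.coeFn_toLp (((sinMode_continuous k).smul continuous_const).memLp_of_hasCompactSupport
    (HasCompactSupport.of_compactSpace _))

theorem sinTensor_eq (k : ℕ) (φ : H1) : sinTensor k φ = toLpT (tensC (sinC k) φ) := by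
  apply Lp.ext
  filter_upwards [sinTensor_ae k φ, toLpT_ae (tensC (sinC k) φ)] with x h1 h2
  rw [h1, h2, tensC_apply, sinC_apply]

/-! ### Sequences of coefficients and solutions -/

/-- The diagonal operator on `ℓ¹(ℕ; L²(ℝ))` defined by a bounded sequence of operators. -/
def diag1 (A : ℕ → L2R →L[ℝ] L2R) (C : ℝ) (hA : ∀ k, ‖A k‖ ≤ C) : Seq1 L2R →L[ℝ] Seq1 L2R :=
  lift1 (fun k => single1 k ∘L A k) C (fun k => by
    refine ContinuousLinearMap.opNorm_le_bound _ ((norm_nonneg _).trans (hA k)) fun v => ?_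
    rw [ContinuousLinearMap.comp_apply, norm_single1]
    exact (A k).le_of_opNorm_le (hA k) v)

theorem diag1_single (A : ℕ → L2R →L[ℝ] L2R) {C : ℝ} (hA : ∀ k, ‖A k‖ ≤ C) (k : ℕ) (f : L2R) :
    diag1 A C hA (single1 k f) = single1 k (A k f) := by
  rw [diag1, lift1_single]
  rfl

theorem norm_id_le : ‖ContinuousLinearMap.id ℝ L2R‖ ≤ 1 := ContinuousLinearMap.norm_id_le

theorem norm_natCast_inv_smul_id_le (n : ℕ) : ‖((n : ℝ)⁻¹) • ContinuousLinearMap.id ℝ L2R‖ ≤ 1 := by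
  rw [norm_smul, Real.norm_eq_abs, abs_of_nonneg (by positivity)]
  have : ((n : ℝ)⁻¹) ≤ 1 := Nat.cast_inv_le_one n
  calc _ ≤ (1 : ℝ) * 1 := by gcongr; exact norm_id_le
    _ = 1 := one_mul 1

/-- The sine series with the given coefficients. -/
def sinL2 : Seq1 L2R →L[ℝ] C(Torus, L2R) :=
  sinSeries (fun _ => ContinuousLinearMap.id ℝ L2R) 1 (fun _ => norm_id_le)

theorem sinL2_single (k : ℕ) (f : L2R) (x : Torus) : sinL2 (single1 k f) x = sinMode k x • f :=
  sinSeries_single _ _ _ _ _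

/-- The sine series with coefficients divided by `k²`. -/
def sinL2Div : Seq1 L2R →L[ℝ] C(Torus, L2R) :=
  sinSeries (fun k => (((k ^ 2 : ℕ) : ℝ)⁻¹) • ContinuousLinearMap.id ℝ L2R) 1
    (fun k => norm_natCast_inv_smul_id_le (k ^ 2))

/-- The cosine series with coefficients divided by `k`. -/
def cosL2Div : Seq1 L2R →L[ℝ] C(Torus, L2R) :=
  cosSeries (fun k => ((k : ℝ)⁻¹) • ContinuousLinearMap.id ℝ L2R) 1
    (fun k => norm_natCast_inv_smul_id_le k)

theorem weakDerivT_sinL2Div (M : Seq1 L2R) : IsWeakDerivT (sinL2Div M) (cosL2Div M) := by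
  refine weakDerivT_sinSeries _ _ (fun k f => ?_) M
  rw [smul_apply, smul_apply, smul_smul]
  congr 1
  -- The convention `0⁻¹ = 0` settles the mode `k = 0`.
  rcases eq_or_ne k 0 with rfl | hk
  · simp
  · have : (k : ℝ) ≠ 0 := by exact_mod_cast hk
    push_cast
    field_simp

theorem weakDerivT_cosL2Div (M : Seq1 L2R) : IsWeakDerivT (cosL2Div M) (-sinL2 M) := by
  have h := weakDerivT_cosSeries (A := fun k => ((k : ℝ)⁻¹) • ContinuousLinearMap.id ℝ L2R)
    (A' := fun _ => -ContinuousLinearMap.id ℝ L2R) (C' := 1)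
    (fun k => norm_natCast_inv_smul_id_le k) (fun k => by rw [norm_neg]; exact norm_id_le)
    (fun k f hk => by
      have : (k : ℝ) ≠ 0 := by exact_mod_cast hk
      rw [smul_apply, neg_apply, smul_smul, mul_inv_cancel₀ this, one_smul]) M
  have e : sinSeries (fun _ => -ContinuousLinearMap.id ℝ L2R) 1
      (fun k => by rw [norm_neg]; exact norm_id_le) = -sinL2 :=
    seq1_clm_ext fun k f => by
      ext1 x
      rw [sinSeries_single, neg_apply, neg_apply, ContinuousMap.neg_apply, sinL2_single, smul_neg]
      rfl
  rw [e] at h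
  exact h

/-- Dividing by `k²` undoes the weight, and the sign accounts for `sin (-k x) = -sin (k x)`, so any
integer frequency is handled by nonnegative modes. -/
theorem sinL2Div_signedSingle (n : ℤ) (p : L2R) (s : ℝ) :
    sinL2Div (signedSingle n p) (s : Torus) = Real.sin (n * s) • p := by
  have h : sinL2Div (signedSingle n p) (s : Torus) = ((n.sign : ℝ) * (n : ℝ) ^ 2) •
      Real.sin (n.natAbs * s) • (((n.natAbs ^ 2 : ℕ) : ℝ)⁻¹) • p := by
    rw [signedSingle, smul_apply, map_smul, ContinuousMap.smul_apply, sinL2Div, sinSeries_single,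
      sinMode_coe]
    rfl
  rw [h, smul_smul, smul_smul]
  congr 1
  rcases eq_or_ne n 0 with rfl | hn
  · simp
  have h0 : (n : ℝ) ≠ 0 := by exact_mod_cast hn
  have h1 : ((n.natAbs ^ 2 : ℕ) : ℝ) = (n : ℝ) ^ 2 := by
    rw [Nat.cast_pow, Nat.cast_natAbs, Int.cast_abs, sq_abs]
  rw [h1]
  rcases lt_or_gt_of_ne hn with h | h
  · have h2 : ((n.natAbs : ℕ) : ℝ) = -n := by
      rw [Nat.cast_natAbs, Int.cast_abs, abs_of_neg (by exact_mod_cast h)]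
    rw [Int.sign_eq_neg_one_of_neg h, h2, neg_mul, Real.sin_neg]
    push_cast
    field_simp
  · have h2 : ((n.natAbs : ℕ) : ℝ) = n := by
      rw [Nat.cast_natAbs, Int.cast_abs, abs_of_pos (by exact_mod_cast h)]
    rw [Int.sign_eq_one_of_pos h, h2]
    push_cast
    field_simp

theorem sin_mul_sin_mul_sin (a b c : ℝ) : Real.sin c * (Real.sin b * Real.sin a)
    = 1 / 4 * (Real.sin (a + b - c) + Real.sin (a - b + c) + Real.sin (-a + b + c)
      - Real.sin (a + b + c)) := by
  simp only [Real.sin_add, Real.sin_sub, Real.cos_add, Real.cos_sub, Real.sin_neg, Real.cos_neg]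
  ring

/-! ### Pairing with `L²` functions on the torus -/

section Pairing

variable {E : Type} [NormedAddCommGroup E] [InnerProductSpace ℝ E]

/-- The functional `u ↦ ∫ ⟨u, Ψ⟩`. -/
def pairT (Ψ : L2T E) : C(Torus, E) →L[ℝ] ℝ := (innerSL ℝ).flip Ψ ∘L toLpT

theorem pairT_ae (Ψ : L2T E) (u : C(Torus, E)) :
    (fun x => inner ℝ ((toLpT u : L2T E) x) (Ψ x)) =ᵐ[volume] fun x => inner ℝ (u x) (Ψ x) := by
  filter_upwards [toLpT_ae u] with x hx
  rw [hx]

theorem pairT_eq (Ψ : L2T E) (u : C(Torus, E)) : pairT Ψ u = ∫ x, inner ℝ (u x) (Ψ x) := by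
  have : pairT Ψ u = inner ℝ (toLpT u) Ψ := rfl
  rw [this, L2.inner_def]
  exact integral_congr_ae (pairT_ae Ψ u)

theorem integrable_pairT (Ψ : L2T E) (u : C(Torus, E)) :
    Integrable (fun x => inner ℝ (u x) (Ψ x)) volume :=
  (L2.integrable_inner (𝕜 := ℝ) (toLpT u) Ψ).congr (pairT_ae Ψ u)

/-- Pairing with one mode sees only the corresponding Fourier coefficient of `Ψ`. This turns the
weak formulation into the `H¹(ℝ)` equations of the separate wavenumbers. -/
theorem pairT_tensC {V : Type} [NormedAddCommGroup V] [NormedSpace ℝ V] [CompleteSpace V]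
    (L : V →L[ℝ] E) (Ψ : L2T V) (g : C(Torus, ℝ)) (v : E) :
    pairT (L.compLpL 2 volume Ψ) (tensC g v) = inner ℝ v (L (∫ x, g x • Ψ x)) := by
  rw [pairT_eq]
  have h := ((innerSL ℝ v) ∘L L).integral_comp_comm (torus_test_integrable g.continuous Ψ)
  refine Eq.trans ?_ h
  apply integral_congr_ae
  filter_upwards [L.coeFn_compLpL (p := 2) Ψ] with x hx
  rw [hx, tensC_apply, real_inner_smul_left, ContinuousLinearMap.comp_apply, map_smul, map_smul]
  rfl

end Pairing

namespace ModeInverse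

variable {α ls : ℝ} {ks : ℕ} {φs : H1} (D : ModeInverse α ls ks φs)

/-- The function `∑ₖ sin (k x) Tₖ Fₖ`. -/
def val : Seq1 L2R →L[ℝ] C(Torus, H1) :=
  sinSeries D.T D.C (fun k => ContinuousLinearMap.opNorm_le_bound _ D.C_nonneg (D.norm_T_le k))

theorem norm_smul_T_le (k : ℕ) : ‖(k : ℝ) • D.T k‖ ≤ D.C :=
  ContinuousLinearMap.opNorm_le_bound _ D.C_nonneg fun f => by
    rw [smul_apply, norm_smul, Real.norm_eq_abs, Nat.abs_cast]
    exact D.norm_T k f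

theorem norm_sq_smul_T_le (k : ℕ) : ‖((k : ℝ) ^ 2) • (toL2 ∘L D.T k)‖ ≤ D.C :=
  ContinuousLinearMap.opNorm_le_bound _ D.C_nonneg fun f => by
    rw [smul_apply, norm_smul, Real.norm_eq_abs, abs_of_nonneg (by positivity)]
    exact D.norm_toL2_T k f

/-- The function `∑ₖ k cos (k x) Tₖ Fₖ`. -/
def valx : Seq1 L2R →L[ℝ] C(Torus, H1) :=
  cosSeries (fun k => (k : ℝ) • D.T k) D.C D.norm_smul_T_le

/-- The coefficients `k² Tₖ Fₖ`. -/
def sqT : Seq1 L2R →L[ℝ] Seq1 L2R :=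
  diag1 (fun k => ((k : ℝ) ^ 2) • (toL2 ∘L D.T k)) D.C D.norm_sq_smul_T_le

theorem sqT_single (k : ℕ) (f : L2R) :
    D.sqT (single1 k f) = single1 k (((k : ℝ) ^ 2) • toL2 (D.T k f)) :=
  diag1_single _ _ _ _

theorem val_single (k : ℕ) (f : L2R) : D.val (single1 k f) = tensC (sinC k) (D.T k f) := by
  rw [val, sinSeries, lift1_single]
  rfl

theorem valx_single (k : ℕ) (f : L2R) :
    D.valx (single1 k f) = tensC (cosC k) ((k : ℝ) • D.T k f) := by
  rw [valx, cosSeries, lift1_single]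
  rfl

theorem weakDerivT_val (F : Seq1 L2R) : IsWeakDerivT (D.val F) (D.valx F) :=
  weakDerivT_sinSeries _ _ (fun _ _ => rfl) F

theorem weakDerivT_valx (F : Seq1 L2R) :
    IsWeakDerivT (fun x => toL2 (D.valx F x)) (-sinL2 (D.sqT F)) := by
  refine weakDerivT_of_single (U := toL2.compLeftContinuous ℝ Torus ∘L D.valx)
    (V := -(sinL2 ∘L D.sqT)) (fun k f => ?_) F
  refine (weakDerivT_smul_const (g' := fun x => -(k * sinMode k x))
    (continuous_const.mul (sinMode_continuous k)).neg (hasDerivAt_cosMode k)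
    ((k : ℝ) • toL2 (D.T k f))).congr (Eventually.of_forall fun x => ?_)
    (Eventually.of_forall fun x => ?_)
  · change toL2 (D.valx (single1 k f) x) = _
    rw [valx_single, tensC_apply, map_smul, map_smul]
    rfl
  · change -(sinL2 (D.sqT (single1 k f)) x) = _
    rw [sqT_single, sinL2_single]
    simp only [smul_smul]
    rw [← neg_smul]
    congr 1
    ring

theorem toL2T_toLpT_ae (u : C(Torus, H1)) :
    (toL2T (toLpT u) : Torus → L2R) =ᵐ[volume] fun x => toL2 (u x) := by
  filter_upwards [toL2.coeFn_compLpL (p := 2) (toLpT u), toLpT_ae u] with x h1 h2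
  exact h1.trans (congrArg _ h2)

/-- The triple `(Φ, Φₓ, Φₓₓ)` for `Φ = ∑ₖ sin (k x) Tₖ Fₖ`. -/
def toSol : Seq1 L2R →L[ℝ] SolSpace :=
  ContinuousLinearMap.codRestrict
    ((toLpT ∘L D.val).prod ((toLpT ∘L D.valx).prod (toLpT ∘L (-(sinL2 ∘L D.sqT))))) SolSpace
    (fun F => ⟨(D.weakDerivT_val F).congr (toLpT_ae _) (toLpT_ae _),
      (D.weakDerivT_valx F).congr (toL2T_toLpT_ae _) (toLpT_ae _)⟩)

theorem solVal_toSol (F : Seq1 L2R) : solVal (D.toSol F) = toLpT (D.val F) := rfl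

theorem hasSum_val (F : Seq1 L2R) :
    HasSum (fun k => tensC (sinC k) (D.T k (F k))) (D.val F) :=
  hasSum_sinSeries _ _ F

theorem isSineSeries_toSol (F : Seq1 L2R) : IsSineSeries (solVal (D.toSol F)) := by
  -- Sine series start at `k = 1`; dropping the index `0` is harmless since `T 0 = 0`.
  refine ⟨fun k => D.T (k + 1) (F (k + 1)), ?_⟩
  have h : HasSum (fun k => sinTensor k (D.T k (F k))) (toLpT (D.val F)) := by
    simp only [sinTensor_eq]
    exact ContinuousLinearMap.hasSum toLpT (D.hasSum_val F)
  have h0 : sinTensor 0 (D.T 0 (F 0)) = 0 := by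
    rw [sinTensor_eq, D.T_zero]
    simp only [zero_apply, map_zero]
  have h1 := (hasSum_nat_add_iff' (f := fun k => sinTensor k (D.T k (F k))) 1).2 h
  simp only [Finset.sum_range_one, h0, sub_zero] at h1
  exact h1

/-- The weighted coefficients of the product of three sine series. -/
def cube : Seq1 L2R →L[ℝ] Seq1 L2R →L[ℝ] Seq1 L2R →L[ℝ] Seq1 L2R := Classical.choose D.exists_cube

theorem cube_single (a b c : ℕ) (u v w : L2R) :
    D.cube (single1 a u) (single1 b v) (single1 c w) = (1 / 4 : ℝ) •
      (signedSingle (a + b - c) (tripleMul (D.T c w) (D.T b v) (D.T a u))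
        + signedSingle (a - b + c) (tripleMul (D.T c w) (D.T b v) (D.T a u))
        + signedSingle (-a + b + c) (tripleMul (D.T c w) (D.T b v) (D.T a u))
        - signedSingle (a + b + c) (tripleMul (D.T c w) (D.T b v) (D.T a u))) :=
  Classical.choose_spec D.exists_cube a b c u v w

theorem sinL2Div_cube_single (a b c : ℕ) (u v w : L2R) (x : Torus) :
    sinL2Div (D.cube (single1 a u) (single1 b v) (single1 c w)) x
      = tripleMul (D.val (single1 c w) x) (D.val (single1 b v) x) (D.val (single1 a u) x) := by
  induction x using QuotientAddGroup.induction_on with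
  | H s =>
    have e : ∀ F G : Seq1 L2R, ∀ y, sinL2Div (F + G) y = sinL2Div F y + sinL2Div G y :=
      fun F G y => by rw [map_add]; rfl
    have e' : ∀ F G : Seq1 L2R, ∀ y, sinL2Div (F - G) y = sinL2Div F y - sinL2Div G y :=
      fun F G y => by rw [map_sub]; rfl
    rw [cube_single, map_smul, ContinuousMap.smul_apply, e', e, e, sinL2Div_signedSingle,
      sinL2Div_signedSingle, sinL2Div_signedSingle, sinL2Div_signedSingle, ← add_smul, ← add_smul,
      ← sub_smul, smul_smul]
    simp only [val_single, tensC_apply, sinC_apply, sinMode_coe, map_smul, smul_apply, smul_smul]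
    congr 1
    push_cast
    simp only [add_mul, sub_mul, neg_mul]
    rw [← sin_mul_sin_mul_sin]
    ring

/-- The product formula for three sines gives the identity on single modes; it extends one variable
at a time by continuity at a fixed `x`. -/
theorem sinL2Div_cube (F G H : Seq1 L2R) (x : Torus) :
    sinL2Div (D.cube F G H) x = tripleMul (D.val H x) (D.val G x) (D.val F x) := by
  let ev : Seq1 L2R →L[ℝ] L2R := ContinuousMap.evalCLM ℝ x ∘L sinL2Div
  let vx : Seq1 L2R →L[ℝ] H1 := ContinuousMap.evalCLM ℝ x ∘L D.val
  have h1 : ∀ a b u v H, ev (D.cube (single1 a u) (single1 b v) H)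
      = tripleMul (vx H) (vx (single1 b v)) (vx (single1 a u)) := fun a b u v H => by
    have : ev ∘L D.cube (single1 a u) (single1 b v)
        = (tripleMul.flip (vx (single1 b v))).flip (vx (single1 a u)) ∘L vx :=
      seq1_clm_ext fun c w => D.sinL2Div_cube_single a b c u v w x
    exact congrArg (fun A => A H) this
  have h2 : ∀ a u G H, ev (D.cube (single1 a u) G H)
      = tripleMul (vx H) (vx G) (vx (single1 a u)) := fun a u G H => by
    have : ev ∘L (D.cube (single1 a u)).flip H
        = (tripleMul (vx H)).flip (vx (single1 a u)) ∘L vx :=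
      seq1_clm_ext fun b v => h1 a b u v H
    exact congrArg (fun A => A G) this
  have h3 : ev ∘L (D.cube.flip G).flip H = tripleMul (vx H) (vx G) ∘L vx :=
    seq1_clm_ext fun a u => h2 a u G H
  exact congrArg (fun A => A F) h3

theorem isCubeDxx_toSol (F : Seq1 L2R) :
    IsCubeDxx (solVal (D.toSol F)) (toLpT (-sinL2 (D.cube F F F))) := by
  refine ⟨toLpT (sinL2Div (D.cube F F F)), toLpT (cosL2Div (D.cube F F F)), ?_,
    (weakDerivT_sinL2Div _).congr (toLpT_ae _) (toLpT_ae _),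
    (weakDerivT_cosL2Div _).congr (toLpT_ae _) (toLpT_ae _)⟩
  rw [solVal_toSol]
  filter_upwards [toLpT_ae (sinL2Div (D.cube F F F)), toLpT_ae (D.val F)] with x h1 h2
  rw [h1, h2, sinL2Div_cube]
  filter_upwards [tripleMul_ae (D.val F x) (D.val F x) (D.val F x)] with y hy
  rw [hy]
  ring

end ModeInverse

/-! ### The weak formulation -/

/-- Multiplication of all coefficients by a bounded function. -/
def smulSeq (Γ : LinfR) : Seq1 L2R →L[ℝ] Seq1 L2R :=
  diag1 (fun _ => smulL Γ) ‖smulL Γ‖ (fun _ => le_rfl)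

theorem smulSeq_single (Γ : LinfR) (k : ℕ) (f : L2R) :
    smulSeq Γ (single1 k f) = single1 k (smulL Γ f) :=
  diag1_single _ _ _ _

theorem sinL2_smulSeq (Γ : LinfR) (M : Seq1 L2R) (x : Torus) :
    sinL2 (smulSeq Γ M) x = smulL Γ (sinL2 M x) := by
  have : ContinuousMap.evalCLM ℝ x ∘L sinL2 ∘L smulSeq Γ
      = smulL Γ ∘L ContinuousMap.evalCLM ℝ x ∘L sinL2 := seq1_clm_ext fun k f => by
    change sinL2 (smulSeq Γ (single1 k f)) x = smulL Γ (sinL2 (single1 k f) x)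
    rw [smulSeq_single, sinL2_single, sinL2_single, map_smul]
  exact congrArg (fun A => A M) this

/-- The weak derivative tested with `cos (k x)`. It supplies the second factor `k` in the delta
term. -/
theorem integral_sinMode_smul {Ψ Ψx : L2T H1} (h : IsWeakDerivT Ψ Ψx) (k : ℕ) :
    ∫ x, cosC k x • Ψx x = (k : ℝ) • ∫ x, sinC k x • Ψ x := by
  have hc : ContDiff ℝ (⊤ : ℕ∞) (fun s : ℝ => cosMode k s) := by
    simp only [cosMode_coe]
    fun_prop
  have := h (cosMode k) (fun x => -(k * sinMode k x)) hc (hasDerivAt_cosMode k)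
  simp only [neg_smul, integral_neg, neg_inj, mul_smul, integral_smul] at this
  exact this.symm

namespace ModeInverse

variable {α ls : ℝ} {ks : ℕ} {φs : H1} (D : ModeInverse α ls ks φs)

/-- The projection onto the critical mode. -/
def proj (ks : ℕ) (φs : H1) : Seq1 L2R →L[ℝ] Seq1 L2R :=
  (innerSL ℝ (toL2 φs) ∘L coef1 ks).smulRight (single1 ks (toL2 φs))

theorem proj_apply (F : Seq1 L2R) :
    proj ks φs F = inner ℝ (toL2 φs) (F ks) • single1 ks (toL2 φs) := rfl

theorem proj_single (k : ℕ) (f : L2R) : proj ks φs (single1 k f)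
    = single1 k (if k = ks then inner ℝ (toL2 φs) f • toL2 φs else 0) := by
  rw [proj_apply, single1_apply]
  rcases eq_or_ne k ks with rfl | h
  · rw [if_pos rfl, if_pos rfl, map_smul]
  · rw [if_neg h, if_neg h.symm, inner_zero_right, zero_smul, map_zero]

/-- The weak form of the linear part of the equation. -/
def weakLin (l : ℝ) (Ψ Ψx : L2T H1) : Seq1 L2R →L[ℝ] ℝ :=
  pairT (dy.compLpL 2 volume Ψ) ∘L dy.compLeftContinuous ℝ Torus ∘L D.val
    - (1 - l) • (pairT (toL2.compLpL 2 volume Ψ) ∘L (-(sinL2 ∘L D.sqT)))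
    - α • (pairT (eval0.compLpL 2 volume Ψx) ∘L eval0.compLeftContinuous ℝ Torus ∘L D.valx)

theorem weakLin_apply (l : ℝ) (Ψ Ψx : L2T H1) (F : Seq1 L2R) : D.weakLin l Ψ Ψx F
    = pairT (dy.compLpL 2 volume Ψ) (dy.compLeftContinuous ℝ Torus (D.val F))
      - (1 - l) * pairT (toL2.compLpL 2 volume Ψ) (-(sinL2 (D.sqT F)))
      - α * pairT (eval0.compLpL 2 volume Ψx) (eval0.compLeftContinuous ℝ Torus (D.valx F)) := rfl

theorem solves_mode (k : ℕ) (f : L2R) (ψ : H1) (hψ : k = 0 → ψ = 0) :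
    inner ℝ (dy (D.T k f)) (dy ψ) + (k : ℝ) ^ 2 * (1 - ls) * inner ℝ (toL2 (D.T k f)) (toL2 ψ)
      - (k : ℝ) ^ 2 * α * (eval0 (D.T k f) * eval0 ψ)
    = inner ℝ (f - if k = ks then inner ℝ (toL2 φs) f • toL2 φs else 0) (toL2 ψ) := by
  rcases eq_or_ne k 0 with hk | hk
  · simp [hψ hk]
  rcases eq_or_ne k ks with rfl | h
  · rw [if_pos rfl]
    exact D.solves_crit f ψ
  · rw [if_neg h, sub_zero]
    exact D.solves k f hk h ψ

theorem sinL2_single_eq (k : ℕ) (g : L2R) : sinL2 (single1 k g) = tensC (sinC k) g := by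
  ext1 x
  exact sinL2_single _ _ _

theorem pairT_dy_val_single (Ψ : L2T H1) (k : ℕ) (f : L2R) :
    pairT (dy.compLpL 2 volume Ψ) (dy.compLeftContinuous ℝ Torus (D.val (single1 k f)))
      = inner ℝ (dy (D.T k f)) (dy (∫ x, sinC k x • Ψ x)) := by
  have t : dy.compLeftContinuous ℝ Torus (D.val (single1 k f))
      = tensC (sinC k) (dy (D.T k f)) := by
    rw [val_single]
    ext1 x
    exact map_smul dy _ _
  exact (congrArg (pairT (dy.compLpL 2 volume Ψ)) t).trans (pairT_tensC dy Ψ _ _)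

theorem pairT_sinL2_single (Ψ : L2T H1) (k : ℕ) (g : L2R) :
    pairT (toL2.compLpL 2 volume Ψ) (sinL2 (single1 k g))
      = inner ℝ g (toL2 (∫ x, sinC k x • Ψ x)) :=
  (congrArg (pairT (toL2.compLpL 2 volume Ψ)) (sinL2_single_eq k g)).trans
    (pairT_tensC toL2 Ψ _ _)

theorem pairT_neg_sqT_single (Ψ : L2T H1) (k : ℕ) (f : L2R) :
    pairT (toL2.compLpL 2 volume Ψ) (-(sinL2 (D.sqT (single1 k f))))
      = -((k : ℝ) ^ 2 * inner ℝ (toL2 (D.T k f)) (toL2 (∫ x, sinC k x • Ψ x))) := by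
  refine (map_neg (pairT (toL2.compLpL 2 volume Ψ)) _).trans (congrArg Neg.neg ?_)
  refine (congrArg (fun z => pairT (toL2.compLpL 2 volume Ψ) (sinL2 z)) (D.sqT_single k f)).trans ?_
  exact (pairT_sinL2_single Ψ k _).trans (real_inner_smul_left _ _ _)

theorem pairT_eval0_valx_single {Ψ Ψx : L2T H1} (h : IsWeakDerivT Ψ Ψx) (k : ℕ) (f : L2R) :
    pairT (eval0.compLpL 2 volume Ψx) (eval0.compLeftContinuous ℝ Torus (D.valx (single1 k f)))
      = (k : ℝ) ^ 2 * (eval0 (D.T k f) * eval0 (∫ x, sinC k x • Ψ x)) := by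
  have t : eval0.compLeftContinuous ℝ Torus (D.valx (single1 k f))
      = tensC (cosC k) ((k : ℝ) * eval0 (D.T k f)) := by
    rw [valx_single]
    ext1 x
    refine (map_smul eval0 _ _).trans ?_
    rw [map_smul]
    rfl
  have e : ∀ a b : ℝ, inner ℝ a b = a * b := fun a b => by simp [mul_comm]
  refine (congrArg (pairT (eval0.compLpL 2 volume Ψx)) t).trans
    ((pairT_tensC eval0 Ψx _ _).trans ?_)
  refine (e _ _).trans ?_
  refine (congrArg (fun z => (k : ℝ) * eval0 (D.T k f) * eval0 z)
    (integral_sinMode_smul h k)).trans ?_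
  refine (congrArg (fun z => (k : ℝ) * eval0 (D.T k f) * z) (map_smul eval0 _ _)).trans ?_
  rw [smul_eq_mul]
  ring

theorem weakLin_single (ν : ℝ) {Ψ Ψx : L2T H1} (h : IsWeakDerivT Ψ Ψx) (k : ℕ) (f : L2R) :
    D.weakLin (ls + ν) Ψ Ψx (single1 k f) = inner ℝ
      ((f - if k = ks then inner ℝ (toL2 φs) f • toL2 φs else 0)
        - (ν * (k : ℝ) ^ 2) • toL2 (D.T k f)) (toL2 (∫ x, sinC k x • Ψ x)) := by
  have c1 := D.pairT_dy_val_single Ψ k f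
  have c2 := D.pairT_neg_sqT_single Ψ k f
  have c3 := D.pairT_eval0_valx_single h k f
  have hψ0 : k = 0 → ∫ x, sinC k x • Ψ x = 0 := by
    rintro rfl
    simp [sinC_apply, sinMode_zero]
  have s1 := D.solves_mode k f _ hψ0
  refine (D.weakLin_apply (ls + ν) Ψ Ψx (single1 k f)).trans ?_
  rw [inner_sub_left, ← s1, real_inner_smul_left]
  linear_combination c1 - (1 - (ls + ν)) * c2 - α * c3

/-- On mode `k` the operator at `ls + ν` is the one at `ls` minus `ν k²`. Since `T k` inverts the
latter up to the critical projection, the linear part becomes an operator on coefficient sequences.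
-/
theorem weakLin_eq (ν : ℝ) {Ψ Ψx : L2T H1} (h : IsWeakDerivT Ψ Ψx) (F : Seq1 L2R) :
    D.weakLin (ls + ν) Ψ Ψx F = pairT (toL2.compLpL 2 volume Ψ)
      (sinL2 (F - proj ks φs F - ν • D.sqT F)) := by
  have : D.weakLin (ls + ν) Ψ Ψx = pairT (toL2.compLpL 2 volume Ψ) ∘L sinL2 ∘L
      (ContinuousLinearMap.id ℝ (Seq1 L2R) - proj ks φs - ν • D.sqT) := seq1_clm_ext fun k f => by
    have t : (ContinuousLinearMap.id ℝ (Seq1 L2R) - proj ks φs - ν • D.sqT) (single1 k f)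
        = single1 k ((f - if k = ks then inner ℝ (toL2 φs) f • toL2 φs else 0)
          - (ν * (k : ℝ) ^ 2) • toL2 (D.T k f)) := by
      simp only [sub_apply, smul_apply, ContinuousLinearMap.id_apply, proj_single, sqT_single,
        map_sub, map_smul, mul_smul]
    refine (D.weakLin_single ν h k f).trans ((pairT_sinL2_single Ψ k _).symm.trans ?_)
    exact congrArg (fun z => pairT (toL2.compLpL 2 volume Ψ) (sinL2 z)) t.symm
  exact congrArg (fun A => A F) this

theorem integral_linear_part (l : ℝ) (F : Seq1 L2R) (Ψ : L2T H1) :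
  ∫ x, (inner ℝ (dy (solVal (D.toSol F) x)) (dy (Ψ x))
      - inner ℝ (solDxx (D.toSol F) x - l • (oneLinf • solDxx (D.toSol F) x : L2R))
        (toL2 (Ψ x)))
      = pairT (dy.compLpL 2 volume Ψ) (dy.compLeftContinuous ℝ Torus (D.val F))
        - (1 - l) * pairT (toL2.compLpL 2 volume Ψ) (-(sinL2 (D.sqT F))) := by
  have a1 := dy.coeFn_compLpL (p := 2) (μ := volume) Ψ
  have a2 := toL2.coeFn_compLpL (p := 2) (μ := volume) Ψ
  have b1 := toLpT_ae (D.val F)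
  have b3 := toLpT_ae ((-(sinL2 ∘L D.sqT) : Seq1 L2R →L[ℝ] C(Torus, L2R)) F)
  have q1 := pairT_eq (dy.compLpL 2 volume Ψ) (dy.compLeftContinuous ℝ Torus (D.val F))
  have q2 := pairT_eq (toL2.compLpL 2 volume Ψ) (-(sinL2 (D.sqT F)))
  have i1 := integrable_pairT (dy.compLpL 2 volume Ψ) (dy.compLeftContinuous ℝ Torus (D.val F))
  have i2 := (integrable_pairT (toL2.compLpL 2 volume Ψ) (-(sinL2 (D.sqT F)))).const_mul
    (1 - l)
  have i3 := integral_sub i1 i2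
  rw [integral_const_mul] at i3
  rw [q1, q2, ← i3]
  apply integral_congr_ae
  filter_upwards [a1, a2, b1, b3] with x h1 h2 h3 h4
  have h5 : solVal (D.toSol F) x = D.val F x := h3
  have h6 : solDxx (D.toSol F) x = -(sinL2 (D.sqT F) x) := h4
  have h7 : (dy.compLeftContinuous ℝ Torus (D.val F)) x = dy (D.val F x) := rfl
  have h8 : (-(sinL2 (D.sqT F))) x = -(sinL2 (D.sqT F) x) := rfl
  have h9 : ∀ (u : H1) (w : L2R) (ψ : H1), inner ℝ (dy u) (dy ψ)
      - inner ℝ (w - l • (oneLinf • w : L2R)) (toL2 ψ)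
      = inner ℝ (dy u) (dy ψ) - (1 - l) * inner ℝ w (toL2 ψ) := fun u w ψ => by
    rw [oneLinf_smul, inner_sub_left, real_inner_smul_left]
    ring
  refine (h9 _ _ _).trans (congrArg₂ (· - ·) (congrArg₂ _ ?_ ?_)
    (congrArg _ (congrArg₂ _ ?_ ?_)))
  · exact congrArg dy h5
  · exact h1.symm
  · exact h6
  · exact h2.symm

theorem integral_delta_part (F : Seq1 L2R) (Ψx : L2T H1) :
  ∫ x, (α • delta0) (solDx (D.toSol F) x) (Ψx x)
      = α * pairT (eval0.compLpL 2 volume Ψx) (eval0.compLeftContinuous ℝ Torus (D.valx F)) := by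
  have a3 := eval0.coeFn_compLpL (p := 2) (μ := volume) Ψx
  have b2 := toLpT_ae (D.valx F)
  have q1 := pairT_eq (eval0.compLpL 2 volume Ψx) (eval0.compLeftContinuous ℝ Torus (D.valx F))
  rw [q1, ← integral_const_mul]
  apply integral_congr_ae
  filter_upwards [a3, b2] with x h1 h2
  have h3 : solDx (D.toSol F) x = D.valx F x := h2
  have h4 : (eval0.compLeftContinuous ℝ Torus (D.valx F)) x = eval0 (D.valx F x) := rfl
  have e : ∀ a b : ℝ, inner ℝ a b = a * b := fun a b => by simp [mul_comm]
  rw [h1, h3, h4, e]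
  rfl

theorem integral_smul_neg_sinL2 (Γ : LinfR) (M : Seq1 L2R) (Ψ : L2T H1) :
    ∫ x, inner ℝ (Γ • (toLpT (-sinL2 M) : L2T L2R) x : L2R) (toL2 (Ψ x))
      = -pairT (toL2.compLpL 2 volume Ψ) (sinL2 (smulSeq Γ M)) := by
  rw [pairT_eq, ← integral_neg]
  apply integral_congr_ae
  have e : ∀ v w : L2R, inner ℝ (Γ • (-v) : L2R) w = -inner ℝ (smulL Γ v) w := fun v w => by
    rw [← smulL_apply, map_neg, inner_neg_left]
  filter_upwards [toL2.coeFn_compLpL (p := 2) (μ := volume) Ψ, toLpT_ae (-sinL2 M)] with x h1 h2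
  refine (congrArg₂ (fun (v w : L2R) => inner ℝ (Γ • v : L2R) w) h2 h1.symm).trans ?_
  refine (e _ _).trans (congrArg (fun v : L2R => -inner ℝ v _) (sinL2_smulSeq Γ M x).symm)

theorem isWeakSolution_toSol (Γ : LinfR) (ν : ℝ) (F : Seq1 L2R)
    (hF : F - proj ks φs F - ν • D.sqT F = smulSeq Γ (D.cube F F F)) :
    IsWeakSolution oneLinf (α • delta0) Γ (ls + ν) (D.toSol F) := by
  refine ⟨_, D.isCubeDxx_toSol F, fun Ψ Ψx h => ?_⟩
  have key := D.weakLin_eq ν h F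
  rw [hF, weakLin_apply] at key
  have e1 := D.integral_linear_part (ls + ν) F Ψ
  have e2 := D.integral_delta_part F Ψx
  have e3 := integral_smul_neg_sinL2 Γ (D.cube F F F) Ψ
  linarith

end ModeInverse

/-! ### Bifurcation from a simple kernel -/

section Bifurcation

open scoped ContDiff

variable {E : Type} [NormedAddCommGroup E] [NormedSpace ℝ E] [CompleteSpace E]

/-- Implicit function theorem for `Z` in terms of `s`. The product `l(Z) A(Z - P Z)` is of second
order, so the linearisation in `Z` is the identity without any spectral assumption on `P` or `A`. -/
theorem exists_reduced_curve (e : E) (P A : E →L[ℝ] E) (l : E →L[ℝ] ℝ)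
    (N : E →L[ℝ] E →L[ℝ] E →L[ℝ] E) :
    ∃ Z : ℝ → E, ContDiffAt ℝ ω Z 0 ∧ Z 0 = 0 ∧ HasDerivAt Z (N e e e) 0 ∧
      ∀ᶠ s in 𝓝 (0 : ℝ), Z s - l (Z s) • A (Z s - P (Z s))
        = s • N (e + (Z s - P (Z s))) (e + (Z s - P (Z s))) (e + (Z s - P (Z s))) := by
  let w : ℝ × E → E := fun p => e + (p.2 - P p.2)
  let n : ℝ × E → E := fun p => N (w p) (w p) (w p)
  let G : ℝ × E → E := fun p => p.2 - l p.2 • A (p.2 - P p.2) - p.1 • n p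
  let S : ℝ × E →L[ℝ] E := ContinuousLinearMap.snd ℝ ℝ E
  have hw : ContDiff ℝ ω w := by fun_prop
  have hn : ContDiff ℝ ω n := (((N.contDiff.comp hw).clm_apply hw).clm_apply hw)
  have hG : ContDiffAt ℝ ω G (0, 0) := by
    apply ContDiff.contDiffAt
    fun_prop
  have hd : HasFDerivAt G (S - (ContinuousLinearMap.fst ℝ ℝ E).smulRight (N e e e)) (0, 0) := by
    have h1 : HasFDerivAt (fun p : ℝ × E => p.2) S (0, 0) := hasFDerivAt_snd
    have h2 := (l.hasFDerivAt.comp (0, 0) h1).smul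
      ((A ∘L (ContinuousLinearMap.id ℝ E - P)).hasFDerivAt.comp (0, 0) h1)
    have h3 := (hasFDerivAt_fst (𝕜 := ℝ) (p := ((0 : ℝ), (0 : E)))).smul
      ((hn.differentiable (by simp)) (0, 0)).hasFDerivAt
    refine ((h1.sub h2).sub h3).congr_fderiv ?_
    ext <;> simp [n, w]
  have e1 : fderiv ℝ G (0, 0) ∘L .inr ℝ ℝ E = ContinuousLinearMap.id ℝ E := by
    rw [hd.fderiv]
    ext
    simp [S]
  have e2 : fderiv ℝ G (0, 0) ∘L .inl ℝ ℝ E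
      = -(ContinuousLinearMap.toSpanSingleton ℝ (N e e e)) := by
    rw [hd.fderiv]
    ext
    simp [S]
  have hi : (fderiv ℝ G (0, 0) ∘L .inr ℝ ℝ E).IsInvertible := by
    rw [e1]
    exact ContinuousLinearMap.isInvertible_equiv (f := ContinuousLinearEquiv.refl ℝ E)
  have hω : (ω : WithTop ℕ∞) ≠ 0 := by simp
  refine ⟨hG.implicitFunction hω hi, hG.contDiffAt_implicitFunction hω hi,
    hG.implicitFunction_apply_self hω hi, ?_, ?_⟩
  · have h := (hG.hasStrictFDerivAt_implicitFunction hω hi).hasFDerivAt.hasDerivAt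
    rw [e1, e2] at h
    simpa using h
  · filter_upwards [hG.eventually_apply_implicitFunction hω hi] with s hs
    have h0 : G (0, 0) = 0 := by simp [G]
    rw [h0] at hs
    exact sub_eq_zero.1 hs

/-- The curve is `F = ε (e + (1 - P) Z(ε²))` with `m = l(Z(ε²))`. Dependence on `ε²` reflects the
oddness of the cubic term and forces `m'(0) = 0`. -/
theorem exists_bifurcation_curve (e : E) (P A : E →L[ℝ] E) (l : E →L[ℝ] ℝ)
    (N : E →L[ℝ] E →L[ℝ] E →L[ℝ] E) (hPe : P e = e) (hPP : ∀ Z, P (P Z) = P Z)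
    (hA : ∀ Z, l Z • A e = -P Z) :
    ∃ (F : ℝ → E) (m : ℝ → ℝ), ContDiffAt ℝ ω F 0 ∧ ContDiffAt ℝ ω m 0 ∧
      (∀ᶠ ε in 𝓝 (0 : ℝ), F ε - P (F ε) - m ε • A (F ε) = N (F ε) (F ε) (F ε)) ∧
      F 0 = 0 ∧ HasDerivAt F e 0 ∧ m 0 = 0 ∧ deriv m 0 = 0 ∧
      deriv (deriv m) 0 = 2 * l (N e e e) := by
  obtain ⟨Z, hZ, hZ0, hZd, hZe⟩ := exists_reduced_curve e P A l N
  have t0 : (0 : ℝ) ^ 2 = 0 := by norm_num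
  have hsq : ContDiffAt ℝ ω (fun ε : ℝ => ε ^ 2) 0 := by fun_prop
  have hZs : ContDiffAt ℝ ω (fun ε : ℝ => Z (ε ^ 2)) 0 :=
    ContDiffAt.comp (g := Z) (0 : ℝ) (by rwa [t0]) hsq
  have hm : ContDiffAt ℝ ω (fun ε : ℝ => l (Z (ε ^ 2))) 0 :=
    l.contDiff.contDiffAt.comp (0 : ℝ) hZs
  have hv : ContDiffAt ℝ ω (fun ε : ℝ => e + (Z (ε ^ 2) - P (Z (ε ^ 2)))) 0 :=
    contDiffAt_const.add (hZs.sub (P.contDiff.contDiffAt.comp (0 : ℝ) hZs))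
  have ht : Tendsto (fun ε : ℝ => ε ^ 2) (𝓝 0) (𝓝 0) := by
    have := hsq.continuousAt
    rwa [ContinuousAt, t0] at this
  refine ⟨fun ε => ε • (e + (Z (ε ^ 2) - P (Z (ε ^ 2)))), fun ε => l (Z (ε ^ 2)),
    contDiffAt_id.smul hv, hm, ?_, by simp, ?_, by simp [hZ0], ?_⟩
  · filter_upwards [ht.eventually hZe] with ε hε
    set W := Z (ε ^ 2) - P (Z (ε ^ 2)) with hW
    have hPW : P W = 0 := by rw [hW, map_sub, hPP, sub_self]
    have h1 := hA (Z (ε ^ 2))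
    -- By `hA` the term `-l(Z) A e` supplies the component `P Z` that the left-hand side lacks;
    -- cubic homogeneity then absorbs `ε · ε²`.
    calc _ = ε • (Z (ε ^ 2) - l (Z (ε ^ 2)) • A W) := by
          simp only [map_smul, map_add, hPe, hPW]
          rw [smul_comm, ← smul_sub, ← smul_sub, smul_add, h1, hW]
          congr 1
          abel
      _ = _ := by
          rw [hε]
          simp only [map_smul, smul_apply, smul_smul]
          congr 1
          ring
  · have h := (hasDerivAt_id (0 : ℝ)).smul (hv.differentiableAt (by simp)).hasDerivAt
    have h1 : (id : ℝ → ℝ) 0 • deriv (fun ε : ℝ => e + (Z (ε ^ 2) - P (Z (ε ^ 2)))) 0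
        + (1 : ℝ) • (e + (Z ((0 : ℝ) ^ 2) - P (Z ((0 : ℝ) ^ 2)))) = e := by simp [hZ0]
    exact h.congr_deriv h1
  -- The first derivative is required near `0`, being differentiated again; at `0` the factor `2ε`
  -- leaves only `2 l(Z'(0))`.
  · have hdm : ∀ᶠ ε in 𝓝 (0 : ℝ), deriv (fun ε : ℝ => l (Z (ε ^ 2))) ε
        = l (deriv Z (ε ^ 2)) * (2 * ε) := by
      have := (hZ.eventually (by simp)).mono fun s hs => hs.differentiableAt (by simp)
      filter_upwards [ht.eventually this] with ε hε
      have h1 : HasDerivAt (fun ε : ℝ => ε ^ 2) (2 * ε) ε := by simpa using hasDerivAt_pow 2 ε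
      have h2 := l.hasFDerivAt.comp_hasDerivAt ε (HasDerivAt.scomp (g₁ := fun s : ℝ => Z s) (h := fun ε : ℝ => ε ^ 2) ε hε.hasDerivAt h1)
      have h3 := h2.deriv
      rw [map_smul, smul_eq_mul, mul_comm] at h3
      exact h3
    refine ⟨hdm.self_of_nhds.trans (by simp), ?_⟩
    rw [Filter.EventuallyEq.deriv_eq hdm]
    have hc : DifferentiableAt ℝ (fun ε : ℝ => l (deriv Z (ε ^ 2))) 0 := by
      have h1 : ContDiffAt ℝ 1 (deriv Z) 0 := by
        have := (hZ.analyticAt).deriv.contDiffAt (n := 1)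
        exact this
      have h2 : DifferentiableAt ℝ (deriv Z) ((0 : ℝ) ^ 2) := by
        rw [t0]
        exact h1.differentiableAt (by simp)
      exact l.differentiableAt.comp (0 : ℝ) (DifferentiableAt.comp (f := fun ε : ℝ => ε ^ 2) (0 : ℝ) h2 (hsq.differentiableAt (by simp)))
    have h3 : HasDerivAt (fun ε : ℝ => 2 * ε) 2 0 := by
      simpa using (hasDerivAt_id (0 : ℝ)).const_mul 2
    have h4 := (hc.hasDerivAt.mul h3).deriv
    refine h4.trans ?_
    simp only [mul_zero, zero_add, t0, hZd.deriv]
    ring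

end Bifurcation

/-! ### Curves under bounded linear maps -/

section Curve

variable {E W : Type} [NormedAddCommGroup E] [NormedSpace ℝ E] [NormedAddCommGroup W]
  [NormedSpace ℝ W] (L : E →L[ℝ] W) {F : ℝ → E} {e : E} {x : ℝ}

theorem deriv_clm_comp (h : HasDerivAt F e x) : deriv (fun t => L (F t)) x = L e :=
  (L.hasFDerivAt.comp_hasDerivAt x h).deriv

theorem eventually_clm_comp_ne (h : HasDerivAt F e x) (he : L e ≠ 0) :
    ∀ᶠ t in 𝓝 x, t ≠ x → L (F t) ≠ 0 :=
  eventually_nhdsWithin_iff.1 ((L.hasFDerivAt.comp_hasDerivAt x h).eventually_ne he)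

end Curve

/-! ### The critical coefficient and the curve of solutions -/

theorem signedSingle_apply (n : ℤ) (p : L2R) (k : ℕ) :
    signedSingle n p k = if n.natAbs = k then ((n.sign : ℝ) * (n : ℝ) ^ 2) • p else 0 := by
  have : signedSingle n p k = ((n.sign : ℝ) * (n : ℝ) ^ 2) • (single1 n.natAbs p) k := rfl
  rw [this, single1_apply]
  rcases eq_or_ne k n.natAbs with h | h
  · rw [if_pos h, if_pos h.symm]
  · rw [if_neg h, if_neg h.symm, smul_zero]

theorem smulSeq_apply (Γ : LinfR) (F : Seq1 L2R) (k : ℕ) : smulSeq Γ F k = smulL Γ (F k) := by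
  have : coef1 k ∘L smulSeq Γ = smulL Γ ∘L coef1 k := seq1_clm_ext fun j f => by
    change smulSeq Γ (single1 j f) k = smulL Γ ((single1 j f) k)
    rw [smulSeq_single, single1_apply, single1_apply]
    split_ifs
    · rfl
    · rw [map_zero]
  exact congrArg (fun A => A F) this

namespace ModeInverse

variable {α ls : ℝ} {ks : ℕ} {φs : H1} (D : ModeInverse α ls ks φs)

/-- This is `sin³ = (3/4) sin - (1/4) sin (3 ·)`: three of the four frequency combinations equal
`ks`, and the fourth, `3 ks`, differs from `ks` as `ks ≠ 0`. -/
theorem cube_crit_apply : D.cube (single1 ks (toL2 φs)) (single1 ks (toL2 φs))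
    (single1 ks (toL2 φs)) ks = (3 / 4 * (ks : ℝ) ^ 2) • tripleMul φs φs φs := by
  have hk := D.ks_ne_zero
  have h1 : signedSingle ((ks : ℤ) + ks - ks) (tripleMul φs φs φs) ks
      = ((ks : ℝ) ^ 2) • tripleMul φs φs φs := by
    rw [add_sub_cancel_right, signedSingle_apply, if_pos (Int.natAbs_natCast ks),
      Int.sign_natCast_of_ne_zero hk]
    simp
  have h2 : signedSingle ((ks : ℤ) + ks + ks) (tripleMul φs φs φs) ks = 0 := by
    rw [signedSingle_apply, if_neg (by omega)]
  have e1 : (ks : ℤ) - ks + ks = ks + ks - ks := by ring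
  have e2 : -(ks : ℤ) + ks + ks = ks + ks - ks := by ring
  rw [cube_single, D.T_crit, e1, e2]
  set p := tripleMul φs φs φs
  change (1 / 4 : ℝ) • (signedSingle ((ks : ℤ) + ks - ks) p ks
    + signedSingle ((ks : ℤ) + ks - ks) p ks + signedSingle ((ks : ℤ) + ks - ks) p ks
    - signedSingle ((ks : ℤ) + ks + ks) p ks) = _
  rw [h1, h2]
  module

/-- The shift of the parameter which compensates the critical component of the right-hand side. -/
def shift (ks : ℕ) (φs : H1) : Seq1 L2R →L[ℝ] ℝ :=
  (-((ks : ℝ) ^ 2)⁻¹) • (innerSL ℝ (toL2 φs) ∘L coef1 ks)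

theorem shift_apply (F : Seq1 L2R) :
    shift ks φs F = -((ks : ℝ) ^ 2)⁻¹ * inner ℝ (toL2 φs) (F ks) := rfl

theorem sqT_crit : D.sqT (single1 ks (toL2 φs)) = ((ks : ℝ) ^ 2) • single1 ks (toL2 φs) := by
  rw [sqT_single, D.T_crit, map_smul]

theorem proj_crit (h : inner ℝ (toL2 φs) (toL2 φs) = 1) :
    proj ks φs (single1 ks (toL2 φs)) = single1 ks (toL2 φs) := by
  rw [proj_single, if_pos rfl, h, one_smul]

theorem inner_smulL_tripleMul (Γ : LinfR) (c : ℝ) (φ : H1) :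
    inner ℝ (toL2 φ) (smulL Γ (c • tripleMul φ φ φ)) = c * ∫ y, Γ y * rep φ y ^ 4 := by
  rw [map_smul, real_inner_smul_right, inner_L2R]
  congr 1
  apply integral_congr_ae
  filter_upwards [smulL_coeFn Γ (tripleMul φ φ φ), tripleMul_ae φ φ φ, rep_ae φ] with y h1 h2 h3
  rw [h1, h2, h3]
  ring

theorem shift_cube_crit (Γ : LinfR) :
    shift ks φs (smulSeq Γ (D.cube (single1 ks (toL2 φs)) (single1 ks (toL2 φs))
      (single1 ks (toL2 φs)))) = -(3 / 4) * ∫ y, Γ y * rep φs y ^ 4 := by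
  have hk : (ks : ℝ) ≠ 0 := by exact_mod_cast D.ks_ne_zero
  rw [shift_apply, smulSeq_apply, cube_crit_apply, inner_smulL_tripleMul]
  generalize ∫ y, Γ y * rep φs y ^ 4 = J
  field_simp

theorem solVal_toSol_crit :
    solVal (D.toSol (single1 ks (toL2 φs))) = sinTensor ks φs := by
  rw [solVal_toSol, val_single, D.T_crit, sinTensor_eq]

theorem toSol_crit_ne_zero : D.toSol (single1 ks (toL2 φs)) ≠ 0 := by
  intro h
  have h1 : (toLpT (tensC (sinC ks) φs) : L2T H1) = 0 := by
    rw [← sinTensor_eq, ← solVal_toSol_crit, h]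
    rfl
  have h2 : (tensC (sinC ks) φs : Torus → H1) =ᵐ[volume] fun _ => 0 := by
    filter_upwards [toLpT_ae (tensC (sinC ks) φs), Lp.coeFn_zero H1 2 (volume : Measure Torus)]
      with x e1 e2
    rw [← e1, h1, e2]
    rfl
  -- At `x = π / (2 ks)` the sine equals one, so vanishing there would give `φs = 0`.
  have h3 := congrFun ((tensC (sinC ks) φs).continuous.ae_eq_iff_eq volume continuous_const |>.1 h2)
    ((Real.pi / 2 / ks : ℝ) : Torus)
  have hk : (ks : ℝ) ≠ 0 := by exact_mod_cast D.ks_ne_zero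
  rw [tensC_apply, sinC_apply, sinMode_coe, mul_div_cancel₀ _ hk, Real.sin_pi_div_two,
    one_smul] at h3
  have h4 := D.norm_crit
  rw [h3, map_zero, inner_zero_left] at h4
  exact zero_ne_one h4

set_option maxHeartbeats 1000000 in
theorem deriv_toSol {F : ℝ → Seq1 L2R} {e : Seq1 L2R} {x : ℝ} (h : HasDerivAt F e x) :
    deriv (fun t => D.toSol (F t)) x = D.toSol e :=
  deriv_clm_comp D.toSol h

theorem exists_solution_curve (D : ModeInverse α ls ks φs) (Γ : LinfR) {I : Set ℝ} (hI : I ∈ 𝓝 ls) :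
    ∃ ε₀ : ℝ, 0 < ε₀ ∧ ∃ (Φ : ℝ → SolSpace) (lam : ℝ → ℝ),
      ContDiffOn ℝ (⊤ : ℕ∞) Φ (Ioo (-ε₀) ε₀) ∧ ContDiffOn ℝ (⊤ : ℕ∞) lam (Ioo (-ε₀) ε₀) ∧
      (∀ ε ∈ Ioo (-ε₀) ε₀, lam ε ∈ I ∧ IsSineSeries (solVal (Φ ε)) ∧
        IsWeakSolution oneLinf (α • delta0) Γ (lam ε) (Φ ε) ∧ (ε ≠ 0 → Φ ε ≠ 0)) ∧
      Φ 0 = 0 ∧ solVal (deriv Φ 0) = sinTensor ks φs ∧ lam 0 = ls ∧ deriv lam 0 = 0 ∧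
      deriv (deriv lam) 0 = -(3 / 2) * ∫ y, Γ y * rep φs y ^ 4 := by
  set e : Seq1 L2R := single1 ks (toL2 φs) with he
  have hk : (ks : ℝ) ≠ 0 := by exact_mod_cast D.ks_ne_zero
  obtain ⟨F, m, hF, hm, heq, hF0, hFd, hm0, hmd, hmdd⟩ := exists_bifurcation_curve e
    (proj ks φs) D.sqT (shift ks φs)
    ((ContinuousLinearMap.compL ℝ _ _ _ (ContinuousLinearMap.compL ℝ _ _ _ (smulSeq Γ))) ∘L D.cube)
    (proj_crit D.norm_crit) (fun Z => by
      rw [proj_apply Z, map_smul, proj_crit D.norm_crit])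
    (fun Z => by
      rw [proj_apply, D.sqT_crit, smul_smul, shift_apply, ← neg_smul]
      congr 1
      field_simp)
  have hmdd' : deriv (deriv m) 0 = -(3 / 2) * ∫ y, Γ y * rep φs y ^ 4 := by
    have h : ∀ J : ℝ, 2 * (-(3 / 4) * J) = -(3 / 2) * J := fun J => by ring
    exact hmdd.trans ((congrArg (fun z : ℝ => 2 * z) (D.shift_cube_crit Γ)).trans (h _))
  have hΦ : ContDiffAt ℝ _ (fun ε => D.toSol (F ε)) 0 := D.toSol.contDiff.contDiffAt.comp (0 : ℝ) hF
  have hl : ContDiffAt ℝ _ (fun ε => ls + m ε) 0 := contDiffAt_const.add hm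
  have hne : ∀ᶠ ε in 𝓝 (0 : ℝ), ε ≠ 0 → D.toSol (F ε) ≠ 0 := by
    exact eventually_clm_comp_ne D.toSol hFd D.toSol_crit_ne_zero
  have hlI : ∀ᶠ ε in 𝓝 (0 : ℝ), ls + m ε ∈ I := by
    refine hl.continuousAt.eventually_mem ?_
    rwa [hm0, add_zero]
  -- Analyticity at `0`, unlike mere `C^∞` at a point, passes to a neighbourhood; one radius then
  -- serves all the local conditions.
  have hall := (((hΦ.eventually (by simp)).and (hl.eventually (by simp))).and
    (heq.and (hne.and hlI)))
  obtain ⟨ε₀, hε₀, hb⟩ := Metric.eventually_nhds_iff_ball.1 hall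
  rw [Real.ball_eq_Ioo, zero_sub, zero_add] at hb
  have hder : deriv (fun ε => ls + m ε) = deriv m := funext fun ε => deriv_const_add _
  refine ⟨ε₀, hε₀, fun ε => D.toSol (F ε), fun ε => ls + m ε,
    fun ε hε => ((hb ε hε).1.1.of_le le_top).contDiffWithinAt,
    fun ε hε => ((hb ε hε).1.2.of_le le_top).contDiffWithinAt,
    fun ε hε => ⟨(hb ε hε).2.2.2, D.isSineSeries_toSol _,
      D.isWeakSolution_toSol Γ _ _ (hb ε hε).2.1, (hb ε hε).2.2.1⟩, ?_, ?_, ?_, ?_, ?_⟩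
  · simp only [hF0, map_zero]
  · exact (congrArg (fun u : SolSpace => solVal u) (D.deriv_toSol hFd)).trans
      D.solVal_toSol_crit
  · simp only [hm0, add_zero]
  · exact (congrFun hder 0).trans hmd
  · exact (congrArg (fun g => deriv g 0) hder).trans hmdd'

end ModeInverse

end TravWave

end

theorem corollary2p5 (Γ : TravWave.LinfR) (ks : ℕ) (hks : 1 ≤ ks) (ls : ℝ) (hls : ls < 1)
    (α : ℝ) (hα : α = 2 * Real.sqrt (1 - ls) / (ks : ℝ)) :
    ∃ (φs : TravWave.H1) (I : Set ℝ),
      (∀ y : ℝ, TravWave.rep φs y = Real.sqrt ((ks : ℝ) * Real.sqrt (1 - ls)) *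
        Real.exp (-((ks : ℝ) * Real.sqrt (1 - ls) * |y|))) ∧
      TravWave.BifurcationHyp TravWave.oneLinf (α • TravWave.delta0) ks ls I φs ∧
      ∃ ε₀ : ℝ, 0 < ε₀ ∧ ∃ (Φ : ℝ → TravWave.SolSpace) (lam : ℝ → ℝ),
        ContDiffOn ℝ (⊤ : ℕ∞) Φ (Ioo (-ε₀) ε₀) ∧
        ContDiffOn ℝ (⊤ : ℕ∞) lam (Ioo (-ε₀) ε₀) ∧
        (∀ ε ∈ Ioo (-ε₀) ε₀,
          lam ε ∈ I ∧
          TravWave.IsSineSeries (TravWave.solVal (Φ ε)) ∧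
          TravWave.IsWeakSolution TravWave.oneLinf (α • TravWave.delta0) Γ (lam ε) (Φ ε) ∧
          (ε ≠ 0 → Φ ε ≠ 0)) ∧
        Φ 0 = 0 ∧
        TravWave.solVal (deriv Φ 0) = TravWave.sinTensor ks φs ∧
        lam 0 = ls ∧
        deriv lam 0 = 0 ∧
        deriv (deriv lam) 0 = -(3 / 2) * (ks : ℝ) ^ 2 * (1 - ls) *
          ∫ y : ℝ, Γ y * Real.exp (-(4 * (ks : ℝ) * Real.sqrt (1 - ls) * |y|)) := by
  have h1 : 0 < 1 - ls := by linarith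
  have hk : (1 : ℝ) ≤ ks := by exact_mod_cast hks
  have hκ : 0 < (ks : ℝ) * Real.sqrt (1 - ls) := by positivity
  have hyp := TravWave.bifurcationHyp_delta hks hls hα hκ
  obtain ⟨D⟩ := TravWave.nonempty_modeInverse hks hls hα hκ
  obtain ⟨ε₀, hε₀, Φ, lam, h2, h3, h4, h5, h6, h7, h8, h9⟩ :=
    D.exists_solution_curve Γ (hyp.isOpen_I.mem_nhds hyp.mem_I)
  refine ⟨_, _, fun y => ?_, hyp, ε₀, hε₀, Φ, lam, h2, h3, h4, h5, h6, h7, h8, h9.trans ?_⟩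
  · rw [TravWave.rep_critMode]
  -- The normalisation `√κ` contributes `κ² = ks² (1 - ls)` to the fourth power.
  · have e : ∀ y, Γ y * TravWave.rep (TravWave.critMode _ hκ) y ^ 4 = (ks : ℝ) ^ 2 * (1 - ls) *
        (Γ y * Real.exp (-(4 * (ks : ℝ) * Real.sqrt (1 - ls) * |y|))) := fun y => by
      rw [TravWave.rep_critMode, mul_pow, ← Real.exp_nat_mul,
        show (4 : ℕ) = 2 * 2 from rfl, pow_mul, Real.sq_sqrt hκ.le, mul_pow, Real.sq_sqrt h1.le]
      push_cast
      ring_nf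
    simp only [e]
    rw [integral_const_mul]
    ring
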